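/- Let $\alpha>-2$, $\beta<-2$ and $C_\infty>0$. For $\ell\in\mathbb N_0$ put $$F_\ell(r)=\sqrt r\,J_{\frac{2\ell+1}{2+\beta}}\Bigl(\tfrac{-2C_\infty^{1/2}}{2+\beta}r^{\frac{2+\beta}2}\Bigr),\qquad G_\ell(r)=\sqrt r\,Y_{\frac{2\ell+1}{2+\beta}}\Bigl(\tfrac{-2C_\infty^{1/2}}{2+\beta}r^{\frac{2+\beta}2}\Bigr),\qquad r>0,$$ where $J_\nu,Y_\nu$ are the Bessel functions of the first and second kind. Fix a real-valued smooth function $\xi$ on $(0,\infty)$ with $\xi=1$ on $(0,1)$ and $\xi=0$ on $(2,\infty)$. Let $H_{\infty,\ell,\min}$ be the closure in $L^2(\mathbb R_+)$ of $-\frac{d^2}{dr^2}+\frac{\ell(\ell+1)}{r^2}-C_\infty r^\beta$ on $C_0^\infty(\mathbb R_+)$, and for $\theta\in[0,\pi)$ let $H_{\infty,\ell,\theta}$ be its extension, acting by the same differential expression, with domain $$D(H_{\infty,\ell,\min})\oplus\mathbb C\,\xi(\cos\theta\,F_\ell+\sin\theta\,G_\ell).$$ For $\tau\in\mathbb R$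 let $\theta_\ell=\theta_\ell(\tau)\in[0,\pi)$ be the number with $$\frac{\theta_\ell}{\pi}\equiv\tau-\frac{2\ell+1}{4+2\alpha}-\frac{2\ell+1}{4+2\beta}-\frac12\pmod 1 .$$ Let $U\psi(r,\omega)=r\psi(r\omega)$, which maps $L^2(\mathbb R^3)$ unitarily onto $L^2(\mathbb R_+)\otimes L^2(S^2)$, and let the infinite atom $H_{\infty,\tau}$ be the operator on $L^2(\mathbb R^3)$ such that $UH_{\infty,\tau}U^{-1}$ is the closure of the operator which maps a finite sum $\sum_j\phi_j\otimes Y_j$, with $Y_j$ a spherical harmonic of degree $\ell_j$ and $\phi_j\in D(H_{\infty,\ell_j,\theta_{\ell_j}})$, to $\sum_j H_{\infty,\ell_j,\theta_{\ell_j}}\phi_j\otimes Y_j$. Then each $H_{\infty,\tau}$ is a well-defined self-adjoint operator, and the following hold. 1. If $\tau_n\to\tau_0$ modulo $1$ (real numbers), then $H_{\infty,\tau_n}\to H_{\infty,\tau_0}$ in the strong resolvent sense, that is, $(H_{\infty,\tau_n}+i)^{-1}\psi\to(H_{\infty,\tau_0}+i)^{-1}\psi$ for every $\psi\in L^2(\mathbb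 R^3)$. 2. The infinite atoms are continuously parametrized by the circle: $e^{2\pi i\tau}\mapsto H_{\infty,\tau}$ is a well-defined injective map on $S^1$, and it is continuous in the strong resolvent sense. -/

import Mathlib

open MeasureTheory Set Filter Topology
open scoped ContDiff

noncomputable section

namespace InfiniteAtom

/-! ### Bessel functions -/

/-- The Bessel function of the first kind `J_ν(x)` of real order `ν`, for `x > 0`:
`∑ₘ (-1)ᵐ / (m! Γ(m + ν + 1)) (x/2)^(2m+ν)`, where `1/Γ` is understood to vanish at the poles of
`Γ` (Mathlib has `Γ = 0` and `a / 0 = 0` there). -/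
def besselJ (ν x : ℝ) : ℝ :=
  ∑' m : ℕ, (-1) ^ m / ((m.factorial : ℝ) * Real.Gamma (m + ν + 1)) * (x / 2) ^ (2 * (m : ℝ) + ν)

/-- `(J_ν(x) cos νπ - J_{-ν}(x)) / sin νπ`, meaningful for `ν` not an integer. -/
def besselYQuotient (ν x : ℝ) : ℝ :=
  (besselJ ν x * Real.cos (ν * Real.pi) - besselJ (-ν) x) / Real.sin (ν * Real.pi)

open Classical in
/-- The Bessel function of the second kind `Y_ν(x)` of real order `ν`, for `x > 0`; at integer
orders the quotient is replaced by its limiting value. -/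
def besselY (ν x : ℝ) : ℝ :=
  if ∃ n : ℤ, ν = n then limUnder (𝓝[≠] ν) (fun μ => besselYQuotient μ x)
  else besselYQuotient ν x

/-! ### The radial operators on `L²(ℝ₊)` -/

/-- `L²(ℝ₊)`. -/
abbrev RadialL2 : Type := Lp ℂ 2 (volume.restrict (Ioi (0 : ℝ)))

/-- `L²(ℝ³)`. -/
abbrev SpaceL2 : Type := Lp ℂ 2 (volume : Measure (EuclideanSpace ℝ (Fin 3)))

/-- The differential expression `-u'' + (ℓ(ℓ+1)/r² - C r^β) u`. -/
def radialExpr (β C : ℝ) (l : ℕ) (u : ℝ → ℂ) (r : ℝ) : ℂ :=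
  -deriv (deriv u) r + (((l : ℝ) * (l + 1) / r ^ 2 - C * r ^ β : ℝ) : ℂ) * u r

/-- The graph of the minimal operator: the closure in `L²(ℝ₊) × L²(ℝ₊)` of the graph of the
differential expression on `C₀^∞(ℝ₊)`. -/
def minGraph (β C : ℝ) (l : ℕ) : Submodule ℂ (RadialL2 × RadialL2) :=
  (Submodule.span ℂ {q : RadialL2 × RadialL2 |
    ∃ u : ℝ → ℂ, ContDiff ℝ ∞ u ∧ HasCompactSupport u ∧ tsupport u ⊆ Ioi 0 ∧
      (∀ᵐ r ∂(volume.restrict (Ioi (0 : ℝ))), q.1 r = u r) ∧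
      (∀ᵐ r ∂(volume.restrict (Ioi (0 : ℝ))), q.2 r = radialExpr β C l u r)}).topologicalClosure

/-- `F(r) = √r J_{(2ℓ+1)/(2+β)}(-2 C^{1/2} / (2+β) · r^{(2+β)/2})`. -/
def solF (β C : ℝ) (l : ℕ) (r : ℝ) : ℝ :=
  √r * besselJ ((2 * (l : ℝ) + 1) / (2 + β)) (-2 * √C / (2 + β) * r ^ ((2 + β) / 2))

/-- `G(r) = √r Y_{(2ℓ+1)/(2+β)}(-2 C^{1/2} / (2+β) · r^{(2+β)/2})`. -/
def solG (β C : ℝ) (l : ℕ) (r : ℝ) : ℝ :=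
  √r * besselY ((2 * (l : ℝ) + 1) / (2 + β)) (-2 * √C / (2 + β) * r ^ ((2 + β) / 2))

/-- A smooth localizing function: `1` on `(0,1)` and `0` on `(2,∞)`. -/
structure IsLocalizer (ξ : ℝ → ℝ) : Prop where
  smooth : ContDiffOn ℝ ∞ ξ (Ioi 0)
  eq_one : ∀ r ∈ Ioo (0 : ℝ) 1, ξ r = 1
  eq_zero : ∀ r ∈ Ioi (2 : ℝ), ξ r = 0

/-- The function `ξ (cos θ F + sin θ G)` generating the boundary condition at the origin. -/
def boundaryFun (β C : ℝ) (ξ : ℝ → ℝ) (l : ℕ) (θ : ℝ) (r : ℝ) : ℂ :=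
  ((ξ r * (Real.cos θ * solF β C l r + Real.sin θ * solG β C l r) : ℝ) : ℂ)

/-- The graph of the extension of the minimal operator with domain
`D(H_min) ⊕ ℂ ξ (cos θ F + sin θ G)`, acting on the added function by the differential
expression. -/
def radialGraph (β C : ℝ) (ξ : ℝ → ℝ) (l : ℕ) (θ : ℝ) : Submodule ℂ (RadialL2 × RadialL2) :=
  minGraph β C l ⊔ Submodule.span ℂ {q : RadialL2 × RadialL2 |
    (∀ᵐ r ∂(volume.restrict (Ioi (0 : ℝ))), q.1 r = boundaryFun β C ξ l θ r) ∧
    (∀ᵐ r ∂(volume.restrict (Ioi (0 : ℝ))),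
      q.2 r = radialExpr β C l (boundaryFun β C ξ l θ) r)}

/-! ### The operators on `L²(ℝ³)` -/

/-- `p` is a harmonic homogeneous polynomial of degree `l` in three variables. The restrictions of
these polynomials to the unit sphere are the spherical harmonics of degree `l`, that is, the span
of `Y_l^m`, `m = -l, …, l`. -/
def IsSolidHarmonic (l : ℕ) (p : MvPolynomial (Fin 3) ℂ) : Prop :=
  p.IsHomogeneous l ∧ ∑ i, MvPolynomial.pderiv i (MvPolynomial.pderiv i p) = 0

/-- `Ψ = U⁻¹(φ ⊗ Y)` where `Uψ(r,ω) = r ψ(rω)` and `Y` is the restriction of `p` to the unit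
sphere, i.e. `Ψ(x) = |x|⁻¹ φ(|x|) Y(x/|x|)`. -/
def IsTensor (φ : RadialL2) (p : MvPolynomial (Fin 3) ℂ) (Ψ : SpaceL2) : Prop :=
  ∀ᵐ x : EuclideanSpace ℝ (Fin 3),
    Ψ x = ((‖x‖⁻¹ : ℝ) : ℂ) * φ ‖x‖ * MvPolynomial.eval (fun i => ((‖x‖⁻¹ * x i : ℝ) : ℂ)) p

/-- The graph of `H_{∞,{θ_ℓ}}`: the closure in `L²(ℝ³) × L²(ℝ³)` of the graph of the operator
`∑ φ_ℓ^m ⊗ Y_ℓ^m ↦ ∑ H_{∞,ℓ,θ_ℓ} φ_ℓ^m ⊗ Y_ℓ^m` on finite sums with `φ_ℓ^m ∈ D(H_{∞,ℓ,θ_ℓ})`. -/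
def atomGraph (β C : ℝ) (ξ : ℝ → ℝ) (θ : ℕ → ℝ) : Submodule ℂ (SpaceL2 × SpaceL2) :=
  (Submodule.span ℂ {q : SpaceL2 × SpaceL2 |
    ∃ (l : ℕ) (p : MvPolynomial (Fin 3) ℂ) (φ ψ : RadialL2), IsSolidHarmonic l p ∧
      (φ, ψ) ∈ radialGraph β C ξ l (θ l) ∧
      IsTensor φ p q.1 ∧ IsTensor ψ p q.2}).topologicalClosure

/-- The operator `H_{∞,{θ_ℓ}}` on `L²(ℝ³)`. -/
def atomOperator (β C : ℝ) (ξ : ℝ → ℝ) (θ : ℕ → ℝ) : SpaceL2 →ₗ.[ℂ] SpaceL2 :=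
  (atomGraph β C ξ θ).toLinearPMap

/-- The number `θ_ℓ ∈ [0,π)` with
`θ_ℓ/π = τ - (2ℓ+1)/(4+2α) - (2ℓ+1)/(4+2β) - 1/2` modulo `1`. -/
def angle (α β τ : ℝ) (l : ℕ) : ℝ :=
  Real.pi * Int.fract
    (τ - (2 * (l : ℝ) + 1) / (4 + 2 * α) - (2 * (l : ℝ) + 1) / (4 + 2 * β) - 1 / 2)

/-- The infinite atom `H_{∞,τ}`. -/
def infiniteAtom (α β C : ℝ) (ξ : ℝ → ℝ) (τ : ℝ) : SpaceL2 →ₗ.[ℂ] SpaceL2 :=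
  atomOperator β C ξ (angle α β τ)

/-! ### Strong resolvent convergence -/

/-- `R` is the resolvent `(A + i)⁻¹`: an everywhere defined bounded two-sided inverse of
`A + i : D(A) → E`. -/
def IsResolvent {E : Type*} [NormedAddCommGroup E] [InnerProductSpace ℂ E]
    (A : E →ₗ.[ℂ] E) (R : E →L[ℂ] E) : Prop :=
  ∀ φ ψ : E, R ψ = φ ↔ ∃ x : A.domain, (x : E) = φ ∧ A x + Complex.I • (x : E) = ψ

/-- Strong resolvent convergence along a filter of self-adjoint operators `A i` to the self-adjoint
operator `A₀`: the resolvents `(A i + i)⁻¹` converge strongly to `(A₀ + i)⁻¹`. -/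
def StrongResolventTendsto {ι E : Type*} [NormedAddCommGroup E] [InnerProductSpace ℂ E]
    [CompleteSpace E] (A : ι → E →ₗ.[ℂ] E) (f : Filter ι) (A₀ : E →ₗ.[ℂ] E) : Prop :=
  (∀ i, IsSelfAdjoint (A i)) ∧ IsSelfAdjoint A₀ ∧
    ∃ (R : ι → E →L[ℂ] E) (R₀ : E →L[ℂ] E), (∀ i, IsResolvent (A i) (R i)) ∧ IsResolvent A₀ R₀ ∧
      ∀ ψ : E, Tendsto (fun i => R i ψ) f (𝓝 (R₀ ψ))

end InfiniteAtom

end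

/-!
The radial operator with angle `θ` and the infinite atoms are treated as closed linear relations,
that is, as subspaces of `E × E`. A closed symmetric relation with dense domain on which `A + i` and
`A - i` have dense range is the graph of a self-adjoint operator with contractive resolvents
(`IsSelfAdjointGraph`). Strong resolvent convergence then follows once every generator of the limit
graph is approximated by elements of the approximating graphs
(`strongResolventTendsto_of_graph`).

For the radial operators, the functions `F` and `G` are a fundamental system of solutions of
`-u'' + V u = 0`, bounded near the origin, with constant nonzero Wronskian
(`exists_fundamental_system`); this includes the integer orders, where `Y` is a limit of quotients.
Green's formula turns the failure of symmetry into a Wronskian at the origin (`tendsto_wronskian`).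
It vanishes for two functions with the same boundary condition, which gives symmetry
(`isSymmGraph_radialGraph`). If `h` is orthogonal to the range of `A - z` with `z` not real, then
`h` is a classical solution of `-h'' + V h = z̄ h` which satisfies the boundary condition, so the
imaginary part of `h' h̄` vanishes at the origin and is monotone; since `h` is square integrable
this forces `h = 0` (`eq_zero_of_orthogonal`).

On `ℝ³`, spherical harmonics of different degrees are orthogonal because integration by parts
against a Gaussian weight evaluates `∫ ∇p · ∇q` as a multiple of `∫ p q` in two ways
(`sphInner_eq_zero`), and the functions `r⁻¹ φ(r) Y(s)` span a dense subspace because polynomials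
are sums of terms `|x|^(2k) h` with `h` harmonic (`mem_harmonicSpan`) and are dense by
Stone–Weierstrass (`eq_zero_of_inner_tensor`). Together with the radial results this makes every
infinite atom self-adjoint (`isSelfAdjointGraph_atomGraph`).

A boundary condition depends only on the line spanned by `(cos θ, sin θ)`, hence on `2θ` modulo
`2π`, and the added vector, rescaled by `cos (θ - θ₀)`, is continuous in it
(`exists_tendsto_radialGraph`); this yields continuity on the circle in spite of the jump of the
angle from `π` to `0`. Injectivity holds because two different angles at `ℓ = 0` give functions
whose Wronskian `sin (θ' - θ) w` is nonzero, so that they cannot lie in the domain of one symmetric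
operator (`eq_of_isSymm_boundary`).
-/

noncomputable section

namespace InfiniteAtom

/-! ### Symmetric graphs with dense ranges -/

section Abstract

variable {E : Type*} [NormedAddCommGroup E] [InnerProductSpace ℂ E]

/-- A linear relation `Γ ⊆ E × E` is symmetric if `⟪ψ, φ'⟫ = ⟪φ, ψ'⟫` for all
`(φ, ψ), (φ', ψ') ∈ Γ`. -/
def IsSymmGraph (Γ : Submodule ℂ (E × E)) : Prop :=
  ∀ p ∈ Γ, ∀ q ∈ Γ, inner ℂ p.2 q.1 = inner ℂ p.1 q.2

/-- Symmetry of a relation may be checked on generators. -/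
lemma isSymmGraph_span {S : Set (E × E)}
    (h : ∀ p ∈ S, ∀ q ∈ S, inner ℂ p.2 q.1 = inner ℂ p.1 q.2) :
    IsSymmGraph (Submodule.span ℂ S) := by
  intro p hp q hq
  induction hp, hq using Submodule.span_induction₂ with
  | mem_mem x y hx hy => exact h x hx y hy
  | zero_left y hy => simp
  | zero_right x hx => simp
  | add_left x y z _ _ _ h1 h2 => simp [h1, h2]
  | add_right x y z _ _ _ h1 h2 => simp [h1, h2]
  | smul_left r x y _ _ h => simp [h]
  | smul_right r x y _ _ h => simp [h]

lemma IsSymmGraph.topologicalClosure {Γ : Submodule ℂ (E × E)} (h : IsSymmGraph Γ) :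
    IsSymmGraph Γ.topologicalClosure := by
  have hc : IsClosed {z : (E × E) × (E × E) | inner ℂ z.1.2 z.2.1 = inner ℂ z.1.1 z.2.2} :=
    isClosed_eq (by fun_prop) (by fun_prop)
  intro p hp q hq
  have hpq : (p, q) ∈ closure ((Γ : Set (E × E)) ×ˢ (Γ : Set (E × E))) := by
    rw [closure_prod_eq]; exact ⟨hp, hq⟩
  exact closure_minimal (fun z hz => h z.1 hz.1 z.2 hz.2) hc hpq

/-- The map `(φ, ψ) ↦ ψ + s φ`. -/
def shiftMap (E : Type*) [NormedAddCommGroup E] [InnerProductSpace ℂ E] (s : ℂ) :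
    E × E →L[ℂ] E :=
  ContinuousLinearMap.snd ℂ E E + s • ContinuousLinearMap.fst ℂ E E

lemma shiftMap_apply (s : ℂ) (q : E × E) : shiftMap E s q = q.2 + s • q.1 := rfl

/-- For symmetric `A` the cross terms in `‖(A ± i) φ‖²` cancel. -/
lemma IsSymmGraph.norm_shiftMap_sq {Γ : Submodule ℂ (E × E)} (h : IsSymmGraph Γ) {s : ℂ}
    (hs : s = Complex.I ∨ s = -Complex.I) {q : E × E} (hq : q ∈ Γ) :
    ‖shiftMap E s q‖ ^ 2 = ‖q.2‖ ^ 2 + ‖q.1‖ ^ 2 := by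
  have him : (inner ℂ q.2 q.1 : ℂ).im = 0 := by
    have h1 := h q hq q hq
    have h2 := inner_conj_symm (𝕜 := ℂ) q.2 q.1
    rw [← h1] at h2
    exact Complex.conj_eq_iff_im.1 h2
  have hn : ‖s‖ = 1 := by rcases hs with rfl | rfl <;> simp
  have hre : s.re = 0 := by rcases hs with rfl | rfl <;> simp
  have hc : RCLike.re (inner ℂ q.2 (s • q.1)) = 0 := by
    rw [inner_smul_right]
    simp [him, hre]
  rw [shiftMap_apply, norm_add_sq (𝕜 := ℂ), hc, norm_smul, hn]
  ring

lemma IsSymmGraph.norm_fst_le {Γ : Submodule ℂ (E × E)} (h : IsSymmGraph Γ) {s : ℂ}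
    (hs : s = Complex.I ∨ s = -Complex.I) {q : E × E} (hq : q ∈ Γ) :
    ‖q.1‖ ≤ ‖shiftMap E s q‖ := by
  refine le_of_sq_le_sq ?_ (norm_nonneg _)
  rw [h.norm_shiftMap_sq hs hq]
  nlinarith [sq_nonneg ‖q.2‖]

lemma IsSymmGraph.norm_le {Γ : Submodule ℂ (E × E)} (h : IsSymmGraph Γ) {s : ℂ}
    (hs : s = Complex.I ∨ s = -Complex.I) {q : E × E} (hq : q ∈ Γ) :
    ‖q‖ ≤ ‖shiftMap E s q‖ := by
  refine max_le (h.norm_fst_le hs hq) (le_of_sq_le_sq ?_ (norm_nonneg _))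
  rw [h.norm_shiftMap_sq hs hq]
  nlinarith [sq_nonneg ‖q.1‖]

/-- A symmetric relation with dense domain is the graph of an operator. -/
lemma IsSymmGraph.snd_eq_zero {Γ : Submodule ℂ (E × E)} (h : IsSymmGraph Γ)
    (hd : Dense (Γ.map (LinearMap.fst ℂ E E) : Set E)) :
    ∀ x ∈ Γ, x.1 = 0 → x.2 = 0 := by
  intro x hx hx0
  refine hd.eq_zero_of_inner_left ℂ ?_
  rintro _ ⟨y, hy, rfl⟩
  have := h x hx y hy
  simpa [hx0] using this

/-- A closed symmetric `A` such that `A ± i` has dense range has `A ± i` surjective: the range is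
closed because `A ± i` is bounded below. -/
lemma IsSymmGraph.surjOn_shiftMap [CompleteSpace E] {Γ : Submodule ℂ (E × E)}
    (h : IsSymmGraph Γ) {s : ℂ} (hs : s = Complex.I ∨ s = -Complex.I) (hcl : IsClosed (Γ : Set (E × E)))
    (hd : Dense (shiftMap E s '' Γ)) (ψ : E) : ∃ q ∈ Γ, shiftMap E s q = ψ := by
  have : CompleteSpace Γ := hcl.completeSpace_coe
  let f : Γ →L[ℂ] E := (shiftMap E s).comp Γ.subtypeL
  have ha : AntilipschitzWith 1 f := by
    refine AddMonoidHomClass.antilipschitz_of_bound f fun x => ?_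
    rw [NNReal.coe_one, one_mul]
    exact h.norm_le hs x.2
  have hc : IsClosed (range f) := ha.isClosed_range f.uniformContinuous
  have hr : range f = shiftMap E s '' Γ := by
    ext y
    simp [f]
  have : ψ ∈ range f := by
    rw [← hc.closure_eq, hr]
    exact hd ψ
  rw [hr] at this
  exact this

/-- The data of a closed symmetric relation with dense domain such that `A + i` and `A - i` have
dense range: the basic criterion for self-adjointness in terms of the graph. -/
structure IsSelfAdjointGraph (Γ : Submodule ℂ (E × E)) : Prop where
  symm : IsSymmGraph Γ
  closed : IsClosed (Γ : Set (E × E))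
  dense_dom : Dense (Γ.map (LinearMap.fst ℂ E E) : Set E)
  dense_range : ∀ s, s = Complex.I ∨ s = -Complex.I → Dense (shiftMap E s '' Γ)

namespace IsSelfAdjointGraph

variable {Γ : Submodule ℂ (E × E)}

lemma graph_eq (h : IsSelfAdjointGraph Γ) : Γ.toLinearPMap.graph = Γ :=
  Submodule.toLinearPMap_graph_eq _ (h.symm.snd_eq_zero h.dense_dom)

lemma isSelfAdjoint [CompleteSpace E] (h : IsSelfAdjointGraph Γ) :
    IsSelfAdjoint Γ.toLinearPMap := by
  have hd : Dense (Γ.toLinearPMap.domain : Set E) := h.dense_dom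
  rw [LinearPMap.isSelfAdjoint_def]
  apply LinearPMap.eq_of_eq_graph
  rw [LinearPMap.adjoint_graph_eq_graph_adjoint hd, h.graph_eq]
  apply le_antisymm
  · intro x hx
    rw [Submodule.mem_adjoint_iff] at hx
    obtain ⟨q, hq, hqx⟩ := h.symm.surjOn_shiftMap (Or.inl rfl) h.closed
      (h.dense_range _ (Or.inl rfl)) (shiftMap E Complex.I x)
    have h0 : x.1 - q.1 = 0 := by
      obtain ⟨p, hp, hpx⟩ := h.symm.surjOn_shiftMap (Or.inr rfl) h.closed
        (h.dense_range _ (Or.inr rfl)) (x.1 - q.1)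
      -- `x.1 - q.1` is orthogonal to the range of `A - i`.
      have h1 := hx p.1 p.2 hp
      have h2 := h.symm p hp q hq
      rw [shiftMap_apply, shiftMap_apply] at hqx
      have h3 : x.2 - q.2 = -(Complex.I • (x.1 - q.1)) := by
        rw [smul_sub]
        rw [add_comm, ← sub_eq_zero] at hqx
        rw [← sub_eq_zero, ← neg_eq_zero, ← hqx]
        abel
      have h4 : inner ℂ (shiftMap E (-Complex.I) p) (x.1 - q.1) = (0 : ℂ) := by
        have h5 : inner ℂ p.2 (x.1 - q.1) - inner ℂ p.1 (x.2 - q.2) = (0 : ℂ) := by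
          rw [inner_sub_right, inner_sub_right]
          linear_combination h1 - h2
        rw [h3, inner_neg_right, inner_smul_right] at h5
        rw [shiftMap_apply, inner_add_left, inner_smul_left]
        simp only [map_neg, Complex.conj_I, neg_neg]
        linear_combination h5
      rw [hpx] at h4
      exact inner_self_eq_zero.1 h4
    have h1 : x.1 = q.1 := sub_eq_zero.1 h0
    have h2 : x.2 = q.2 := by
      rw [shiftMap_apply, shiftMap_apply, h1] at hqx
      exact (add_right_cancel hqx).symm
    rwa [Prod.ext h1 h2]
  · intro x hx
    rw [Submodule.mem_adjoint_iff]
    intro a b hab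
    rw [sub_eq_zero]
    exact h.symm (a, b) hab x hx

/-- The resolvent at `-i` of a self-adjoint graph is a contraction. -/
lemma exists_resolvent [CompleteSpace E] (h : IsSelfAdjointGraph Γ) :
    ∃ R : E →L[ℂ] E, (∀ ψ, ‖R ψ‖ ≤ ‖ψ‖) ∧ IsResolvent Γ.toLinearPMap R ∧
      ∀ q ∈ Γ, R (shiftMap E Complex.I q) = q.1 := by
  have hs : Complex.I = Complex.I ∨ Complex.I = -Complex.I := Or.inl rfl
  have inj : ∀ p ∈ Γ, ∀ q ∈ Γ, shiftMap E Complex.I p = shiftMap E Complex.I q → p = q := by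
    intro p hp q hq hpq
    have := h.symm.norm_le hs (Γ.sub_mem hp hq)
    rw [map_sub, hpq, sub_self, norm_zero] at this
    exact sub_eq_zero.1 (norm_le_zero_iff.1 this)
  choose f hf hf' using h.symm.surjOn_shiftMap hs h.closed (h.dense_range _ hs)
  let R₀ : E →ₗ[ℂ] E :=
    { toFun := fun ψ => (f ψ).1
      map_add' := fun a b => by
        rw [inj (f (a + b)) (hf _) (f a + f b) (Γ.add_mem (hf _) (hf _)) (by simp [hf'])]
        rfl
      map_smul' := fun c a => by
        rw [inj (f (c • a)) (hf _) (c • f a) (Γ.smul_mem _ (hf _)) (by simp [hf'])]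
        rfl }
  have hR : ∀ ψ, ‖R₀ ψ‖ ≤ ‖ψ‖ := fun ψ => by
    have := h.symm.norm_fst_le hs (hf ψ)
    rwa [hf'] at this
  have hR' : ∀ q ∈ Γ, R₀ (shiftMap E Complex.I q) = q.1 := fun q hq => by
    change (f _).1 = _
    rw [inj _ (hf _) q hq (hf' _)]
  refine ⟨R₀.mkContinuous 1 (by simpa using hR), hR, ?_, hR'⟩
  intro φ ψ
  change R₀ ψ = φ ↔ _
  constructor
  · rintro rfl
    have hm : f ψ ∈ Γ.toLinearPMap.graph := by rw [h.graph_eq]; exact hf ψ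
    obtain ⟨x, hx1, hx2⟩ := (LinearPMap.mem_graph_iff _).1 hm
    refine ⟨x, hx1, ?_⟩
    rw [hx1, hx2]
    exact hf' ψ
  · rintro ⟨x, rfl, rfl⟩
    have hm : ((x : E), Γ.toLinearPMap x) ∈ Γ := by
      have := Γ.toLinearPMap.mem_graph x
      rwa [h.graph_eq] at this
    exact hR' _ hm

end IsSelfAdjointGraph

/-- Self-adjoint operators converge in the strong resolvent sense as soon as every generator of the
limiting graph is a limit of elements of the approximating graphs. -/
lemma strongResolventTendsto_of_graph [CompleteSpace E] {ι : Type*} {f : Filter ι}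
    {Γ : ι → Submodule ℂ (E × E)} {S : Set (E × E)} (h : ∀ i, IsSelfAdjointGraph (Γ i))
    (h₀ : IsSelfAdjointGraph (Submodule.span ℂ S).topologicalClosure)
    (hS : ∀ q ∈ S, ∃ p : ι → E × E, (∀ i, p i ∈ Γ i) ∧ Tendsto p f (𝓝 q)) :
    StrongResolventTendsto (fun i => (Γ i).toLinearPMap) f
      (Submodule.span ℂ S).topologicalClosure.toLinearPMap := by
  refine ⟨fun i => (h i).isSelfAdjoint, h₀.isSelfAdjoint, ?_⟩
  choose R hR1 hR2 hR3 using fun i => (h i).exists_resolvent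
  obtain ⟨R₀, hR₀1, hR₀2, hR₀3⟩ := h₀.exists_resolvent
  refine ⟨R, R₀, hR2, hR₀2, fun ψ => ?_⟩
  -- Elements of the span are limits as well.
  have hspan : ∀ q ∈ Submodule.span ℂ S,
      ∃ p : ι → E × E, (∀ i, p i ∈ Γ i) ∧ Tendsto p f (𝓝 q) := by
    intro q hq
    induction hq using Submodule.span_induction with
    | mem x hx => exact hS x hx
    | zero => exact ⟨0, fun i => (Γ i).zero_mem, tendsto_const_nhds⟩
    | add x y _ _ hx hy =>
      obtain ⟨p, hp, hp'⟩ := hx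
      obtain ⟨q, hq, hq'⟩ := hy
      exact ⟨p + q, fun i => (Γ i).add_mem (hp i) (hq i), hp'.add hq'⟩
    | smul c x _ hx =>
      obtain ⟨p, hp, hp'⟩ := hx
      exact ⟨c • p, fun i => (Γ i).smul_mem c (hp i), hp'.const_smul c⟩
  have hT : ∀ q ∈ Submodule.span ℂ S,
      Tendsto (fun i => R i (shiftMap E Complex.I q)) f (𝓝 q.1) := by
    intro q hq
    obtain ⟨p, hp, hpq⟩ := hspan q hq
    have h1 : Tendsto (fun i => (p i).1) f (𝓝 q.1) := (continuous_fst.tendsto q).comp hpq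
    have h2 : Tendsto (fun i => shiftMap E Complex.I (q - p i)) f (𝓝 0) := by
      have := ((shiftMap E Complex.I).continuous.tendsto (q - q)).comp
        (tendsto_const_nhds.sub hpq)
      rwa [sub_self, map_zero] at this
    have h3 : Tendsto (fun i => R i (shiftMap E Complex.I (q - p i))) f (𝓝 0) :=
      squeeze_zero_norm (fun i => hR1 i _) (by simpa using h2.norm)
    have := h3.add h1
    rw [zero_add] at this
    refine this.congr fun i => ?_
    rw [map_sub, map_sub, hR3 i (p i) (hp i), sub_add_cancel]
  have hdense : ψ ∈ closure (shiftMap E Complex.I '' (Submodule.span ℂ S : Set (E × E))) := by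
    have h1 := h₀.dense_range _ (Or.inl rfl) ψ
    refine closure_minimal ?_ isClosed_closure h1
    rw [Submodule.topologicalClosure_coe]
    exact image_closure_subset_closure_image (shiftMap E Complex.I).continuous
  rw [Metric.tendsto_nhds]
  intro ε hε
  obtain ⟨_, ⟨q, hq, rfl⟩, hd⟩ := Metric.mem_closure_iff.1 hdense (ε / 3) (by positivity)
  have h0 : R₀ (shiftMap E Complex.I q) = q.1 :=
    hR₀3 q ((Submodule.span ℂ S).le_topologicalClosure hq)
  filter_upwards [Metric.tendsto_nhds.1 (hT q hq) (ε / 3) (by positivity)] with i hi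
  rw [dist_eq_norm] at hd
  have h1 : dist (R i ψ) (R i (shiftMap E Complex.I q)) < ε / 3 := by
    rw [dist_eq_norm, ← map_sub]
    exact (hR1 i _).trans_lt hd
  have h2 : dist q.1 (R₀ ψ) < ε / 3 := by
    rw [← h0, dist_comm, dist_eq_norm, ← map_sub]
    exact (hR₀1 _).trans_lt hd
  calc dist (R i ψ) (R₀ ψ) ≤ dist (R i ψ) (R i (shiftMap E Complex.I q))
        + dist (R i (shiftMap E Complex.I q)) q.1 + dist q.1 (R₀ ψ) := dist_triangle4 _ _ _ _
    _ < ε := by linarith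

end Abstract

/-! ### The reciprocal Gamma function on the real line -/

/-- The reciprocal Gamma function `1/Γ`, with value `0` at the poles of `Γ`. -/
def recipGamma (s : ℝ) : ℝ := (Real.Gamma s)⁻¹

lemma hasDerivAt_recipGamma (s : ℝ) :
    HasDerivAt recipGamma (deriv (fun z : ℂ => (Complex.Gamma z)⁻¹) s).re s := by
  have h := (Complex.differentiable_one_div_Gamma (s : ℂ)).hasDerivAt.real_of_complex
  refine h.congr_of_eventuallyEq (.of_forall fun x => ?_)
  simp only [recipGamma]
  rw [Complex.Gamma_ofReal, ← Complex.ofReal_inv, Complex.ofReal_re]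

lemma differentiable_recipGamma : Differentiable ℝ recipGamma :=
  fun s => (hasDerivAt_recipGamma s).differentiableAt

lemma continuous_deriv_recipGamma : Continuous (deriv recipGamma) := by
  have h : deriv recipGamma = fun s : ℝ => (deriv (fun z : ℂ => (Complex.Gamma z)⁻¹) s).re :=
    funext fun s => (hasDerivAt_recipGamma s).deriv
  have hc : Continuous (deriv fun z : ℂ => (Complex.Gamma z)⁻¹) :=
    (Complex.differentiable_one_div_Gamma.contDiff (n := 1)).continuous_deriv le_rfl
  rw [h]
  exact Complex.continuous_re.comp (hc.comp Complex.continuous_ofReal)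

lemma recipGamma_eq (s : ℝ) : recipGamma s = s * recipGamma (s + 1) := by
  have h := Complex.one_div_Gamma_eq_self_mul_one_div_Gamma_add_one (s : ℂ)
  have h1 : ((s : ℂ) + 1) = ((s + 1 : ℝ) : ℂ) := by push_cast; rfl
  rw [h1, Complex.Gamma_ofReal, Complex.Gamma_ofReal] at h
  exact_mod_cast h

lemma deriv_recipGamma_eq (s : ℝ) :
    deriv recipGamma s = recipGamma (s + 1) + s * deriv recipGamma (s + 1) := by
  have h : recipGamma = fun s => s * recipGamma (s + 1) := funext recipGamma_eq
  have h2 : HasDerivAt (fun s => s * recipGamma (s + 1))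
      (1 * recipGamma (s + 1) + s * deriv recipGamma (s + 1)) s :=
    (hasDerivAt_id s).mul (((differentiable_recipGamma (s + 1)).hasDerivAt).comp_add_const s 1)
  rw [← h] at h2
  rw [h2.deriv, one_mul]

/-- `1/Γ` has simple zeros at the nonpositive integers. -/
lemma deriv_recipGamma_neg_nat (k : ℕ) : deriv recipGamma (-(k : ℝ)) ≠ 0 := by
  induction k with
  | zero => rw [deriv_recipGamma_eq]; simp [recipGamma]
  | succ k ih =>
    rw [deriv_recipGamma_eq]
    have h1 : -((k + 1 : ℕ) : ℝ) + 1 = -(k : ℝ) := by push_cast; ring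
    have h2 : recipGamma (-(k : ℝ)) = 0 := by simp [recipGamma, Real.Gamma_neg_nat_eq_zero]
    rw [h1, h2, zero_add]
    refine mul_ne_zero ?_ ih
    rw [neg_ne_zero]
    positivity

/-- `1/Γ` and its derivative are bounded on right half-lines, since `1/Γ(s) = (1/Γ(s-1))/(s-1)`. -/
lemma exists_bound_recipGamma (A : ℝ) :
    ∃ K, ∀ s, A ≤ s → |recipGamma s| ≤ K ∧ |deriv recipGamma s| ≤ K := by
  obtain ⟨K1, hK1⟩ := (isCompact_Icc (a := A) (b := max A 2 + 1)).exists_bound_of_continuousOn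
    differentiable_recipGamma.continuous.continuousOn
  obtain ⟨K2, hK2⟩ := (isCompact_Icc (a := A) (b := max A 2 + 1)).exists_bound_of_continuousOn
    continuous_deriv_recipGamma.continuousOn
  have key : ∀ n : ℕ, ∀ s, A ≤ s → s ≤ max A 2 + 1 + n →
      |recipGamma s| ≤ max K1 K2 ∧ |deriv recipGamma s| ≤ max K1 K2 := by
    intro n
    induction n with
    | zero =>
      intro s h1 h2
      have hs : s ∈ Icc A (max A 2 + 1) := ⟨h1, by simpa using h2⟩
      exact ⟨(hK1 s hs).trans (le_max_left _ _), (hK2 s hs).trans (le_max_right _ _)⟩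
    | succ n ih =>
      intro s h1 h2
      by_cases hs : s ≤ max A 2 + 1 + n
      · exact ih s h1 hs
      push Not at hs
      have hn : (0 : ℝ) ≤ n := n.cast_nonneg
      have hA : A ≤ max A 2 := le_max_left _ _
      have h2' : (2 : ℝ) ≤ max A 2 := le_max_right _ _
      push_cast at h2
      obtain ⟨i1, i2⟩ := ih (s - 1) (by linarith) (by linarith)
      have e1 := recipGamma_eq (s - 1)
      have e2 := deriv_recipGamma_eq (s - 1)
      rw [sub_add_cancel] at e1 e2
      have hs1 : 2 ≤ s - 1 := by linarith
      have b1 : |s - 1| = s - 1 := abs_of_pos (by linarith)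
      have c1 : (s - 1) * |recipGamma s| ≤ max K1 K2 := by
        rw [e1, abs_mul, b1] at i1; exact i1
      have c2 : |recipGamma s| ≤ max K1 K2 := by
        nlinarith [abs_nonneg (recipGamma s)]
      have c3 : (s - 1) * |deriv recipGamma s| ≤ max K1 K2 + max K1 K2 := by
        have : (s - 1) * deriv recipGamma s = deriv recipGamma (s - 1) - recipGamma s := by
          rw [e2]; ring
        rw [← b1, ← abs_mul, this]
        exact (abs_sub _ _).trans (add_le_add i2 c2)
      exact ⟨c2, by nlinarith [abs_nonneg (deriv recipGamma s)]⟩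
  refine ⟨max K1 K2, fun s hs => ?_⟩
  obtain ⟨n, hn⟩ := exists_nat_ge (s - (max A 2 + 1))
  exact key n s hs (by linarith)

/-! ### Exponential generating functions -/

/-- The exponential generating function `∑ₘ c m zᵐ / m!`. -/
def egf (c : ℕ → ℝ) (z : ℝ) : ℝ := ∑' m : ℕ, c m * (z ^ m / m.factorial)

/-- A sequence that is bounded in absolute value. -/
def IsBddSeq (c : ℕ → ℝ) : Prop := ∃ K, ∀ m, |c m| ≤ K

lemma IsBddSeq.shift {c : ℕ → ℝ} (h : IsBddSeq c) : IsBddSeq fun m => c (m + 1) :=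
  h.imp fun _ hK m => hK (m + 1)

lemma IsBddSeq.summable {c : ℕ → ℝ} (h : IsBddSeq c) (z : ℝ) :
    Summable fun m => c m * (z ^ m / m.factorial) := by
  obtain ⟨K, hK⟩ := h
  refine Summable.of_norm_bounded ((Real.summable_pow_div_factorial |z|).mul_left K) fun m => ?_
  rw [norm_mul, norm_div, norm_pow, Real.norm_eq_abs, Real.norm_eq_abs, Real.norm_natCast]
  gcongr
  exact hK m

lemma egf_zero (c : ℕ → ℝ) : egf c 0 = c 0 := by
  rw [egf, tsum_eq_single 0]
  · simp
  · intro m hm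
    simp [hm]

lemma egf_eq_zero_add {c : ℕ → ℝ} (h : IsBddSeq c) (z : ℝ) :
    egf c z = c 0 + ∑' m : ℕ, c (m + 1) * (z ^ (m + 1) / (m + 1).factorial) := by
  rw [egf, (h.summable z).tsum_eq_zero_add]
  simp

lemma hasDerivAt_egf {c : ℕ → ℝ} (h : IsBddSeq c) (z : ℝ) :
    HasDerivAt (egf c) (egf (fun m => c (m + 1)) z) z := by
  have h1 : HasDerivAt (fun z => ∑' m : ℕ, c (m + 1) * (z ^ (m + 1) / (m + 1).factorial))
      (∑' m : ℕ, c (m + 1) * (z ^ m / m.factorial)) z := by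
    obtain ⟨K, hK⟩ := id h
    have hK0 : 0 ≤ K := (abs_nonneg _).trans (hK 0)
    have hs : Summable fun m : ℕ => c (m + 1) * (z ^ (m + 1) / (m + 1).factorial) :=
      (summable_nat_add_iff (f := fun m : ℕ => c m * (z ^ m / m.factorial)) 1).2 (h.summable z)
    refine hasDerivAt_tsum_of_isPreconnected
      (g := fun (m : ℕ) z => c (m + 1) * (z ^ (m + 1) / (m + 1).factorial))
      (g' := fun (m : ℕ) z => c (m + 1) * (z ^ m / m.factorial))
      (t := Metric.ball 0 (|z| + 1)) (y₀ := z)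
      ((Real.summable_pow_div_factorial (|z| + 1)).mul_left K) Metric.isOpen_ball
      (convex_ball _ _).isPreconnected (fun m y _ => ?_) (fun m y hy => ?_) (by simp)
      hs (by simp)
    · have := ((hasDerivAt_pow (m + 1) y).div_const ((m + 1).factorial : ℝ)).const_mul (c (m + 1))
      refine this.congr_deriv ?_
      rw [Nat.factorial_succ]
      push_cast
      field_simp
    · rw [norm_mul, norm_div, norm_pow, Real.norm_eq_abs, Real.norm_natCast]
      have hy' : ‖y‖ ≤ |z| + 1 := by simpa using (Metric.mem_ball.1 hy).le
      gcongr
      exact hK _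
  have h2 := h1.const_add (c 0)
  exact h2.congr_of_eventuallyEq (.of_forall fun y => egf_eq_zero_add h y)

lemma continuous_egf {c : ℕ → ℝ} (h : IsBddSeq c) : Continuous (egf c) :=
  continuous_iff_continuousAt.2 fun z => (hasDerivAt_egf h z).continuousAt

/-- A recursion for the coefficients turns into a three-term relation for the generating
functions. -/
lemma egf_recursion {c d e : ℕ → ℝ} {lam : ℝ} (hd : IsBddSeq d) (he : IsBddSeq e)
    (h : ∀ m : ℕ, c m = (m + lam) * d m + e m) (z : ℝ) :
    egf c z = lam * egf d z + z * egf (fun m => d (m + 1)) z + egf e z := by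
  have h1 := (hd.summable z).hasSum.mul_left lam
  have h2 : HasSum (fun m : ℕ => (m : ℝ) * d m * (z ^ m / m.factorial))
      (z * egf (fun m => d (m + 1)) z) := by
    have h0 := (hd.shift.summable z).hasSum.mul_left z
    have hf : (fun m : ℕ => z * (d (m + 1) * (z ^ m / m.factorial))) =
        fun m : ℕ => ((m + 1 : ℕ) : ℝ) * d (m + 1) * (z ^ (m + 1) / (m + 1).factorial) := by
      ext m
      rw [Nat.factorial_succ]
      push_cast
      field_simp
      ring
    rw [hf] at h0
    have h1 := (hasSum_nat_add_iff (f := fun m : ℕ => (m : ℝ) * d m * (z ^ m / m.factorial)) 1).1 h0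
    simpa [egf] using h1
  have h3 := (he.summable z).hasSum
  have := (h1.add h2).add h3
  refine Eq.trans ?_ this.tsum_eq
  rw [egf]
  congr 1
  ext m
  rw [h m]
  ring

/-! ### The functions `(x/2)^ν E(-x²/4)` -/

/-- The function `(x/2)^ν ∑ₘ c m (-x²/4)ᵐ / m!`; for `c m = 1/Γ(m+ν+1)` it is `J_ν`. -/
def besselSeries (ν : ℝ) (c : ℕ → ℝ) (x : ℝ) : ℝ := (x / 2) ^ ν * egf c (-(x ^ 2 / 4))

lemma half_rpow_add_one (ν : ℝ) {x : ℝ} (hx : 0 < x) :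
    (x / 2) ^ (ν + 1) = (x / 2) ^ ν * (x / 2) := by
  rw [Real.rpow_add (by positivity), Real.rpow_one]

lemma hasDerivAt_besselSeries (ν : ℝ) {c : ℕ → ℝ} (h : IsBddSeq c) {x : ℝ} (hx : 0 < x) :
    HasDerivAt (besselSeries ν c)
      (ν / x * besselSeries ν c x - besselSeries (ν + 1) (fun m => c (m + 1)) x) x := by
  have h1 : HasDerivAt (fun x : ℝ => (x / 2) ^ ν) (1 / 2 * ν * (x / 2) ^ (ν - 1)) x :=
    ((hasDerivAt_id x).div_const 2).rpow_const (Or.inl (by simp [hx.ne']))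
  have h2 : HasDerivAt (fun x : ℝ => -(x ^ 2 / 4)) (-(2 * x / 4)) x := by
    simpa using ((hasDerivAt_pow 2 x).div_const 4).fun_neg
  have h3 := (hasDerivAt_egf h (-(x ^ 2 / 4))).comp x h2
  refine (h1.mul h3).congr_deriv ?_
  rw [besselSeries, besselSeries, half_rpow_add_one ν hx, Real.rpow_sub_one (by positivity)]
  simp only [Function.comp]
  field_simp
  ring

/-- The coefficients `1/Γ(m+ν+1)` of `J_ν`. -/
def besselCoeff (ν : ℝ) (m : ℕ) : ℝ := recipGamma (m + ν + 1)

/-- The derivatives of the coefficients of `J_ν` with respect to the order. -/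
def besselCoeffDeriv (ν : ℝ) (m : ℕ) : ℝ := deriv recipGamma (m + ν + 1)

lemma exists_bound_besselCoeff (A : ℝ) :
    ∃ K, ∀ ν, A ≤ ν → ∀ m, |besselCoeff ν m| ≤ K ∧ |besselCoeffDeriv ν m| ≤ K := by
  obtain ⟨K, hK⟩ := exists_bound_recipGamma (A + 1)
  refine ⟨K, fun ν hν m => hK _ ?_⟩
  have : (0 : ℝ) ≤ m := m.cast_nonneg
  linarith

lemma isBddSeq_besselCoeff (ν : ℝ) : IsBddSeq (besselCoeff ν) := by
  obtain ⟨K, hK⟩ := exists_bound_besselCoeff ν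
  exact ⟨K, fun m => (hK ν le_rfl m).1⟩

lemma isBddSeq_besselCoeffDeriv (ν : ℝ) : IsBddSeq (besselCoeffDeriv ν) := by
  obtain ⟨K, hK⟩ := exists_bound_besselCoeff ν
  exact ⟨K, fun m => (hK ν le_rfl m).2⟩

lemma besselCoeff_shift (ν : ℝ) : (fun m => besselCoeff ν (m + 1)) = besselCoeff (ν + 1) := by
  ext m
  simp only [besselCoeff]
  congr 1
  push_cast
  ring

lemma besselJ_eq (ν : ℝ) {x : ℝ} (hx : 0 < x) :
    besselJ ν x = besselSeries ν (besselCoeff ν) x := by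
  rw [besselJ, besselSeries, egf, ← tsum_mul_left]
  congr 1
  ext m
  rw [Real.rpow_add (by positivity), besselCoeff, recipGamma]
  have h1 : (x / 2) ^ (2 * (m : ℝ)) = (x ^ 2 / 4) ^ m := by
    rw [Real.rpow_mul (by positivity)]
    norm_cast
    congr 1
    ring
  rw [h1, neg_pow (x ^ 2 / 4), div_eq_mul_inv, mul_inv]
  ring

/-- The derivative of `J_ν(x)` with respect to the order `ν`. -/
def besselOrderDeriv (ν x : ℝ) : ℝ :=
  Real.log (x / 2) * besselSeries ν (besselCoeff ν) x + besselSeries ν (besselCoeffDeriv ν) x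

lemma hasDerivAt_besselJ_order (ν : ℝ) {x : ℝ} (hx : 0 < x) :
    HasDerivAt (fun μ => besselJ μ x) (besselOrderDeriv ν x) ν := by
  obtain ⟨K, hK⟩ := exists_bound_besselCoeff (ν - 1)
  set z := -(x ^ 2 / 4) with hz
  have h1 : HasDerivAt (fun μ => egf (besselCoeff μ) z) (egf (besselCoeffDeriv ν) z) ν := by
    refine hasDerivAt_tsum_of_isPreconnected
      (g := fun (m : ℕ) μ => besselCoeff μ m * (z ^ m / m.factorial))
      (g' := fun (m : ℕ) μ => besselCoeffDeriv μ m * (z ^ m / m.factorial))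
      (t := Metric.ball ν 1) (y₀ := ν)
      ((Real.summable_pow_div_factorial |z|).mul_left K) Metric.isOpen_ball
      (convex_ball _ _).isPreconnected (fun m y _ => ?_) (fun m y hy => ?_) (by simp)
      ((isBddSeq_besselCoeff ν).summable z) (by simp)
    · refine HasDerivAt.mul_const ?_ _
      have h2 := (differentiable_recipGamma (m + y + 1)).hasDerivAt
      have h3 : HasDerivAt (fun y : ℝ => (m : ℝ) + y + 1) 1 y :=
        ((hasDerivAt_id y).const_add (m : ℝ)).add_const 1
      exact (h2.comp y h3).congr_deriv (mul_one _)
    · rw [norm_mul, norm_div, norm_pow, Real.norm_eq_abs, Real.norm_eq_abs, Real.norm_natCast]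
      have hy' : ν - 1 ≤ y := by
        rw [Metric.mem_ball, Real.dist_eq, abs_lt] at hy
        linarith
      gcongr
      exact (hK y hy' m).2
  have h2 : HasDerivAt (fun μ : ℝ => (x / 2) ^ μ) ((x / 2) ^ ν * Real.log (x / 2)) ν :=
    (Real.hasStrictDerivAt_const_rpow (by positivity) ν).hasDerivAt
  refine ((h2.mul h1).congr_deriv ?_).congr_of_eventuallyEq
    (.of_forall fun μ => besselJ_eq μ hx)
  rw [besselOrderDeriv, besselSeries, besselSeries]
  ring

/-! ### Bessel's equation and Wronskians -/

/-- `Z` solves Bessel's equation of order `ν` on `(0,∞)`, with derivative `Z'`. -/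
def IsBesselSol (ν : ℝ) (Z Z' : ℝ → ℝ) : Prop :=
  ∀ x, 0 < x → HasDerivAt Z (Z' x) x ∧
    HasDerivAt Z' (-(Z' x / x) - (1 - ν ^ 2 / x ^ 2) * Z x) x

lemma IsBesselSol.congr {ν : ℝ} {Z W Z' : ℝ → ℝ} (h : IsBesselSol ν Z Z')
    (hW : ∀ x, 0 < x → W x = Z x) : IsBesselSol ν W Z' := fun x hx => by
  rw [hW x hx]
  refine ⟨(h x hx).1.congr_of_eventuallyEq ?_, (h x hx).2⟩
  filter_upwards [lt_mem_nhds hx] with y hy using hW y hy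

lemma IsBesselSol.linear_combination {ν : ℝ} {Z Z' W W' : ℝ → ℝ} (h : IsBesselSol ν Z Z')
    (k : IsBesselSol ν W W') (a b : ℝ) :
    IsBesselSol ν (fun x => a * Z x + b * W x) (fun x => a * Z' x + b * W' x) := fun x hx => by
  refine ⟨((h x hx).1.const_mul a).add ((k x hx).1.const_mul b),
    (((h x hx).2.const_mul a).add ((k x hx).2.const_mul b)).congr_deriv ?_⟩
  ring

/-- A function with vanishing derivative on `(0,∞)` is constant there. -/
lemma eq_of_hasDerivAt_zero_Ioi {G : Type*} [NormedAddCommGroup G] [NormedSpace ℝ G] {f : ℝ → G}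
    (h : ∀ x, 0 < x → HasDerivAt f 0 x) {x y : ℝ} (hx : 0 < x) (hy : 0 < y) : f x = f y :=
  isOpen_Ioi.is_const_of_deriv_eq_zero isPreconnected_Ioi
    (fun x hx => (h x hx).differentiableAt.differentiableWithinAt) (fun x hx => (h x hx).deriv)
    (mem_Ioi.2 hx) (mem_Ioi.2 hy)

/-- If `x` times the Wronskian of two solutions of Bessel's equation extends continuously to
`x = 0`, then it is equal to the value of the extension at `0`. -/
lemma IsBesselSol.wronskian_eq {ν : ℝ} {Z Z' W W' : ℝ → ℝ} (h : IsBesselSol ν Z Z')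
    (k : IsBesselSol ν W W') {Q : ℝ → ℝ} (hQ : ContinuousAt Q 0)
    (hW : ∀ x, 0 < x → x * (Z x * W' x - Z' x * W x) = Q x) {x : ℝ} (hx : 0 < x) :
    x * (Z x * W' x - Z' x * W x) = Q 0 := by
  have hd : ∀ x, 0 < x → HasDerivAt (fun x => x * (Z x * W' x - Z' x * W x)) 0 x := fun x hx => by
    obtain ⟨h1, h2⟩ := h x hx
    obtain ⟨k1, k2⟩ := k x hx
    refine ((hasDerivAt_id x).mul ((h1.mul k2).sub (h2.mul k1))).congr_deriv ?_
    simp only [id, Pi.sub_apply, Pi.mul_apply]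
    field_simp
    ring
  have h1 : Tendsto Q (𝓝[>] 0) (𝓝 (Q 0)) := hQ.tendsto.mono_left nhdsWithin_le_nhds
  refine tendsto_nhds_unique (tendsto_const_nhds.congr' ?_) h1
  filter_upwards [self_mem_nhdsWithin] with y hy
  rw [← hW y hy]
  exact eq_of_hasDerivAt_zero_Ioi hd hx hy

/-- Derivative of `besselSeries`. -/
def besselSeriesDeriv (ν : ℝ) (c : ℕ → ℝ) (x : ℝ) : ℝ :=
  ν / x * besselSeries ν c x - besselSeries (ν + 1) (fun m => c (m + 1)) x

/-- If the coefficients satisfy `c m = (m + ν + 1) c (m + 1) + e m`, then `(x/2)^ν E_c(-x²/4)`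
solves the inhomogeneous Bessel equation with right-hand side `(x/2)^ν E_e(-x²/4)`. -/
lemma hasDerivAt_besselSeriesDeriv {ν : ℝ} {c e : ℕ → ℝ} (hc : IsBddSeq c) (he : IsBddSeq e)
    (h : ∀ m : ℕ, c m = (m + (ν + 1)) * c (m + 1) + e m) {x : ℝ} (hx : 0 < x) :
    HasDerivAt (besselSeriesDeriv ν c)
      (-(besselSeriesDeriv ν c x / x) - (1 - ν ^ 2 / x ^ 2) * besselSeries ν c x
        + besselSeries ν e x) x := by
  have h1 : HasDerivAt (fun x : ℝ => ν / x) (-(ν / x ^ 2)) x := by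
    have := (hasDerivAt_inv hx.ne').const_mul ν
    simp only [div_eq_mul_inv]
    exact this.congr_deriv (by ring)
  have h2 := (h1.mul (hasDerivAt_besselSeries ν hc hx)).sub
    (hasDerivAt_besselSeries (ν + 1) hc.shift hx)
  refine h2.congr_deriv ?_
  have h3 := egf_recursion (c := c) (lam := ν + 1) hc.shift he h (-(x ^ 2 / 4))
  simp only [besselSeriesDeriv, besselSeries] at *
  rw [half_rpow_add_one (ν + 1) hx, half_rpow_add_one ν hx, h3]
  field_simp
  ring

/-- The derivative of `J_ν` in the variable `x`. -/
def besselJDeriv (ν : ℝ) : ℝ → ℝ := besselSeriesDeriv ν (besselCoeff ν)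

lemma isBesselSol_besselJ (ν : ℝ) : IsBesselSol ν (besselJ ν) (besselJDeriv ν) := by
  refine IsBesselSol.congr (Z := besselSeries ν (besselCoeff ν)) (fun x hx =>
    ⟨hasDerivAt_besselSeries ν (isBddSeq_besselCoeff ν) hx, ?_⟩) fun x hx => besselJ_eq ν hx
  have h := hasDerivAt_besselSeriesDeriv (ν := ν) (c := besselCoeff ν) (e := fun _ => 0)
    (isBddSeq_besselCoeff ν) ⟨0, by simp⟩ (fun m => ?_) hx
  · refine h.congr_deriv ?_
    simp [besselSeries, egf, besselJDeriv]
  · rw [add_zero, besselCoeff, recipGamma_eq, besselCoeff]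
    push_cast
    ring_nf

/-- The `x`-derivative of the order derivative of `J_ν(x)`. -/
def besselOrderDerivDeriv (ν x : ℝ) : ℝ :=
  besselSeries ν (besselCoeff ν) x / x + Real.log (x / 2) * besselJDeriv ν x
    + besselSeriesDeriv ν (besselCoeffDeriv ν) x

/-- The order derivative of `J_ν` satisfies the equation obtained by differentiating Bessel's
equation with respect to `ν`. -/
lemma hasDerivAt_besselOrderDeriv (ν : ℝ) {x : ℝ} (hx : 0 < x) :
    HasDerivAt (besselOrderDeriv ν) (besselOrderDerivDeriv ν x) x ∧
    HasDerivAt (besselOrderDerivDeriv ν)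
      (-(besselOrderDerivDeriv ν x / x) - (1 - ν ^ 2 / x ^ 2) * besselOrderDeriv ν x
        + 2 * ν / x ^ 2 * besselJ ν x) x := by
  have hl : HasDerivAt (fun x : ℝ => Real.log (x / 2)) (1 / x) x := by
    have := ((hasDerivAt_id x).div_const 2).log (by simp [hx.ne'])
    refine this.congr_deriv ?_
    simp only [id]
    field_simp
  have hJ := isBesselSol_besselJ ν x hx
  have h0 : HasDerivAt (besselSeries ν (besselCoeff ν)) (besselJDeriv ν x) x :=
    hasDerivAt_besselSeries ν (isBddSeq_besselCoeff ν) hx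
  have h1 := hasDerivAt_besselSeries ν (isBddSeq_besselCoeffDeriv ν) hx
  have h2 := hasDerivAt_besselSeriesDeriv (ν := ν) (c := besselCoeffDeriv ν)
    (e := besselCoeff (ν + 1)) (isBddSeq_besselCoeffDeriv ν) (isBddSeq_besselCoeff _)
    (fun m => by
      rw [besselCoeffDeriv, deriv_recipGamma_eq, besselCoeffDeriv, besselCoeff]
      push_cast
      ring_nf) hx
  refine ⟨((hl.mul h0).add h1).congr_deriv ?_,
    (((h0.div (hasDerivAt_id x) hx.ne').add (hl.mul hJ.2)).add h2).congr_deriv ?_⟩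
  · rw [besselOrderDerivDeriv, besselSeriesDeriv]
    ring
  · rw [besselJ_eq ν hx]
    simp only [besselOrderDerivDeriv, besselOrderDeriv, besselJDeriv, besselSeriesDeriv,
      besselCoeff_shift, id]
    simp only [besselSeries]
    rw [half_rpow_add_one ν hx]
    field_simp
    ring

/-! ### Bessel functions of opposite order -/

lemma besselCoeff_nat (k m : ℕ) : besselCoeff k m = ((m + k).factorial : ℝ)⁻¹ := by
  rw [besselCoeff, recipGamma, ← Real.Gamma_nat_eq_factorial]
  push_cast
  rfl

lemma besselCoeff_neg_nat_of_lt {k m : ℕ} (h : m < k) : besselCoeff (-(k : ℝ)) m = 0 := by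
  obtain ⟨j, rfl⟩ := Nat.exists_eq_add_of_lt h
  rw [besselCoeff, recipGamma]
  have : (m : ℝ) + -((m + j + 1 : ℕ) : ℝ) + 1 = -(j : ℝ) := by push_cast; ring
  rw [this, Real.Gamma_neg_nat_eq_zero, inv_zero]

lemma besselCoeff_neg_nat_add (k m : ℕ) :
    besselCoeff (-(k : ℝ)) (m + k) = (m.factorial : ℝ)⁻¹ := by
  rw [besselCoeff, recipGamma, ← Real.Gamma_nat_eq_factorial]
  push_cast
  ring_nf

lemma half_rpow_neg_nat (k : ℕ) {x : ℝ} (hx : 0 < x) :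
    (x / 2) ^ (-(k : ℝ)) = ((x / 2) ^ k)⁻¹ := by
  rw [Real.rpow_neg (by positivity), Real.rpow_natCast]

/-- `J_{-k} = (-1)^k J_k`. -/
lemma besselJ_neg_nat (k : ℕ) {x : ℝ} (hx : 0 < x) :
    besselJ (-(k : ℝ)) x = (-1) ^ k * besselJ k x := by
  have h1 : egf (besselCoeff (-(k : ℝ))) (-(x ^ 2 / 4)) =
      (-(x ^ 2 / 4)) ^ k * egf (besselCoeff k) (-(x ^ 2 / 4)) := by
    set z := -(x ^ 2 / 4)
    rw [egf, egf, ← ((isBddSeq_besselCoeff (-(k : ℝ))).summable z).sum_add_tsum_nat_add k,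
      ← tsum_mul_left, Finset.sum_eq_zero, zero_add]
    · congr 1
      ext m
      rw [besselCoeff_neg_nat_add, besselCoeff_nat, pow_add]
      ring
    · intro m hm
      rw [besselCoeff_neg_nat_of_lt (Finset.mem_range.1 hm), zero_mul]
  rw [besselJ_eq _ hx, besselJ_eq _ hx, besselSeries, besselSeries, half_rpow_neg_nat k hx, h1,
    Real.rpow_natCast]
  have h2 : (-(x ^ 2 / 4)) ^ k = (-1) ^ k * ((x / 2) ^ k * (x / 2) ^ k) := by
    rw [← mul_pow, ← mul_pow]
    congr 1
    ring
  rw [h2]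
  field_simp

lemma besselJDeriv_neg_nat (k : ℕ) {x : ℝ} (hx : 0 < x) :
    besselJDeriv (-(k : ℝ)) x = (-1) ^ k * besselJDeriv k x := by
  have h1 := (isBesselSol_besselJ (-(k : ℝ)) x hx).1
  have h2 := (isBesselSol_besselJ (k : ℝ) x hx).1.const_mul ((-1) ^ k)
  refine h1.unique (h2.congr_of_eventuallyEq ?_)
  filter_upwards [lt_mem_nhds hx] with y hy using besselJ_neg_nat k hy

/-- At an integer order the limit defining `Y` is
`Y_{-k} = (∂_ν J_ν|_{ν=-k} + (-1)^k ∂_ν J_ν|_{ν=k}) / π`. -/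
lemma besselY_neg_nat (k : ℕ) {x : ℝ} (hx : 0 < x) :
    besselY (-(k : ℝ)) x =
      Real.pi⁻¹ * besselOrderDeriv (-(k : ℝ)) x
        + Real.pi⁻¹ * (-1) ^ k * besselOrderDeriv k x := by
  have hex : ∃ n : ℤ, -(k : ℝ) = n := ⟨-k, by simp⟩
  rw [besselY, if_pos hex]
  have hcos : Real.cos (-(k : ℝ) * Real.pi) = (-1) ^ k := by
    rw [neg_mul, Real.cos_neg, Real.cos_nat_mul_pi]
  have hsin : Real.sin (-(k : ℝ) * Real.pi) = 0 := by
    rw [neg_mul, Real.sin_neg, Real.sin_nat_mul_pi, neg_zero]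
  have hpi : HasDerivAt (fun μ : ℝ => μ * Real.pi) Real.pi (-(k : ℝ)) := by
    simpa using (hasDerivAt_id (-(k : ℝ))).mul_const Real.pi
  have h1 : HasDerivAt (fun μ => besselJ μ x * Real.cos (μ * Real.pi) - besselJ (-μ) x)
      ((-1) ^ k * besselOrderDeriv (-(k : ℝ)) x + besselOrderDeriv k x) (-(k : ℝ)) := by
    have a1 := (hasDerivAt_besselJ_order (-(k : ℝ)) hx).mul hpi.cos
    have a2 : HasDerivAt (fun μ => besselJ (-μ) x) (-besselOrderDeriv k x) (-(k : ℝ)) := by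
      have a3 := hasDerivAt_besselJ_order (-(-(k : ℝ))) hx
      have := a3.comp (-(k : ℝ)) (hasDerivAt_neg (-(k : ℝ)))
      simpa [Function.comp_def] using this
    refine (a1.sub a2).congr_deriv ?_
    rw [hcos, hsin]
    ring
  have h2 : HasDerivAt (fun μ : ℝ => Real.sin (μ * Real.pi)) ((-1) ^ k * Real.pi) (-(k : ℝ)) := by
    have := hpi.sin
    rwa [hcos] at this
  have hne : ((-1 : ℝ) ^ k) ≠ 0 := pow_ne_zero _ (by norm_num)
  have hne' : ((-1 : ℝ) ^ k) * Real.pi ≠ 0 := mul_ne_zero hne Real.pi_ne_zero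
  rw [hasDerivAt_iff_tendsto_slope] at h1 h2
  have h3 := h1.div h2 hne'
  have hval : Real.pi⁻¹ * besselOrderDeriv (-(k : ℝ)) x
        + Real.pi⁻¹ * (-1) ^ k * besselOrderDeriv k x =
      ((-1) ^ k * besselOrderDeriv (-(k : ℝ)) x + besselOrderDeriv k x) /
        ((-1) ^ k * Real.pi) := by
    have hsq : ((-1 : ℝ) ^ k) * (-1) ^ k = 1 := by rw [← mul_pow]; simp
    field_simp
    linear_combination (besselOrderDeriv (k : ℝ) x) * hsq
  rw [hval]
  refine Tendsto.limUnder_eq (h3.congr' ?_)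
  filter_upwards [self_mem_nhdsWithin] with μ hμ
  have hμ' : μ - -(k : ℝ) ≠ 0 := sub_ne_zero.2 hμ
  have hN : besselJ (-(k : ℝ)) x * Real.cos (-(k : ℝ) * Real.pi) - besselJ (- -(k : ℝ)) x = 0 := by
    rw [hcos, besselJ_neg_nat k hx, neg_neg]
    have hsq : ((-1 : ℝ) ^ k) * (-1) ^ k = 1 := by rw [← mul_pow]; simp
    linear_combination (besselJ (k : ℝ) x) * hsq
  rw [Pi.div_apply, slope_def_field, slope_def_field, hN, hsin, sub_zero, sub_zero, besselYQuotient,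
    div_div_div_cancel_right₀ hμ']

/-! ### The pair `J_ν`, `Y_ν` is a fundamental system -/

/-- `J_ν` and `Y_ν` solve Bessel's equation, and `x` times their Wronskian is a nonzero constant. -/
def IsFundamentalPair (ν : ℝ) : Prop :=
  ∃ J' Y' : ℝ → ℝ, IsBesselSol ν (besselJ ν) J' ∧ IsBesselSol ν (besselY ν) Y' ∧
    ∃ w : ℝ, w ≠ 0 ∧ ∀ x, 0 < x → x * (besselJ ν x * Y' x - J' x * besselY ν x) = w

lemma IsBesselSol.neg_order {ν : ℝ} {Z Z' : ℝ → ℝ} (h : IsBesselSol (-ν) Z Z') :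
    IsBesselSol ν Z Z' := by
  intro x hx
  have := h x hx
  rwa [neg_sq] at this

/-- At a noninteger order the Wronskian of `J_ν` and `J_{-ν}` is read off at `x = 0` from
`1/(Γ(1+ν) Γ(1-ν)) ≠ 0`. -/
lemma isFundamentalPair_of_not_int {ν : ℝ} (hν : ¬ ∃ n : ℤ, ν = n) : IsFundamentalPair ν := by
  have hs : Real.sin (ν * Real.pi) ≠ 0 := by
    rw [Real.sin_ne_zero_iff]
    intro n hn
    exact hν ⟨n, (mul_right_cancel₀ Real.pi_ne_zero hn).symm⟩
  set s := Real.sin (ν * Real.pi)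
  set c := Real.cos (ν * Real.pi)
  have hJ := isBesselSol_besselJ ν
  have hJn : IsBesselSol ν (besselJ (-ν)) (besselJDeriv (-ν)) :=
    (isBesselSol_besselJ (-ν)).neg_order
  have hY : IsBesselSol ν (besselY ν)
      (fun x => c / s * besselJDeriv ν x + (-1 / s) * besselJDeriv (-ν) x) := by
    refine (hJ.linear_combination hJn (c / s) (-1 / s)).congr fun x _ => ?_
    rw [besselY, if_neg hν, besselYQuotient]
    ring
  -- The continuous extension to `x = 0` of `x` times the Wronskian of `J_ν` and `J_{-ν}`.
  let Q : ℝ → ℝ := fun x => -2 * ν * (egf (besselCoeff ν) (-(x ^ 2 / 4)) *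
      egf (besselCoeff (-ν)) (-(x ^ 2 / 4))) + x ^ 2 / 2 *
    (egf (fun m => besselCoeff ν (m + 1)) (-(x ^ 2 / 4)) * egf (besselCoeff (-ν)) (-(x ^ 2 / 4))
      - egf (besselCoeff ν) (-(x ^ 2 / 4)) *
        egf (fun m => besselCoeff (-ν) (m + 1)) (-(x ^ 2 / 4)))
  have c1 := continuous_egf (isBddSeq_besselCoeff ν)
  have c2 := continuous_egf (isBddSeq_besselCoeff (-ν))
  have c3 := continuous_egf (isBddSeq_besselCoeff ν).shift
  have c4 := continuous_egf (isBddSeq_besselCoeff (-ν)).shift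
  have hQc : Continuous Q := by
    have hz : Continuous fun x : ℝ => -(x ^ 2 / 4) := by fun_prop
    have d1 := c1.comp hz
    have d2 := c2.comp hz
    have d3 := c3.comp hz
    have d4 := c4.comp hz
    simp only [Function.comp_def] at d1 d2 d3 d4
    exact (continuous_const.mul (d1.mul d2)).add
      (((continuous_pow 2).div_const 2).mul ((d3.mul d2).sub (d1.mul d4)))
  have hW : ∀ x, 0 < x →
      x * (besselJ ν x * besselJDeriv (-ν) x - besselJDeriv ν x * besselJ (-ν) x) = Q x := by
    intro x hx
    have hp : (x / 2) ^ (-ν) * (x / 2) ^ ν = 1 := by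
      rw [← Real.rpow_add (by positivity), neg_add_cancel, Real.rpow_zero]
    rw [besselJ_eq _ hx, besselJ_eq _ hx, besselJDeriv, besselJDeriv]
    simp only [besselSeriesDeriv, besselSeries, Q]
    rw [half_rpow_add_one ν hx, half_rpow_add_one (-ν) hx]
    field_simp
    generalize egf (besselCoeff ν) (-(x ^ 2 / 4)) = e1
    generalize egf (besselCoeff (-ν)) (-(x ^ 2 / 4)) = e2
    generalize egf (fun m => besselCoeff ν (m + 1)) (-(x ^ 2 / 4)) = e3
    generalize egf (fun m => besselCoeff (-ν) (m + 1)) (-(x ^ 2 / 4)) = e4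
    linear_combination (-4 * ν * e1 * e2 + x ^ 2 * (e3 * e2 - e1 * e4)) * hp
  have hQ0 : Q 0 ≠ 0 := by
    have h1 : besselCoeff ν 0 ≠ 0 := by
      rw [besselCoeff, recipGamma, ne_eq, inv_eq_zero, Real.Gamma_eq_zero_iff]
      rintro ⟨m, hm⟩
      refine hν ⟨-m - 1, ?_⟩
      push_cast at hm ⊢
      linarith
    have h2 : besselCoeff (-ν) 0 ≠ 0 := by
      rw [besselCoeff, recipGamma, ne_eq, inv_eq_zero, Real.Gamma_eq_zero_iff]
      rintro ⟨m, hm⟩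
      refine hν ⟨m + 1, ?_⟩
      push_cast at hm ⊢
      linarith
    have h3 : ν ≠ 0 := fun h => hν ⟨0, by simpa using h⟩
    simp [Q, egf_zero, h1, h2, h3]
  refine ⟨_, _, hJ, hY, -1 / s * Q 0, mul_ne_zero (div_ne_zero (by norm_num) hs) hQ0,
    fun x hx => ?_⟩
  rw [← hJ.wronskian_eq hJn hQc.continuousAt hW hx, besselY, if_neg hν, besselYQuotient]
  ring

/-- At a negative integer order `Y` is a combination of the order derivatives of `J` at `±k`, and the
Wronskian is governed by the simple zero of `1/Γ` at `1 - k`. -/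
lemma isFundamentalPair_neg_nat {k : ℕ} (hk : k ≠ 0) : IsFundamentalPair (-(k : ℝ)) := by
  have hsq : ((-1 : ℝ) ^ k) * (-1) ^ k = 1 := by rw [← mul_pow]; simp
  have hJ : IsBesselSol k (besselJ k) (besselJDeriv k) := isBesselSol_besselJ k
  have hJn : IsBesselSol (-(k : ℝ)) (besselJ (-(k : ℝ)))
      (fun x => (-1) ^ k * besselJDeriv k x) := by
    have h : IsBesselSol (-(-(k : ℝ))) (besselJ k) (besselJDeriv k) := by rwa [neg_neg]
    have := (h.neg_order.linear_combination h.neg_order ((-1) ^ k) 0)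
    simp only [zero_mul, add_zero] at this
    exact this.congr fun x hx => besselJ_neg_nat k hx
  -- The two order derivatives solve inhomogeneous equations whose right-hand sides cancel.
  have hY : IsBesselSol (-(k : ℝ)) (besselY (-(k : ℝ)))
      (fun x => Real.pi⁻¹ * besselOrderDerivDeriv (-(k : ℝ)) x
        + Real.pi⁻¹ * (-1) ^ k * besselOrderDerivDeriv k x) := by
    refine IsBesselSol.congr (Z := fun x => Real.pi⁻¹ * besselOrderDeriv (-(k : ℝ)) x
        + Real.pi⁻¹ * (-1) ^ k * besselOrderDeriv k x) (fun x hx => ?_)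
        fun x hx => besselY_neg_nat k hx
    obtain ⟨a1, a2⟩ := hasDerivAt_besselOrderDeriv (-(k : ℝ)) hx
    obtain ⟨b1, b2⟩ := hasDerivAt_besselOrderDeriv (k : ℝ) hx
    refine ⟨(a1.const_mul _).add (b1.const_mul _),
      ((a2.const_mul _).add (b2.const_mul _)).congr_deriv ?_⟩
    rw [besselJ_neg_nat k hx]
    ring
  let p : ℝ → ℝ := fun x => egf (besselCoeff k) (-(x ^ 2 / 4))
  let p' : ℝ → ℝ := fun x => egf (fun m => besselCoeff k (m + 1)) (-(x ^ 2 / 4))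
  let q : ℝ → ℝ := fun x => egf (besselCoeffDeriv k) (-(x ^ 2 / 4))
  let q' : ℝ → ℝ := fun x => egf (fun m => besselCoeffDeriv k (m + 1)) (-(x ^ 2 / 4))
  let r : ℝ → ℝ := fun x => egf (besselCoeffDeriv (-(k : ℝ))) (-(x ^ 2 / 4))
  let r' : ℝ → ℝ := fun x => egf (fun m => besselCoeffDeriv (-(k : ℝ)) (m + 1)) (-(x ^ 2 / 4))
  have hzc : Continuous fun x : ℝ => -(x ^ 2 / 4) := by fun_prop
  have cp : Continuous p := (continuous_egf (isBddSeq_besselCoeff k)).comp hzc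
  have cp' : Continuous p' := (continuous_egf (isBddSeq_besselCoeff k).shift).comp hzc
  have cq : Continuous q := (continuous_egf (isBddSeq_besselCoeffDeriv k)).comp hzc
  have cq' : Continuous q' := (continuous_egf (isBddSeq_besselCoeffDeriv k).shift).comp hzc
  have cr : Continuous r := (continuous_egf (isBddSeq_besselCoeffDeriv (-(k : ℝ)))).comp hzc
  have cr' : Continuous r' := (continuous_egf (isBddSeq_besselCoeffDeriv (-(k : ℝ))).shift).comp hzc
  -- The continuous extension to `x = 0` of `x` times the Wronskian of `J_k` with
  -- `∂_ν J_ν|_{ν=-k} + (-1)^k ∂_ν J_ν|_{ν=k}`; the logarithms have cancelled.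
  let Q₁ : ℝ → ℝ := fun x => (-1) ^ k * ((x / 2) ^ k * p x) ^ 2 - 2 * k * (p x * r x) +
      x ^ 2 / 2 * (p' x * r x - p x * r' x) + (-1) ^ k * (((x / 2) ^ k * p x) ^ 2 +
      2 * (x / 2) ^ (2 * k + 2) * (p' x * q x - p x * q' x))
  let Q : ℝ → ℝ := fun x => (-1) ^ k * Real.pi⁻¹ * Q₁ x
  have hQc : Continuous Q := by fun_prop
  have hW : ∀ x, 0 < x → x * (besselJ (-(k : ℝ)) x * (Real.pi⁻¹ * besselOrderDerivDeriv (-(k : ℝ)) x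
        + Real.pi⁻¹ * (-1) ^ k * besselOrderDerivDeriv k x) -
        ((-1) ^ k * besselJDeriv k x) * besselY (-(k : ℝ)) x) = Q x := by
    intro x hx
    have j1 := besselJ_neg_nat k hx
    have j2 := besselJDeriv_neg_nat k hx
    rw [besselY_neg_nat k hx]
    simp only [besselOrderDerivDeriv, besselOrderDeriv]
    rw [← besselJ_eq _ hx, ← besselJ_eq _ hx, j2, j1, besselJ_eq _ hx, besselJDeriv]
    simp only [besselSeriesDeriv, besselSeries, Q, Q₁]
    rw [half_rpow_add_one k hx, half_rpow_add_one (-k) hx, half_rpow_neg_nat k hx,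
      Real.rpow_natCast]
    change x * ((-1) ^ k * ((x / 2) ^ k * p x) * (Real.pi⁻¹ * ((-1) ^ k * ((x / 2) ^ k * p x) / x
      + Real.log (x / 2) * ((-1) ^ k * (k / x * ((x / 2) ^ k * p x) - (x / 2) ^ k * (x / 2) * p' x))
      + (-k / x * (((x / 2) ^ k)⁻¹ * r x) - ((x / 2) ^ k)⁻¹ * (x / 2) * r' x))
      + Real.pi⁻¹ * (-1) ^ k * ((x / 2) ^ k * p x / x
      + Real.log (x / 2) * (k / x * ((x / 2) ^ k * p x) - (x / 2) ^ k * (x / 2) * p' x)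
      + (k / x * ((x / 2) ^ k * q x) - (x / 2) ^ k * (x / 2) * q' x)))
      - (-1) ^ k * (k / x * ((x / 2) ^ k * p x) - (x / 2) ^ k * (x / 2) * p' x) *
      (Real.pi⁻¹ * (Real.log (x / 2) * ((-1) ^ k * ((x / 2) ^ k * p x)) + ((x / 2) ^ k)⁻¹ * r x)
      + Real.pi⁻¹ * (-1) ^ k * (Real.log (x / 2) * ((x / 2) ^ k * p x) + (x / 2) ^ k * q x)))
      = (-1) ^ k * Real.pi⁻¹ * ((-1) ^ k * ((x / 2) ^ k * p x) ^ 2 - 2 * k * (p x * r x) +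
      x ^ 2 / 2 * (p' x * r x - p x * r' x) + (-1) ^ k * (((x / 2) ^ k * p x) ^ 2 +
      2 * (x / 2) ^ (2 * k + 2) * (p' x * q x - p x * q' x)))
    have hX : (x / 2) ^ k ≠ 0 := by positivity
    have hX2 : (x / 2) ^ (2 * k + 2) = ((x / 2) ^ k) ^ 2 * (x / 2) ^ 2 := by ring
    rw [hX2]
    generalize (x / 2) ^ k = X at *
    generalize (-1 : ℝ) ^ k = s
    generalize Real.log (x / 2) = L
    field_simp
    ring
  have hQ0 : Q 0 ≠ 0 := by
    have e1 : Q 0 = (-1) ^ k * Real.pi⁻¹ * (-2 * k * (p 0 * r 0)) := by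
      simp [Q, Q₁, hk]
    have e2 : p 0 = ((k.factorial : ℝ))⁻¹ := by
      simp only [p]
      have := besselCoeff_nat k 0
      simpa [egf_zero] using this
    have e3 : r 0 ≠ 0 := by
      obtain ⟨j, rfl⟩ := Nat.exists_eq_succ_of_ne_zero hk
      have h1 : r 0 = deriv recipGamma (-(j : ℝ)) := by
        simp only [r]
        norm_num [egf_zero, besselCoeffDeriv]
      rw [h1]
      exact deriv_recipGamma_neg_nat j
    rw [e1, e2]
    have hk' : (k : ℝ) ≠ 0 := by exact_mod_cast hk
    have hs : ((-1 : ℝ) ^ k) ≠ 0 := pow_ne_zero _ (by norm_num)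
    have := k.factorial_ne_zero
    have := Real.pi_ne_zero
    positivity
  exact ⟨_, _, hJn, hY, Q 0, hQ0, fun x hx => hJn.wronskian_eq hY hQc.continuousAt hW hx⟩

lemma isFundamentalPair_of_neg {ν : ℝ} (hν : ν < 0) : IsFundamentalPair ν := by
  by_cases h : ∃ n : ℤ, ν = n
  · obtain ⟨n, rfl⟩ := h
    have hn : n < 0 := by exact_mod_cast hν
    obtain ⟨k, rfl⟩ := Int.eq_ofNat_of_zero_le (Int.neg_nonneg_of_nonpos hn.le)|>.imp
      fun k hk => (neg_eq_iff_eq_neg.1 hk)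
    have hk : k ≠ 0 := by rintro rfl; simp at hn
    have := isFundamentalPair_neg_nat hk
    push_cast
    exact_mod_cast this
  · exact isFundamentalPair_of_not_int h

/-- Solutions of Bessel's equation are bounded near infinity, because
`(Z'² + (1 - ν²/x²) Z²) exp(2ν²/x²)` is nonincreasing there. -/
lemma IsBesselSol.bounded {ν : ℝ} {Z Z' : ℝ → ℝ} (h : IsBesselSol ν Z Z') :
    ∃ X > 0, ∃ M, ∀ x, X ≤ x → |Z x| ≤ M := by
  set X : ℝ := 2 * |ν| + 1 with hX
  have hX0 : 0 < X := by positivity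
  let E : ℝ → ℝ := fun x =>
    (Z' x ^ 2 + (1 - ν ^ 2 / x ^ 2) * Z x ^ 2) * Real.exp (2 * ν ^ 2 / x ^ 2)
  have hhalf : ∀ x, X ≤ x → 1 / 2 ≤ 1 - ν ^ 2 / x ^ 2 := by
    intro x hx
    have hx0 : 0 < x := hX0.trans_le hx
    have : ν ^ 2 / x ^ 2 ≤ 1 / 2 := by
      rw [div_le_iff₀ (by positivity)]
      have h1 : |ν| ≥ 0 := abs_nonneg ν
      rw [← sq_abs ν]
      nlinarith
    linarith
  have hd : ∀ x, X ≤ x → HasDerivAt E ((-(2 * Z' x ^ 2 / x) + 2 * ν ^ 2 / x ^ 3 * Z x ^ 2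
      - 4 * ν ^ 2 / x ^ 3 * (Z' x ^ 2 + (1 - ν ^ 2 / x ^ 2) * Z x ^ 2)) *
      Real.exp (2 * ν ^ 2 / x ^ 2)) x := by
    intro x hx
    have hx0 : 0 < x := hX0.trans_le hx
    obtain ⟨h1, h2⟩ := h x hx0
    have h3 : ∀ a : ℝ, HasDerivAt (fun x : ℝ => a / x ^ 2) (-(2 * a / x ^ 3)) x := by
      intro a
      have := ((hasDerivAt_pow 2 x).inv (by positivity)).const_mul a
      simp only [div_eq_mul_inv]
      refine this.congr_deriv ?_
      field_simp
      norm_num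
      ring
    have h4 := ((h2.pow 2).add (((h3 (ν ^ 2)).const_sub 1).mul (h1.pow 2))).mul (h3 (2 * ν ^ 2)).exp
    refine h4.congr_deriv ?_
    simp only [Pi.add_apply, Pi.mul_apply, Pi.pow_apply]
    push_cast
    field_simp
    ring
  have hanti : AntitoneOn E (Ici X) := by
    refine antitoneOn_of_deriv_nonpos (convex_Ici X)
      (fun x hx => (hd x hx).continuousAt.continuousWithinAt)
      (fun x hx => ?_) fun x hx => ?_
    · rw [interior_Ici] at hx
      exact (hd x (le_of_lt hx)).differentiableAt.differentiableWithinAt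
    · rw [interior_Ici] at hx
      have hx' : X ≤ x := le_of_lt hx
      have hx0 : 0 < x := hX0.trans_le hx'
      rw [(hd x hx').deriv]
      refine mul_nonpos_of_nonpos_of_nonneg ?_ (Real.exp_pos _).le
      have h1 := hhalf x hx'
      have h2 : 0 ≤ 2 * Z' x ^ 2 / x := by positivity
      have h3 : 0 ≤ 4 * ν ^ 2 / x ^ 3 := by positivity
      have h4 : 1 / 2 * Z x ^ 2 ≤ Z' x ^ 2 + (1 - ν ^ 2 / x ^ 2) * Z x ^ 2 := by
        nlinarith [sq_nonneg (Z x), sq_nonneg (Z' x)]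
      have h5 := mul_le_mul_of_nonneg_left h4 h3
      have h6 : 4 * ν ^ 2 / x ^ 3 * (1 / 2 * Z x ^ 2) = 2 * ν ^ 2 / x ^ 3 * Z x ^ 2 := by ring
      linarith
  refine ⟨X, hX0, √(2 * E X), fun x hx => ?_⟩
  apply Real.abs_le_sqrt
  have h1 : E x ≤ E X := hanti self_mem_Ici hx hx
  have h2 := hhalf x hx
  have h3 : 1 ≤ Real.exp (2 * ν ^ 2 / x ^ 2) := Real.one_le_exp (by positivity)
  have h4 : 1 / 2 * Z x ^ 2 ≤ Z' x ^ 2 + (1 - ν ^ 2 / x ^ 2) * Z x ^ 2 := by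
    nlinarith [sq_nonneg (Z x), sq_nonneg (Z' x)]
  have h5 : 1 / 2 * Z x ^ 2 ≤ E x := by
    simp only [E]
    nlinarith [sq_nonneg (Z x)]
  linarith

/-! ### The zero-energy solutions `F` and `G` -/

/-- The potential `ℓ(ℓ+1)/r² - C r^β` of the radial operator. -/
def potential (β C : ℝ) (l : ℕ) (r : ℝ) : ℝ := (l : ℝ) * (l + 1) / r ^ 2 - C * r ^ β

/-- `u` is a real solution of `u'' = V u` on `(0,∞)`, with derivative `u'`, where `V` is the radial
potential. -/
def IsZeroEnergySol (β C : ℝ) (l : ℕ) (u u' : ℝ → ℝ) : Prop :=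
  ∀ r, 0 < r → HasDerivAt u (u' r) r ∧ HasDerivAt u' (potential β C l r * u r) r

/-- The argument `x(r) = -2√C/(2+β) r^{(2+β)/2}` of the Bessel functions. -/
def besselArg (β C r : ℝ) : ℝ := -2 * √C / (2 + β) * r ^ ((2 + β) / 2)

lemma besselArg_pos {β C r : ℝ} (hβ : β < -2) (hC : 0 < C) (hr : 0 < r) : 0 < besselArg β C r := by
  have h1 : 0 < √C := Real.sqrt_pos.2 hC
  have h2 : -2 * √C / (2 + β) = 2 * √C / (-(2 + β)) := by rw [div_neg, neg_mul, neg_div]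
  rw [besselArg, h2]
  have : 0 < -(2 + β) := by linarith
  positivity

lemma hasDerivAt_besselArg {β C r : ℝ} (hr : 0 < r) :
    HasDerivAt (besselArg β C) ((2 + β) / 2 * besselArg β C r / r) r := by
  have h := (Real.hasDerivAt_rpow_const (p := (2 + β) / 2) (Or.inl hr.ne')).const_mul
    (-2 * √C / (2 + β))
  refine h.congr_deriv ?_
  rw [besselArg, Real.rpow_sub_one hr.ne']
  ring

/-- The Liouville substitution: `√r Z(x(r))` solves the radial equation if `Z` solves Bessel's. -/
lemma IsBesselSol.isZeroEnergySol {β C : ℝ} (hβ : β < -2) (hC : 0 < C) (l : ℕ) {Z Z' : ℝ → ℝ}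
    (h : IsBesselSol ((2 * (l : ℝ) + 1) / (2 + β)) Z Z') :
    IsZeroEnergySol β C l (fun r => √r * Z (besselArg β C r))
      (fun r => √r / r * (Z (besselArg β C r) / 2
        + (2 + β) / 2 * besselArg β C r * Z' (besselArg β C r))) := by
  intro r hr
  have hx := hasDerivAt_besselArg (β := β) (C := C) hr
  have hx0 := besselArg_pos hβ hC hr
  obtain ⟨h1, h2⟩ := h _ hx0
  have k1 := h1.comp r hx
  have k2 := h2.comp r hx
  simp only [Function.comp_def] at k1 k2
  have hs : HasDerivAt (fun r : ℝ => √r) (√r / (2 * r)) r := by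
    refine (Real.hasDerivAt_sqrt hr.ne').congr_deriv ?_
    have := Real.sq_sqrt hr.le
    have h0 : √r ≠ 0 := (Real.sqrt_pos.2 hr).ne'
    field_simp
    exact this.symm
  have hb : 2 + β ≠ 0 := by linarith
  have hsq : ((2 + β) / 2) ^ 2 * besselArg β C r ^ 2 = C * r ^ β * r ^ 2 := by
    have e1 : (r ^ ((2 + β) / 2)) ^ 2 = r ^ β * r ^ 2 := by
      rw [← Real.rpow_natCast, ← Real.rpow_mul hr.le, ← Real.rpow_natCast r 2,
        ← Real.rpow_add hr]
      congr 1
      push_cast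
      ring
    have e2 : √C ^ 2 = C := Real.sq_sqrt hC.le
    rw [besselArg, mul_pow, e1, div_pow, div_pow, mul_pow, e2]
    field_simp
  refine ⟨(hs.mul k1).congr_deriv ?_, ((hs.div (hasDerivAt_id r) hr.ne').mul
    ((k1.div_const 2).add ((hx.const_mul ((2 + β) / 2)).mul k2))).congr_deriv ?_⟩
  · field_simp
  · rw [potential]
    simp only [Pi.div_apply, Pi.add_apply, Pi.mul_apply, id]
    generalize Z (besselArg β C r) = z at *
    generalize Z' (besselArg β C r) = z' at *
    generalize besselArg β C r = x at *
    generalize r ^ β = t at *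
    have hq : C * t = ((2 + β) / 2) ^ 2 * x ^ 2 / r ^ 2 := by
      field_simp
      linear_combination -4 * hsq
    rw [hq]
    field_simp
    ring

lemma bounded_near_zero_of_bessel {β C : ℝ} (hβ : β < -2) (hC : 0 < C) {ν : ℝ} {Z Z' : ℝ → ℝ}
    (h : IsBesselSol ν Z Z') :
    ∃ M, ∀ r ∈ Ioc (0 : ℝ) 1, |√r * Z (besselArg β C r)| ≤ M := by
  obtain ⟨X, hX, M, hM⟩ := h.bounded
  have ht : Tendsto (besselArg β C) (𝓝[>] 0) atTop := by
    have h1 : 0 < -2 * √C / (2 + β) := by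
      have := besselArg_pos hβ hC one_pos
      simpa [besselArg] using this
    have h2 : Tendsto (fun r : ℝ => r ^ ((2 + β) / 2)) (𝓝[>] 0) atTop := by
      have := tendsto_rpow_neg_nhdsGT_zero (y := (2 + β) / 2) (by linarith)
      exact this
    exact h2.const_mul_atTop h1
  obtain ⟨δ, hδ, hδ'⟩ := mem_nhdsGT_iff_exists_Ioc_subset.1 (ht.eventually_ge_atTop X)
  have hδ0 : (0 : ℝ) < δ := hδ
  have hc : ContinuousOn (fun r => √r * Z (besselArg β C r)) (Icc δ 1) := by
    intro r hr
    have hr0 : 0 < r := hδ0.trans_le hr.1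
    have h1 := (h _ (besselArg_pos hβ hC hr0)).1.continuousAt.comp
      (hasDerivAt_besselArg (β := β) (C := C) hr0).continuousAt
    exact (Real.continuous_sqrt.continuousAt.mul h1).continuousWithinAt
  obtain ⟨M', hM'⟩ := isCompact_Icc.exists_bound_of_continuousOn hc
  refine ⟨max M M', fun r hr => ?_⟩
  by_cases hrδ : r ≤ δ
  · refine le_max_of_le_left ?_
    rw [abs_mul, abs_of_nonneg (Real.sqrt_nonneg r)]
    have h1 := hM _ (hδ' ⟨hr.1, hrδ⟩)
    have h2 : √r ≤ 1 := Real.sqrt_le_one.2 hr.2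
    nlinarith [abs_nonneg (Z (besselArg β C r)), Real.sqrt_nonneg r]
  · exact le_max_of_le_right (hM' r ⟨(not_le.1 hrδ).le, hr.2⟩)

/-- `F` and `G` form a fundamental system of solutions of the radial equation at energy zero, and
both are bounded near the origin. -/
lemma exists_fundamental_system {β C : ℝ} (hβ : β < -2) (hC : 0 < C) (l : ℕ) :
    ∃ F' G' : ℝ → ℝ, IsZeroEnergySol β C l (solF β C l) F' ∧
      IsZeroEnergySol β C l (solG β C l) G' ∧
      (∃ w : ℝ, w ≠ 0 ∧ ∀ r, 0 < r → solF β C l r * G' r - F' r * solG β C l r = w) ∧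
      ∃ M, ∀ r ∈ Ioc (0 : ℝ) 1, |solF β C l r| ≤ M ∧ |solG β C l r| ≤ M := by
  have hν : (2 * (l : ℝ) + 1) / (2 + β) < 0 := div_neg_of_pos_of_neg (by positivity) (by linarith)
  obtain ⟨J', Y', hJ, hY, w, hw, hW⟩ := isFundamentalPair_of_neg hν
  obtain ⟨M₁, hM₁⟩ := bounded_near_zero_of_bessel hβ hC hJ
  obtain ⟨M₂, hM₂⟩ := bounded_near_zero_of_bessel hβ hC hY
  refine ⟨_, _, hJ.isZeroEnergySol hβ hC l, hY.isZeroEnergySol hβ hC l,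
    ⟨(2 + β) / 2 * w, mul_ne_zero (by linarith) hw, fun r hr => ?_⟩, max M₁ M₂, fun r hr =>
    ⟨le_max_of_le_left (hM₁ r hr), le_max_of_le_right (hM₂ r hr)⟩⟩
  rw [← hW _ (besselArg_pos hβ hC hr), solF, solG]
  have := Real.sq_sqrt hr.le
  change √r * besselJ _ (besselArg β C r) * _ - _ * (√r * besselY _ (besselArg β C r)) = _
  generalize besselJ _ (besselArg β C r) = a
  generalize besselY _ (besselArg β C r) = b
  generalize J' (besselArg β C r) = a'
  generalize Y' (besselArg β C r) = b'
  generalize besselArg β C r = x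
  field_simp
  rw [this]
  ring

/-! ### Calculus on the half-line -/

lemma two_le_smooth : (2 : WithTop ℕ∞) ≤ ∞ :=
  WithTop.coe_le_coe.2 (le_top : (2 : ℕ∞) ≤ ⊤)

section Calculus

variable {u v : ℝ → ℂ}

lemma hasDerivAt_of_contDiffOn_Ioi (h : ContDiffOn ℝ 2 u (Ioi 0)) {r : ℝ} (hr : 0 < r) :
    HasDerivAt u (deriv u r) r ∧ HasDerivAt (deriv u) (deriv (deriv u) r) r := by
  have h1 : ContDiffOn ℝ (1 + 1) u (Ioi 0) := h
  obtain ⟨a, -, b⟩ := (contDiffOn_succ_iff_deriv_of_isOpen isOpen_Ioi).1 h1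
  have hm : Ioi (0 : ℝ) ∈ 𝓝 r := Ioi_mem_nhds hr
  exact ⟨(a.differentiableAt hm).hasDerivAt,
    ((b.differentiableOn one_ne_zero).differentiableAt hm).hasDerivAt⟩

lemma continuousOn_deriv_deriv (h : ContDiffOn ℝ 2 u (Ioi 0)) :
    ContinuousOn (deriv (deriv u)) (Ioi 0) := by
  have h1 : ContDiffOn ℝ (1 + 1) u (Ioi 0) := h
  obtain ⟨a, -, b⟩ := (contDiffOn_succ_iff_deriv_of_isOpen isOpen_Ioi).1 h1
  exact b.continuousOn_deriv_of_isOpen isOpen_Ioi le_rfl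

lemma contDiffOn_two_of_hasDerivAt {u u' u'' : ℝ → ℂ}
    (h : ∀ r, 0 < r → HasDerivAt u (u' r) r ∧ HasDerivAt u' (u'' r) r)
    (hc : ContinuousOn u'' (Ioi 0)) : ContDiffOn ℝ 2 u (Ioi 0) := by
  have h1 : ContDiffOn ℝ 1 u' (Ioi 0) := by
    rw [show (1 : WithTop ℕ∞) = 0 + 1 by rfl, contDiffOn_succ_iff_deriv_of_isOpen isOpen_Ioi]
    refine ⟨fun r hr => (h r hr).2.differentiableAt.differentiableWithinAt, by simp, ?_⟩
    rw [contDiffOn_zero]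
    exact hc.congr fun r hr => (h r hr).2.deriv
  rw [show (2 : WithTop ℕ∞) = 1 + 1 by rfl, contDiffOn_succ_iff_deriv_of_isOpen isOpen_Ioi]
  exact ⟨fun r hr => (h r hr).1.differentiableAt.differentiableWithinAt, by simp,
    h1.congr fun r hr => (h r hr).1.deriv⟩

lemma contDiffOn_conj (h : ContDiffOn ℝ 2 u (Ioi 0)) :
    ContDiffOn ℝ 2 (fun r => star (u r)) (Ioi 0) :=
  Complex.conjCLE.contDiff.comp_contDiffOn h

lemma continuousOn_potential (β C : ℝ) (l : ℕ) : ContinuousOn (potential β C l) (Ioi 0) := by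
  intro r hr
  have hr' : r ≠ 0 := (mem_Ioi.1 hr).ne'
  unfold potential
  refine ContinuousAt.continuousWithinAt ?_
  exact (continuousAt_const.div (continuousAt_id.pow 2) (pow_ne_zero 2 hr')).sub
    (continuousAt_const.mul (Real.continuousAt_rpow_const r β (Or.inl hr')))

lemma radialExpr_eq (β C : ℝ) (l : ℕ) (u : ℝ → ℂ) (r : ℝ) :
    radialExpr β C l u r = -deriv (deriv u) r + (potential β C l r : ℂ) * u r := rfl

lemma continuousOn_radialExpr (β C : ℝ) (l : ℕ) (h : ContDiffOn ℝ 2 u (Ioi 0)) :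
    ContinuousOn (radialExpr β C l u) (Ioi 0) := by
  refine (continuousOn_deriv_deriv h).neg.add (ContinuousOn.mul ?_ h.continuousOn)
  exact Complex.continuous_ofReal.comp_continuousOn (continuousOn_potential β C l)

lemma radialExpr_conj (β C : ℝ) (l : ℕ) (u : ℝ → ℂ) (r : ℝ) :
    radialExpr β C l (fun r => star (u r)) r = star (radialExpr β C l u r) := by
  rw [radialExpr_eq, radialExpr_eq, deriv.star', deriv.star']
  simp

lemma radialExpr_congr (β C : ℝ) (l : ℕ) {r : ℝ} (h : u =ᶠ[𝓝 r] v) :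
    radialExpr β C l u r = radialExpr β C l v r := by
  rw [radialExpr_eq, radialExpr_eq, h.deriv.deriv_eq, h.eq_of_nhds]

/-- The Wronskian `u v' - u' v`. -/
def wronskian (u v : ℝ → ℂ) (r : ℝ) : ℂ := u r * deriv v r - deriv u r * v r

lemma wronskian_congr {u v u₁ v₁ : ℝ → ℂ} {r : ℝ} (hu : u =ᶠ[𝓝 r] u₁) (hv : v =ᶠ[𝓝 r] v₁) :
    wronskian u v r = wronskian u₁ v₁ r := by
  rw [wronskian, wronskian, hu.eq_of_nhds, hv.eq_of_nhds, hu.deriv_eq, hv.deriv_eq]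

lemma hasDerivAt_wronskian (β C : ℝ) (l : ℕ) (hu : ContDiffOn ℝ 2 u (Ioi 0))
    (hv : ContDiffOn ℝ 2 v (Ioi 0)) {r : ℝ} (hr : 0 < r) :
    HasDerivAt (wronskian u v)
      (-(u r * radialExpr β C l v r - radialExpr β C l u r * v r)) r := by
  obtain ⟨a1, a2⟩ := hasDerivAt_of_contDiffOn_Ioi hu hr
  obtain ⟨b1, b2⟩ := hasDerivAt_of_contDiffOn_Ioi hv hr
  refine ((a1.mul b2).sub (a2.mul b1)).congr_deriv ?_
  rw [radialExpr_eq, radialExpr_eq]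
  ring

/-- Green's formula. -/
lemma integral_green (β C : ℝ) (l : ℕ) (hu : ContDiffOn ℝ 2 u (Ioi 0))
    (hv : ContDiffOn ℝ 2 v (Ioi 0)) {a b : ℝ} (ha : 0 < a) (hb : 0 < b) :
    ∫ r in a..b, (u r * radialExpr β C l v r - radialExpr β C l u r * v r) =
      wronskian u v a - wronskian u v b := by
  have hsub : uIcc a b ⊆ Ioi 0 := fun r hr => (lt_min ha hb).trans_le hr.1
  have hc : ContinuousOn (fun r => u r * radialExpr β C l v r - radialExpr β C l u r * v r)
      (uIcc a b) :=
    ((hu.continuousOn.mul (continuousOn_radialExpr β C l hv)).sub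
      ((continuousOn_radialExpr β C l hu).mul hv.continuousOn)).mono hsub
  have h := intervalIntegral.integral_eq_sub_of_hasDerivAt
    (fun r hr => hasDerivAt_wronskian β C l hu hv (hsub hr)) (hc.neg.intervalIntegrable)
  rw [intervalIntegral.integral_neg] at h
  linear_combination -h

end Calculus

/-! ### Green's formula in `L²` -/

/-- The integral over `(0,∞)` of a function that vanishes for large `r` is the limit of the
integrals over `(ε, R)`. -/
lemma tendsto_integral_of_eq_zero {g : ℝ → ℂ} (hg : Integrable g (volume.restrict (Ioi (0 : ℝ))))
    {R : ℝ} (hR : 0 < R) (h0 : ∀ r, R < r → g r = 0) :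
    Tendsto (fun ε => ∫ r in ε..R, g r) (𝓝[>] 0) (𝓝 (∫ r in Ioi (0 : ℝ), g r)) := by
  have hI : IntegrableOn g (uIcc 0 R) volume := by
    rw [uIcc_of_le hR.le, integrableOn_Icc_iff_integrableOn_Ioc]
    exact IntegrableOn.mono_set hg Ioc_subset_Ioi_self
  have h1 := intervalIntegral.continuousOn_primitive_interval_left (μ := volume) hI 0
    (by simp)
  have h2 : ∫ r in (0 : ℝ)..R, g r = ∫ r in Ioi (0 : ℝ), g r := by
    rw [intervalIntegral.integral_of_le hR.le]
    refine (setIntegral_eq_of_subset_of_forall_sdiff_eq_zero measurableSet_Ioi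
      Ioc_subset_Ioi_self fun r hr => h0 r ?_).symm
    by_contra hcon
    exact hr.2 ⟨hr.1, not_lt.1 hcon⟩
  rw [← h2]
  refine h1.mono_left (nhdsWithin_le_of_mem ?_)
  rw [uIcc_of_le hR.le]
  exact mem_of_superset (Ioo_mem_nhdsGT hR) Ioo_subset_Icc_self

/-- The boundary term at the origin in Green's formula for two `L²` functions, one of which
vanishes for large `r`. -/
lemma tendsto_wronskian (β C : ℝ) (l : ℕ) {φ ψ φ' ψ' : RadialL2} {u v : ℝ → ℂ}
    (hu : ContDiffOn ℝ 2 u (Ioi 0)) (hv : ContDiffOn ℝ 2 v (Ioi 0))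
    (h1 : ∀ᵐ r ∂(volume.restrict (Ioi (0 : ℝ))), φ r = u r)
    (h2 : ∀ᵐ r ∂(volume.restrict (Ioi (0 : ℝ))), ψ r = radialExpr β C l u r)
    (h3 : ∀ᵐ r ∂(volume.restrict (Ioi (0 : ℝ))), φ' r = v r)
    (h4 : ∀ᵐ r ∂(volume.restrict (Ioi (0 : ℝ))), ψ' r = radialExpr β C l v r)
    {R : ℝ} (hR : ∀ r, R < r → v r = 0) :
    Tendsto (wronskian (fun r => star (u r)) v) (𝓝[>] 0)
      (𝓝 (inner ℂ φ ψ' - inner ℂ ψ φ')) := by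
  set g : ℝ → ℂ := fun r => star (u r) * radialExpr β C l v r -
    radialExpr β C l (fun r => star (u r)) r * v r with hg
  have hae : (fun r => inner ℂ (φ r) (ψ' r) - inner ℂ (ψ r) (φ' r))
      =ᵐ[volume.restrict (Ioi (0 : ℝ))] g := by
    filter_upwards [h1, h2, h3, h4] with r e1 e2 e3 e4
    rw [e1, e2, e3, e4, hg]
    simp only [RCLike.inner_apply, radialExpr_conj]
    rw [mul_comm, mul_comm (v r)]
    rfl
  have hint : Integrable g (volume.restrict (Ioi (0 : ℝ))) :=
    ((L2.integrable_inner φ ψ').sub (L2.integrable_inner ψ φ')).congr hae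
  have hval : ∫ r in Ioi (0 : ℝ), g r = inner ℂ φ ψ' - inner ℂ ψ φ' := by
    rw [L2.inner_def, L2.inner_def, ← integral_sub (L2.integrable_inner φ ψ')
      (L2.integrable_inner ψ φ')]
    exact (integral_congr_ae hae).symm
  set R' := max R 0 + 1
  have hR' : 0 < R' := by positivity
  have hvz : ∀ r, R < r → v =ᶠ[𝓝 r] fun _ => 0 := fun r hr => by
    filter_upwards [lt_mem_nhds hr] with s hs using hR s hs
  have hRR : ∀ r, R' ≤ r → R < r := fun r hr =>
    lt_of_le_of_lt (le_max_left R 0) (lt_of_lt_of_le (lt_add_one _) hr)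
  have hgz : ∀ r, R' < r → g r = 0 := fun r hr => by
    have := radialExpr_congr β C l (hvz r (hRR r hr.le))
    simp only [hg]
    rw [this, hR r (hRR r hr.le), radialExpr_eq]
    simp
  have hlim := tendsto_integral_of_eq_zero hint hR' hgz
  rw [hval] at hlim
  refine hlim.congr' ?_
  filter_upwards [self_mem_nhdsWithin] with ε hε
  rw [hg, integral_green β C l (contDiffOn_conj hu) hv hε hR']
  have : wronskian (fun r => star (u r)) v R' = 0 := by
    rw [wronskian, (hvz R' (hRR R' le_rfl)).deriv_eq, hR R' (hRR R' le_rfl)]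
    simp
  rw [this, sub_zero]

lemma memLp_radial {g : ℝ → ℂ} (hc : ContinuousOn g (Ioi 0)) {M R : ℝ}
    (hM : ∀ r ∈ Ioc (0 : ℝ) 1, ‖g r‖ ≤ M) (hR : ∀ r, R < r → g r = 0) :
    MemLp g 2 (volume.restrict (Ioi (0 : ℝ))) := by
  obtain ⟨M', hM'⟩ := (isCompact_Icc (a := (1 : ℝ)) (b := R)).exists_bound_of_continuousOn
    (hc.mono fun r hr => one_pos.trans_le hr.1)
  have hK : MemLp ((Ioc 0 R).indicator fun _ : ℝ => max M M') 2
      (volume.restrict (Ioi (0 : ℝ))) := by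
    refine memLp_indicator_const _ measurableSet_Ioc _ (Or.inr ?_)
    refine ((Measure.restrict_apply_le _ _).trans_lt ?_).ne
    simp
  refine hK.mono (hc.aestronglyMeasurable measurableSet_Ioi) ?_
  filter_upwards [ae_restrict_mem measurableSet_Ioi] with r hr
  by_cases h : r ≤ R
  · rw [indicator_of_mem (show r ∈ Ioc 0 R from ⟨hr, h⟩)]
    refine le_trans ?_ (le_abs_self _)
    by_cases h1 : r ≤ 1
    · exact le_max_of_le_left (hM r ⟨hr, h1⟩)
    · exact le_max_of_le_right (hM' r ⟨(not_le.1 h1).le, h⟩)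
  · rw [hR r (not_le.1 h), norm_zero]
    exact norm_nonneg _

/-! ### Generators of the radial graphs -/

/-- The combination `cos θ F + sin θ G`. -/
def boundarySol (β C : ℝ) (l : ℕ) (θ : ℝ) (r : ℝ) : ℝ :=
  Real.cos θ * solF β C l r + Real.sin θ * solG β C l r

/-- The pairs `(u, -u'' + V u)` of `L²` functions, where `u` is a `C²` function which vanishes for
large `r` and is a multiple of `cos θ F + sin θ G` near the origin. -/
def coreSet (β C : ℝ) (l : ℕ) (θ : ℝ) : Set (RadialL2 × RadialL2) :=
  {q | ∃ u : ℝ → ℂ, ContDiffOn ℝ 2 u (Ioi 0) ∧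
    (∀ᵐ r ∂(volume.restrict (Ioi (0 : ℝ))), q.1 r = u r) ∧
    (∀ᵐ r ∂(volume.restrict (Ioi (0 : ℝ))), q.2 r = radialExpr β C l u r) ∧
    (∃ R, ∀ r, R < r → u r = 0) ∧
    ∃ c : ℂ, ∃ δ > 0, ∀ r ∈ Ioo 0 δ, u r = c * boundarySol β C l θ r}

/-- The Wronskian of two functions which are real multiples of the same real function. -/
lemma wronskian_eq_zero_of_proportional {w : ℝ → ℝ} {a b : ℂ} {r w' : ℝ} (hw : HasDerivAt w w' r) :
    wronskian (fun r => a * (w r : ℂ)) (fun r => b * (w r : ℂ)) r = 0 := by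
  have h1 := hw.ofReal_comp.const_mul a
  have h2 := hw.ofReal_comp.const_mul b
  rw [wronskian, h1.deriv, h2.deriv]
  ring

lemma exists_boundarySol_deriv {β C : ℝ} (hβ : β < -2) (hC : 0 < C) (l : ℕ) (θ : ℝ) :
    ∃ w', IsZeroEnergySol β C l (boundarySol β C l θ) w' := by
  obtain ⟨F', G', hF, hG, -, -⟩ := exists_fundamental_system hβ hC l
  refine ⟨fun r => Real.cos θ * F' r + Real.sin θ * G' r, fun r hr => ?_⟩
  refine ⟨((hF r hr).1.const_mul _).add ((hG r hr).1.const_mul _),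
    (((hF r hr).2.const_mul _).add ((hG r hr).2.const_mul _)).congr_deriv ?_⟩
  rw [boundarySol]
  ring

/-- Functions with the same boundary condition have vanishing Wronskian near the origin, so that
Green's formula has no boundary term. -/
lemma coreSet_symm {β C : ℝ} (hβ : β < -2) (hC : 0 < C) (l : ℕ) (θ : ℝ) :
    ∀ p ∈ coreSet β C l θ, ∀ q ∈ coreSet β C l θ, inner ℂ p.2 q.1 = inner ℂ p.1 q.2 := by
  rintro p ⟨u, hu, hu1, hu2, -, c, δ, hδ, hc⟩ q ⟨v, hv, hv1, hv2, ⟨R, hR⟩, d, δ', hδ', hd⟩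
  have hlim := tendsto_wronskian β C l hu hv hu1 hu2 hv1 hv2 hR
  have h0 : Tendsto (wronskian (fun r => star (u r)) v) (𝓝[>] 0) (𝓝 0) := by
    refine tendsto_const_nhds.congr' ?_
    filter_upwards [Ioo_mem_nhdsGT (lt_min hδ hδ')] with r hr
    obtain ⟨w', hw⟩ := exists_boundarySol_deriv hβ hC l θ
    rw [← wronskian_eq_zero_of_proportional (a := star c) (b := d) (hw r hr.1).1]
    have hm := Ioo_mem_nhds hr.1 hr.2
    refine (wronskian_congr ?_ ?_).symm
    · filter_upwards [hm] with s hs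
      rw [hc s ⟨hs.1, hs.2.trans_le (min_le_left _ _)⟩]
      simp
    · filter_upwards [hm] with s hs
      exact hd s ⟨hs.1, hs.2.trans_le (min_le_right _ _)⟩
  have := tendsto_nhds_unique hlim h0
  exact (sub_eq_zero.1 this).symm

/-- The pairs `(u, -u'' + V u)` with `u` a test function. -/
lemma exists_testPair (β C : ℝ) (l : ℕ) {u : ℝ → ℂ} (h1 : ContDiff ℝ ∞ u)
    (h2 : HasCompactSupport u) (h3 : tsupport u ⊆ Ioi 0) :
    ∃ q : RadialL2 × RadialL2, q ∈ minGraph β C l ∧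
      (∀ᵐ r ∂(volume.restrict (Ioi (0 : ℝ))), q.1 r = u r) ∧
      (∀ᵐ r ∂(volume.restrict (Ioi (0 : ℝ))), q.2 r = radialExpr β C l u r) := by
  have hu : ContDiffOn ℝ 2 u (Ioi 0) := (h1.of_le two_le_smooth).contDiffOn
  have hz : ∀ r, r ∉ tsupport u → radialExpr β C l u r = 0 := fun r hr => by
    have := notMem_tsupport_iff_eventuallyEq.1 hr
    rw [radialExpr_congr β C l this, radialExpr_eq]
    have hd : deriv (0 : ℝ → ℂ) = 0 := by ext; simp
    rw [hd, hd]
    simp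
  have hsub : tsupport (radialExpr β C l u) ⊆ tsupport u :=
    closure_minimal (fun r hr => by_contra fun h => hr (hz r h)) (isClosed_tsupport u)
  have hcs : HasCompactSupport (radialExpr β C l u) := h2.mono' (subset_closure.trans hsub)
  have hc : Continuous (radialExpr β C l u) :=
    (continuousOn_radialExpr β C l hu).continuous_of_tsupport_subset isOpen_Ioi (hsub.trans h3)
  have m1 : MemLp u 2 (volume.restrict (Ioi (0 : ℝ))) :=
    (h1.continuous.memLp_of_hasCompactSupport h2).restrict _
  have m2 : MemLp (radialExpr β C l u) 2 (volume.restrict (Ioi (0 : ℝ))) :=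
    (hc.memLp_of_hasCompactSupport hcs).restrict _
  refine ⟨(m1.toLp, m2.toLp), ?_, m1.coeFn_toLp, m2.coeFn_toLp⟩
  exact Submodule.le_topologicalClosure _
    (Submodule.subset_span ⟨u, h1, h2, h3, m1.coeFn_toLp, m2.coeFn_toLp⟩)

section Boundary

variable {β C : ℝ} {ξ : ℝ → ℝ}

lemma contDiffOn_boundaryFun (hβ : β < -2) (hC : 0 < C) (hξ : IsLocalizer ξ) (l : ℕ) (θ : ℝ) :
    ContDiffOn ℝ 2 (boundaryFun β C ξ l θ) (Ioi 0) := by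
  obtain ⟨w', hw⟩ := exists_boundarySol_deriv hβ hC l θ
  have h1 : ContDiffOn ℝ 2 (fun r => (boundarySol β C l θ r : ℂ)) (Ioi 0) := by
    refine contDiffOn_two_of_hasDerivAt
      (fun r hr => ⟨(hw r hr).1.ofReal_comp, (hw r hr).2.ofReal_comp⟩) ?_
    refine Complex.continuous_ofReal.comp_continuousOn ((continuousOn_potential β C l).mul ?_)
    exact fun r hr => (hw r hr).1.continuousAt.continuousWithinAt
  have h2 : ContDiffOn ℝ 2 (fun r => (ξ r : ℂ)) (Ioi 0) :=
    Complex.ofRealCLM.contDiff.comp_contDiffOn (hξ.smooth.of_le two_le_smooth)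
  refine (h2.mul h1).congr fun r _ => ?_
  rw [boundaryFun, boundarySol]
  push_cast
  rfl

lemma boundaryFun_eq (hξ : IsLocalizer ξ) (l : ℕ) (θ : ℝ) {r : ℝ} (hr : r ∈ Ioo (0 : ℝ) 1) :
    boundaryFun β C ξ l θ r = boundarySol β C l θ r := by
  rw [boundaryFun, hξ.eq_one r hr, one_mul, boundarySol]

lemma boundaryFun_eq_zero (hξ : IsLocalizer ξ) (l : ℕ) (θ : ℝ) {r : ℝ} (hr : 2 < r) :
    boundaryFun β C ξ l θ r = 0 := by
  rw [boundaryFun, hξ.eq_zero r hr, zero_mul, Complex.ofReal_zero]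

/-- The boundary function `ξ (cos θ F + sin θ G)` and its image under the differential expression
are square integrable. -/
lemma exists_boundaryPair (hβ : β < -2) (hC : 0 < C) (hξ : IsLocalizer ξ) (l : ℕ) (θ : ℝ) :
    ∃ q : RadialL2 × RadialL2,
      (∀ᵐ r ∂(volume.restrict (Ioi (0 : ℝ))), q.1 r = boundaryFun β C ξ l θ r) ∧
      (∀ᵐ r ∂(volume.restrict (Ioi (0 : ℝ))),
        q.2 r = radialExpr β C l (boundaryFun β C ξ l θ) r) := by
  have hu := contDiffOn_boundaryFun hβ hC hξ l θ
  obtain ⟨w', hw⟩ := exists_boundarySol_deriv hβ hC l θ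
  obtain ⟨-, -, -, -, -, M, hM⟩ := exists_fundamental_system hβ hC l
  have hR : ∀ r, (2 : ℝ) < r → boundaryFun β C ξ l θ r = 0 :=
    fun r hr => boundaryFun_eq_zero hξ l θ hr
  have hξc : ContinuousOn ξ (Ioi 0) := hξ.smooth.continuousOn
  have hξ1 : ∀ r ∈ Ioc (0 : ℝ) 1, ξ r = 1 := by
    intro r hr
    rcases hr.2.lt_or_eq with h | rfl
    · exact hξ.eq_one r ⟨hr.1, h⟩
    · have h1 : Tendsto ξ (𝓝[<] 1) (𝓝 (ξ 1)) :=
        ((hξc 1 hr.1).continuousAt (Ioi_mem_nhds hr.1)).mono_left nhdsWithin_le_nhds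
      refine tendsto_nhds_unique h1 (tendsto_const_nhds.congr' ?_)
      filter_upwards [Ioo_mem_nhdsLT one_pos] with s hs using (hξ.eq_one s hs).symm
  have m1 : MemLp (boundaryFun β C ξ l θ) 2 (volume.restrict (Ioi (0 : ℝ))) := by
    refine memLp_radial (M := M + M) hu.continuousOn (fun r hr => ?_) hR
    rw [boundaryFun, hξ1 r hr, one_mul, Complex.norm_real]
    refine (norm_add_le _ _).trans (add_le_add ?_ ?_) <;> rw [norm_mul]
    · exact (mul_le_of_le_one_left (norm_nonneg _) (Real.abs_cos_le_one θ)).trans (hM r hr).1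
    · exact (mul_le_of_le_one_left (norm_nonneg _) (Real.abs_sin_le_one θ)).trans (hM r hr).2
  have hcont := continuousOn_radialExpr β C l hu
  have hzero : ∀ r ∈ Ioo (0 : ℝ) 1, radialExpr β C l (boundaryFun β C ξ l θ) r = 0 := by
    intro r hr
    have he : boundaryFun β C ξ l θ =ᶠ[𝓝 r] fun r => (boundarySol β C l θ r : ℂ) := by
      filter_upwards [Ioo_mem_nhds hr.1 hr.2] with s hs using boundaryFun_eq hξ l θ hs
    have hd : deriv (fun r => (boundarySol β C l θ r : ℂ)) =ᶠ[𝓝 r] fun r => (w' r : ℂ) := by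
      filter_upwards [lt_mem_nhds hr.1] with s hs using (hw s hs).1.ofReal_comp.deriv
    rw [radialExpr_congr β C l he, radialExpr_eq, hd.deriv_eq, (hw r hr.1).2.ofReal_comp.deriv]
    push_cast
    ring
  have m2 : MemLp (radialExpr β C l (boundaryFun β C ξ l θ)) 2
      (volume.restrict (Ioi (0 : ℝ))) := by
    refine memLp_radial (M := 0) (R := 2) hcont (fun r hr => ?_) fun r hr => ?_
    · rcases hr.2.lt_or_eq with h | rfl
      · rw [hzero r ⟨hr.1, h⟩, norm_zero]
      · have h1 := ((hcont 1 hr.1).continuousAt (Ioi_mem_nhds hr.1)).mono_left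
          (nhdsWithin_le_nhds (s := Iio 1))
        have h2 := tendsto_nhds_unique h1 (tendsto_const_nhds.congr' (by
          filter_upwards [Ioo_mem_nhdsLT one_pos] with s hs using (hzero s hs).symm))
        rw [h2, norm_zero]
    · have he : boundaryFun β C ξ l θ =ᶠ[𝓝 r] 0 := by
        filter_upwards [lt_mem_nhds hr] with s hs using hR s hs
      rw [radialExpr_congr β C l he, radialExpr_eq]
      have hd : deriv (0 : ℝ → ℂ) = 0 := by ext; simp
      rw [hd, hd]
      simp
  exact ⟨(m1.toLp, m2.toLp), m1.coeFn_toLp, m2.coeFn_toLp⟩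

lemma boundaryPair_mem_coreSet (hβ : β < -2) (hC : 0 < C) (hξ : IsLocalizer ξ) (l : ℕ) (θ : ℝ)
    {q : RadialL2 × RadialL2}
    (h1 : ∀ᵐ r ∂(volume.restrict (Ioi (0 : ℝ))), q.1 r = boundaryFun β C ξ l θ r)
    (h2 : ∀ᵐ r ∂(volume.restrict (Ioi (0 : ℝ))),
      q.2 r = radialExpr β C l (boundaryFun β C ξ l θ) r) : q ∈ coreSet β C l θ := by
  refine ⟨_, contDiffOn_boundaryFun hβ hC hξ l θ, h1, h2,
    ⟨2, fun r hr => boundaryFun_eq_zero hξ l θ hr⟩, 1, 1, one_pos, fun r hr => ?_⟩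
  rw [boundaryFun_eq hξ l θ hr, one_mul]

lemma radialGraph_le (hβ : β < -2) (hC : 0 < C) (hξ : IsLocalizer ξ) (l : ℕ) (θ : ℝ) :
    radialGraph β C ξ l θ ≤ (Submodule.span ℂ (coreSet β C l θ)).topologicalClosure := by
  refine sup_le (Submodule.topologicalClosure_mono (Submodule.span_mono ?_))
    ((Submodule.span_mono ?_).trans (Submodule.le_topologicalClosure _))
  · rintro q ⟨u, h1, h2, h3, h4, h5⟩
    refine ⟨u, (h1.of_le two_le_smooth).contDiffOn, h4, h5, ?_, 0, ?_⟩
    · obtain ⟨R, hR⟩ := h2.isCompact.bddAbove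
      exact ⟨R, fun r hr => image_eq_zero_of_notMem_tsupport fun h => hr.not_ge (hR h)⟩
    · have h0 : (0 : ℝ) ∉ tsupport u := fun h => lt_irrefl (0 : ℝ) (h3 h)
      obtain ⟨δ, hδ, hδ'⟩ := Metric.eventually_nhds_iff.1 (notMem_tsupport_iff_eventuallyEq.1 h0)
      refine ⟨δ, hδ, fun r hr => ?_⟩
      rw [zero_mul]
      refine hδ' ?_
      rw [Real.dist_eq, sub_zero, abs_of_pos hr.1]
      exact hr.2
  · rintro q ⟨h1, h2⟩
    exact boundaryPair_mem_coreSet hβ hC hξ l θ h1 h2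

lemma isSymmGraph_radialGraph (hβ : β < -2) (hC : 0 < C) (hξ : IsLocalizer ξ) (l : ℕ) (θ : ℝ) :
    IsSymmGraph (radialGraph β C ξ l θ) := fun p hp q hq =>
  (isSymmGraph_span (coreSet_symm hβ hC l θ)).topologicalClosure p
    (radialGraph_le hβ hC hξ l θ hp) q (radialGraph_le hβ hC hξ l θ hq)

end Boundary

/-! ### Weak solutions of second-order equations on the half-line -/

/-- Real-valued test functions on `(0,∞)`. -/
structure IsTest (u : ℝ → ℝ) : Prop where
  smooth : ContDiff ℝ ∞ u
  compact : HasCompactSupport u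
  support : tsupport u ⊆ Ioi 0

namespace IsTest

variable {u v : ℝ → ℝ}

lemma deriv (h : IsTest u) : IsTest (deriv u) :=
  ⟨(contDiff_infty_iff_deriv.1 h.smooth).2, h.compact.deriv,
    tsupport_deriv_subset.trans h.support⟩

lemma sub_const_mul (h : IsTest u) (k : IsTest v) (c : ℝ) : IsTest fun r => u r - c * v r := by
  have hk : HasCompactSupport fun r => c * v r := k.compact.mul_left
  refine ⟨h.smooth.sub (contDiff_const.mul k.smooth), h.compact.sub hk, ?_⟩
  refine (tsupport_sub u fun r => c * v r).trans (union_subset h.support ?_)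
  exact (tsupport_mul_subset_right (f := fun _ => c)).trans k.support

lemma exists_Ioo (h : IsTest u) :
    ∃ a b : ℝ, 0 < a ∧ a ≤ 1 ∧ 1 ≤ b ∧ tsupport u ⊆ Ioo a b := by
  have h0 : (tsupport u)ᶜ ∈ 𝓝 (0 : ℝ) :=
    (isClosed_tsupport u).isOpen_compl.mem_nhds fun h' => lt_irrefl (0 : ℝ) (h.support h')
  obtain ⟨δ, hδ, hδ'⟩ := Metric.mem_nhds_iff.1 h0
  obtain ⟨R, hR⟩ := h.compact.isCompact.bddAbove
  refine ⟨min (δ / 2) 1, max R 1 + 1, by positivity, min_le_right _ _,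
    by linarith [le_max_right R 1], fun r hr => ⟨?_, ?_⟩⟩
  · refine (min_le_left _ _).trans_lt ?_
    by_contra hcon
    have h1 : r ∈ Metric.ball (0 : ℝ) δ := by
      have := h.support hr
      rw [Metric.mem_ball, Real.dist_eq, sub_zero, abs_of_pos this]
      linarith
    exact hδ' h1 hr
  · linarith [hR hr, le_max_left R 1]

lemma eq_zero (_h : IsTest u) {a b r : ℝ} (hab : tsupport u ⊆ Ioo a b) (hr : r ∉ Ioo a b) :
    u r = 0 :=
  image_eq_zero_of_notMem_tsupport fun h' => hr (hab h')

lemma integrable_smul {E : Type*} [NormedAddCommGroup E] [NormedSpace ℝ E] (h : IsTest u)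
    {g : ℝ → E} (hg : LocallyIntegrableOn g (Ioi 0)) : Integrable fun r => u r • g r := by
  have h1 := (hg.integrableOn_compact_subset h.support h.compact.isCompact).continuousOn_smul
    h.smooth.continuous.continuousOn h.compact.isCompact
  refine (integrableOn_iff_integrable_of_support_subset fun r hr => ?_).1 h1
  refine subset_tsupport u fun h0 => hr ?_
  simp only [h0, zero_smul]

/-- A test function with vanishing integral is the derivative of a test function. -/
lemma exists_primitive (h : IsTest v) (h0 : ∫ r, v r = 0) :
    ∃ u, IsTest u ∧ _root_.deriv u = v := by
  obtain ⟨a, b, ha, -, -, hab⟩ := h.exists_Ioo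
  have hd : ∀ r, HasDerivAt (fun r => ∫ s in (0 : ℝ)..r, v s) (v r) r := fun r =>
    h.smooth.continuous.integral_hasStrictDerivAt 0 r |>.hasDerivAt
  have hde : _root_.deriv (fun r => ∫ s in (0 : ℝ)..r, v s) = v := funext fun r => (hd r).deriv
  have hz : ∀ r, r ∉ Icc a b → ∫ s in (0 : ℝ)..r, v s = 0 := by
    intro r hr
    by_cases hra : r < a
    · refine (intervalIntegral.integral_congr (g := fun _ => (0 : ℝ)) fun s hs => ?_).trans (by simp)
      refine h.eq_zero hab fun hs' => ?_
      have := hs.2.trans (max_le ha.le hra.le)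
      linarith [hs'.1]
    · have hrb : b < r := not_le.1 fun hb => hr ⟨not_lt.1 hra, hb⟩
      rw [intervalIntegral.integral_eq_integral_of_support_subset, h0]
      intro s hs
      have := hab (subset_tsupport v hs)
      exact ⟨ha.trans this.1, (this.2.trans hrb).le⟩
  have hsub : tsupport (fun r => ∫ s in (0 : ℝ)..r, v s) ⊆ Icc a b :=
    closure_minimal (fun r hr => by_contra fun h' => hr (hz r h')) isClosed_Icc
  refine ⟨_, ⟨?_, ?_, hsub.trans fun r hr => ha.trans_le hr.1⟩, hde⟩
  · rw [contDiff_infty_iff_deriv, hde]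
    exact ⟨fun r => (hd r).differentiableAt, h.smooth⟩
  · exact HasCompactSupport.of_support_subset_isCompact isCompact_Icc
      ((subset_tsupport _).trans hsub)

end IsTest

/-- There is a test function with integral one. -/
lemma exists_isTest_integral_eq_one : ∃ u, IsTest u ∧ ∫ r, u r = 1 := by
  let f : ContDiffBump (2 : ℝ) := ⟨1 / 2, 1, by norm_num, by norm_num⟩
  refine ⟨f.normed volume, ⟨f.contDiff_normed, f.hasCompactSupport_normed, ?_⟩,
    f.integral_normed⟩
  rw [f.tsupport_normed_eq]
  intro r hr
  rw [Metric.mem_closedBall, Real.dist_eq, abs_le] at hr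
  have : (-1 : ℝ) ≤ r - 2 := hr.1
  exact mem_Ioi.2 (by linarith)

lemma intervalIntegrable_of_locallyIntegrableOn {E : Type*} [NormedAddCommGroup E] {g : ℝ → E}
    (hg : LocallyIntegrableOn g (Ioi 0)) {a b : ℝ} (ha : 0 < a) (hb : 0 < b) :
    IntervalIntegrable g volume a b :=
  (hg.integrableOn_compact_subset (t := uIcc a b) (fun _ hr => (lt_min ha hb).trans_le hr.1)
    isCompact_uIcc).intervalIntegrable

lemma continuousOn_primitive_Ioi {E : Type*} [NormedAddCommGroup E] [NormedSpace ℝ E] {g : ℝ → E}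
    (hg : LocallyIntegrableOn g (Ioi 0)) :
    ContinuousOn (fun r => ∫ s in (1 : ℝ)..r, g s) (Ioi 0) := by
  intro r hr
  have hr0 : 0 < r := hr
  have ha : 0 < min 1 r / 2 := by positivity
  have h1 : min 1 r / 2 < r := by linarith [min_le_right 1 r]
  have h2 : min 1 r / 2 ≤ 1 := by linarith [min_le_left 1 r]
  have hI : IntegrableOn g (Icc (min 1 r / 2) (max 1 r + 1)) :=
    hg.integrableOn_compact_subset (fun s hs => ha.trans_le hs.1) isCompact_Icc
  have hle : min 1 r / 2 ≤ max 1 r + 1 := by linarith [le_max_left 1 r]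
  have h := intervalIntegral.continuousOn_primitive_interval' (μ := volume) (f := g)
    (a := (1 : ℝ)) (b₁ := min 1 r / 2) (b₂ := max 1 r + 1)
    (by rw [intervalIntegrable_iff_integrableOn_Icc_of_le hle]; exact hI)
    (by rw [uIcc_of_le hle]; exact ⟨h2, by linarith [le_max_left 1 r]⟩)
  rw [uIcc_of_le hle] at h
  exact (h.continuousAt (Icc_mem_nhds h1 (by linarith [le_max_right 1 r]))).continuousWithinAt

/-- Integration by parts of the primitive of a locally integrable function against a test
function. -/
lemma integral_deriv_mul_primitive {g : ℝ → ℝ} (hg : LocallyIntegrableOn g (Ioi 0)) {u : ℝ → ℝ}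
    (hu : IsTest u) :
    ∫ r, deriv u r * ∫ s in (1 : ℝ)..r, g s = -∫ r, u r * g r := by
  obtain ⟨a, b, ha, ha1, hb1, hab⟩ := hu.exists_Ioo
  have hb : 0 < b := one_pos.trans_le hb1
  have hI := intervalIntegrable_of_locallyIntegrableOn hg ha hb
  have h1 : (1 : ℝ) ∈ uIcc a b := by rw [uIcc_of_le (ha1.trans hb1)]; exact ⟨ha1, hb1⟩
  have hA := hI.absolutelyContinuousOnInterval_intervalIntegral h1
  have hB : AbsolutelyContinuousOnInterval u a b :=
    (hu.smooth.of_le (by exact_mod_cast le_top)).contDiffOn.absolutelyContinuousOnInterval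
  have key := hA.integral_mul_deriv_eq_deriv_mul hB
  rw [hu.eq_zero hab (fun h => lt_irrefl _ h.1), hu.eq_zero hab (fun h => lt_irrefl _ h.2)] at key
  have hae : ∫ x in a..b, deriv (fun x => ∫ s in (1 : ℝ)..x, g s) x * u x =
      ∫ x in a..b, u x * g x := by
    refine intervalIntegral.integral_congr_ae ?_
    filter_upwards [hI.ae_hasDerivAt_integral] with x hx hx'
    rw [(hx (uIoc_subset_uIcc hx') 1 h1).deriv, mul_comm]
  rw [hae] at key
  have e1 : ∫ x in a..b, u x * g x = ∫ x, u x * g x := by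
    refine intervalIntegral.integral_eq_integral_of_support_subset fun r hr => ?_
    have := hab (subset_tsupport u (left_ne_zero_of_mul hr))
    exact ⟨this.1, this.2.le⟩
  have e2 : ∫ x in a..b, (∫ s in (1 : ℝ)..x, g s) * deriv u x =
      ∫ r, deriv u r * ∫ s in (1 : ℝ)..r, g s := by
    rw [intervalIntegral.integral_eq_integral_of_support_subset]
    · simp only [mul_comm]
    · intro r hr
      have := hab (tsupport_deriv_subset (subset_tsupport _ (right_ne_zero_of_mul hr)))
      exact ⟨this.1, this.2.le⟩
  rw [e1, e2] at key
  rw [key]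
  ring

lemma integral_deriv_smul_primitive {g : ℝ → ℂ} (hg : LocallyIntegrableOn g (Ioi 0)) {u : ℝ → ℝ}
    (hu : IsTest u) :
    ∫ r, deriv u r • ∫ s in (1 : ℝ)..r, g s = -∫ r, u r • g r := by
  have hP : LocallyIntegrableOn (fun r => ∫ s in (1 : ℝ)..r, g s) (Ioi 0) :=
    (continuousOn_primitive_Ioi hg).locallyIntegrableOn measurableSet_Ioi
  have i1 := hu.deriv.integrable_smul hP
  have i2 := hu.integrable_smul hg
  have key : ∀ L : ℂ →L[ℝ] ℝ, L (∫ r, deriv u r • ∫ s in (1 : ℝ)..r, g s) =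
      L (-∫ r, u r • g r) := by
    intro L
    have hL : LocallyIntegrableOn (fun r => L (g r)) (Ioi 0) := fun x hx =>
      (hg x hx).imp fun s hs => ⟨hs.1, L.integrable_comp hs.2⟩
    rw [map_neg, ← L.integral_comp_comm i1, ← L.integral_comp_comm i2]
    simp only [map_smul, smul_eq_mul]
    rw [← integral_deriv_mul_primitive hL hu]
    congr 1
    ext r
    by_cases hr : 0 < r
    · rw [L.intervalIntegral_comp_comm (intervalIntegrable_of_locallyIntegrableOn hg one_pos hr)]
    · have : deriv u r = 0 := image_eq_zero_of_notMem_tsupport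
        fun h => hr (hu.deriv.support h)
      rw [this, zero_mul, zero_mul]
  exact Complex.ext (key Complex.reCLM) (key Complex.imCLM)

/-- The du Bois-Reymond lemma of second order: a locally integrable function with vanishing second
distributional derivative is affine. -/
lemma exists_affine_of_integral_deriv_deriv_eq_zero {g : ℝ → ℂ}
    (hg : LocallyIntegrableOn g (Ioi 0))
    (h : ∀ u, IsTest u → ∫ r, deriv (deriv u) r • g r = 0) :
    ∃ a b : ℂ, ∀ᵐ r, r ∈ Ioi (0 : ℝ) → g r = a + r * b := by
  obtain ⟨η, hη, hη1⟩ := exists_isTest_integral_eq_one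
  have hid : LocallyIntegrableOn (fun r : ℝ => (r : ℂ)) (Ioi 0) :=
    Complex.continuous_ofReal.continuousOn.locallyIntegrableOn measurableSet_Ioi
  have hone : LocallyIntegrableOn (fun _ : ℝ => (1 : ℂ)) (Ioi 0) :=
    continuousOn_const.locallyIntegrableOn measurableSet_Ioi
  set A : ℂ := ∫ r, η r • g r
  set B : ℂ := ∫ r, deriv η r • g r
  set m : ℂ := ∫ r, η r • (r : ℂ)
  have hηC : ∫ r, η r • (1 : ℂ) = 1 := by
    rw [integral_smul_const, hη1, one_smul]
  refine ⟨A + m * B, -B, ?_⟩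
  set f : ℝ → ℂ := fun r => g r - ((A + m * B) + r * (-B)) with hf
  have haff : LocallyIntegrableOn (fun r : ℝ => (A + m * B) + r * (-B)) (Ioi 0) := by
    refine ContinuousOn.locallyIntegrableOn ?_ measurableSet_Ioi
    fun_prop
  have hfl : LocallyIntegrableOn f (Ioi 0) := hg.sub haff
  have key : ∀ v : ℝ → ℝ, ContDiff ℝ ∞ v → HasCompactSupport v → tsupport v ⊆ Ioi 0 →
      ∫ r, v r • f r = 0 := by
    intro v hv1 hv2 hv3
    have hv : IsTest v := ⟨hv1, hv2, hv3⟩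
    -- Subtracting multiples of `η` and `η'` turns `v` into a second derivative `w''`.
    have hv0 : Integrable v := hv1.continuous.integrable_of_hasCompactSupport hv2
    have hη0 : Integrable η := hη.smooth.continuous.integrable_of_hasCompactSupport hη.compact
    obtain ⟨u, hu, hud⟩ := (hv.sub_const_mul hη (∫ r, v r)).exists_primitive (by
      rw [integral_sub hv0 (hη0.const_mul _), integral_const_mul, hη1, mul_one, sub_self])
    have hu0 : Integrable u := hu.smooth.continuous.integrable_of_hasCompactSupport hu.compact
    obtain ⟨w, hw, hwd⟩ := (hu.sub_const_mul hη (∫ r, u r)).exists_primitive (by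
      rw [integral_sub hu0 (hη0.const_mul _), integral_const_mul, hη1, mul_one, sub_self])
    have hw2 : ∀ r, deriv (deriv w) r = v r - (∫ r, v r) * η r - (∫ r, u r) * deriv η r := by
      intro r
      rw [hwd]
      have d1 : HasDerivAt u (deriv u r) r :=
        ((contDiff_infty_iff_deriv.1 hu.smooth).1 r).hasDerivAt
      have d2 : HasDerivAt η (deriv η r) r :=
        ((contDiff_infty_iff_deriv.1 hη.smooth).1 r).hasDerivAt
      rw [(d1.fun_sub (d2.const_mul (∫ r, u r))).deriv, hud]
    have i1 := hv.integrable_smul hg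
    have i2 := hη.integrable_smul hg
    have i3 := hη.deriv.integrable_smul hg
    have e1 : ∫ r, v r • g r = ((∫ r, v r : ℝ) : ℂ) * A + ((∫ r, u r : ℝ) : ℂ) * B := by
      have h0 := h w hw
      simp only [hw2, sub_smul, mul_smul] at h0
      have i4 : Integrable fun r => (∫ r, v r) • η r • g r := i2.smul (∫ r, v r)
      have i5 : Integrable fun r => (∫ r, u r) • deriv η r • g r := i3.smul (∫ r, u r)
      have i6 : Integrable fun r => v r • g r - (∫ r, v r) • η r • g r := i1.sub i4
      rw [integral_sub i6 i5, integral_sub i1 i4,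
        integral_smul, integral_smul, Complex.real_smul, Complex.real_smul] at h0
      linear_combination h0
    -- The integral of `u` is a first moment of `v`.
    have e2 : ((∫ r, u r : ℝ) : ℂ) = -(∫ r, v r • (r : ℂ)) + ((∫ r, v r : ℝ) : ℂ) * m := by
      have k1 := integral_deriv_smul_primitive hone hu
      have k2 : ∀ r : ℝ, ∫ s in (1 : ℝ)..r, (1 : ℂ) = (r : ℂ) - 1 := by
        intro r
        rw [intervalIntegral.integral_const]
        simp
      have k3 : ∫ r, u r • (1 : ℂ) = ((∫ r, u r : ℝ) : ℂ) := by
        rw [integral_smul_const, Complex.real_smul, mul_one]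
      have j1 := hv.integrable_smul hid
      have j2 := hη.integrable_smul hid
      have j3 := hv.integrable_smul hone
      have j4 := hη.integrable_smul hone
      have k4 : ∫ r, v r • (1 : ℂ) = ((∫ r, v r : ℝ) : ℂ) := by
        rw [integral_smul_const, Complex.real_smul, mul_one]
      simp only [k2, hud, sub_smul, smul_sub, mul_smul] at k1
      have j5 : Integrable fun r => (∫ r, v r) • η r • (r : ℂ) := j2.smul (∫ r, v r)
      have j6 : Integrable fun r => (∫ r, v r) • η r • (1 : ℂ) := j4.smul (∫ r, v r)
      have j7 : Integrable fun r => v r • (r : ℂ) - (∫ r, v r) • η r • (r : ℂ) := j1.sub j5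
      have j8 : Integrable fun r => v r • (1 : ℂ) - (∫ r, v r) • η r • (1 : ℂ) := j3.sub j6
      rw [integral_sub j7 j8, integral_sub j1 j5, integral_sub j3 j6, integral_smul, integral_smul, k3, k4, hηC,
        Complex.real_smul, Complex.real_smul] at k1
      linear_combination k1
    have i4 := hv.integrable_smul haff
    simp only [hf, smul_sub]
    rw [integral_sub i1 i4]
    have e3 : ∫ r, v r • ((A + m * B) + (r : ℂ) * (-B)) =
        ((∫ r, v r : ℝ) : ℂ) * (A + m * B) - (∫ r, v r • (r : ℂ)) * B := by
      have j1 := hv.integrable_smul hid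
      have : ∀ r : ℝ, v r • ((A + m * B) + (r : ℂ) * (-B)) =
          v r • (A + m * B) - v r • (r : ℂ) * B := by
        intro r
        simp only [Complex.real_smul]
        ring
      simp only [this]
      rw [integral_sub (hv0.smul_const _) (j1.mul_const _), integral_smul_const,
        integral_mul_const, Complex.real_smul]
    rw [e1, e3, e2]
    ring
  have hae := isOpen_Ioi.ae_eq_zero_of_integral_contDiff_smul_eq_zero hfl key
  filter_upwards [hae] with r hr hr'
  have := hr hr'
  rw [hf] at this
  exact sub_eq_zero.1 this

/-- Regularity of weak solutions: a locally integrable weak solution of `k'' = q k` with continuous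
`q` agrees almost everywhere with a classical one. -/
lemma exists_classical_of_weak {k q : ℝ → ℂ} (hk : LocallyIntegrableOn k (Ioi 0))
    (hq : ContinuousOn q (Ioi 0))
    (h : ∀ u, IsTest u → ∫ r, deriv (deriv u) r • k r = ∫ r, u r • (q r * k r)) :
    ∃ y : ℝ → ℂ, ContDiffOn ℝ 2 y (Ioi 0) ∧ (∀ᵐ r, r ∈ Ioi (0 : ℝ) → k r = y r) ∧
      ∀ r, 0 < r → deriv (deriv y) r = q r * y r := by
  have hκ : LocallyIntegrableOn (fun r => q r * k r) (Ioi 0) :=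
    hk.continuousOn_mul hq isOpen_Ioi.isLocallyClosed
  set K₁ : ℝ → ℂ := fun r => ∫ s in (1 : ℝ)..r, q s * k s with hK₁
  set K₂ : ℝ → ℂ := fun r => ∫ s in (1 : ℝ)..r, K₁ s with hK₂
  have c1 : ContinuousOn K₁ (Ioi 0) := continuousOn_primitive_Ioi hκ
  have l1 : LocallyIntegrableOn K₁ (Ioi 0) := c1.locallyIntegrableOn measurableSet_Ioi
  have c2 : ContinuousOn K₂ (Ioi 0) := continuousOn_primitive_Ioi l1
  have l2 : LocallyIntegrableOn K₂ (Ioi 0) := c2.locallyIntegrableOn measurableSet_Ioi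
  obtain ⟨a, b, hab⟩ := exists_affine_of_integral_deriv_deriv_eq_zero (g := fun r => k r - K₂ r)
    (hk.sub l2) (by
      intro u hu
      simp only [smul_sub]
      rw [integral_sub (hu.deriv.deriv.integrable_smul hk) (hu.deriv.deriv.integrable_smul l2),
        h u hu, integral_deriv_smul_primitive l1 hu.deriv, integral_deriv_smul_primitive hκ hu]
      ring)
  set y : ℝ → ℂ := fun r => K₂ r + (a + r * b) with hy
  have hky : ∀ᵐ r, r ∈ Ioi (0 : ℝ) → k r = y r := by
    filter_upwards [hab] with r hr hr'
    rw [hy]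
    linear_combination hr hr'
  have hyc : ContinuousOn y (Ioi 0) := by
    refine c2.add ?_
    fun_prop
  have hqy : ContinuousOn (fun r => q r * y r) (Ioi 0) := hq.mul hyc
  have hdprim : ∀ f : ℝ → ℂ, ContinuousOn f (Ioi 0) → ∀ r, 0 < r →
      HasDerivAt (fun r => ∫ s in (1 : ℝ)..r, f s) (f r) r := by
    intro f hf r hr
    refine intervalIntegral.integral_hasDerivAt_right
      (intervalIntegrable_of_locallyIntegrableOn (hf.locallyIntegrableOn measurableSet_Ioi)
        one_pos hr) ?_ (hf.continuousAt (Ioi_mem_nhds hr))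
    exact hf.stronglyMeasurableAtFilter isOpen_Ioi r hr
  have hK₁' : ∀ r, 0 < r → K₁ r = ∫ s in (1 : ℝ)..r, q s * y s := by
    intro r hr
    refine intervalIntegral.integral_congr_ae ?_
    filter_upwards [hky] with s hs hs'
    rw [hs ((lt_min one_pos hr).trans_le (uIoc_subset_uIcc hs').1)]
  have d2 : ∀ r, 0 < r → HasDerivAt (fun r => K₁ r + b) (q r * y r) r := by
    intro r hr
    refine ((hdprim _ hqy r hr).congr_of_eventuallyEq ?_).add_const b
    filter_upwards [lt_mem_nhds hr] with s hs using hK₁' s hs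
  have d1 : ∀ r, 0 < r → HasDerivAt y (K₁ r + b) r := by
    intro r hr
    have e1 : HasDerivAt (fun r : ℝ => a + (r : ℂ) * b) b r := by
      have := ((hasDerivAt_id r).ofReal_comp.mul_const b).const_add a
      simpa using this
    exact (hdprim K₁ c1 r hr).add e1
  refine ⟨y, contDiffOn_two_of_hasDerivAt (fun r hr => ⟨d1 r hr, d2 r hr⟩) hqy, hky,
    fun r hr => ?_⟩
  have : deriv y =ᶠ[𝓝 r] fun r => K₁ r + b := by
    filter_upwards [lt_mem_nhds hr] with s hs using (d1 s hs).deriv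
  rw [this.deriv_eq, (d2 r hr).deriv]

/-! ### Vanishing of the deficiency spaces -/

/-- A nonnegative function `N` with bounded primitive `P` cannot satisfy `N'' ≥ a - b N` with
`a > 0` near infinity. -/
lemma no_bounded_primitive {P N N' N'' : ℝ → ℝ} {R a b I : ℝ} (ha : 0 < a) (hb : 0 ≤ b)
    (hP : ∀ r, R ≤ r → HasDerivAt P (N r) r) (hN : ∀ r, R ≤ r → HasDerivAt N (N' r) r)
    (hN' : ∀ r, R ≤ r → HasDerivAt N' (N'' r) r) (hN0 : ∀ r, 0 ≤ N r)
    (hI : ∀ r, R ≤ r → P r ≤ I) (hle : ∀ r, R ≤ r → a - b * N r ≤ N'' r) : False := by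
  have mono : ∀ {f f' : ℝ → ℝ} {R₀ : ℝ}, (∀ r, R₀ ≤ r → HasDerivAt f (f' r) r) →
      (∀ r, R₀ ≤ r → 0 ≤ f' r) → ∀ r, R₀ ≤ r → f R₀ ≤ f r := by
    intro f f' R₀ hf hf' r hr
    have hm : MonotoneOn f (Ici R₀) := by
      refine monotoneOn_of_deriv_nonneg (convex_Ici R₀)
        (fun s hs => (hf s hs).continuousAt.continuousWithinAt) (fun s hs => ?_) fun s hs => ?_
      · rw [interior_Ici] at hs
        exact (hf s (le_of_lt hs)).differentiableAt.differentiableWithinAt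
      · rw [interior_Ici] at hs
        rw [(hf s (le_of_lt hs)).deriv]
        exact hf' s (le_of_lt hs)
    exact hm self_mem_Ici hr hr
  -- `N'` grows at least linearly.
  have h1 : ∀ r, R ≤ r → N' R + b * P R - a * R ≤ N' r + b * P r - a * r := by
    refine mono (f := fun r => N' r + b * P r - a * r) (f' := fun r => N'' r + b * N r - a)
      (fun r hr => ?_) fun r hr => ?_
    · have := ((hN' r hr).fun_add ((hP r hr).const_mul b)).fun_sub ((hasDerivAt_id r).const_mul a)
      simpa using this
    · have := hle r hr
      linarith
  set R₁ := max R ((1 + b * I - (N' R + b * P R - a * R)) / a) with hR₁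
  have h2 : ∀ r, R₁ ≤ r → 1 ≤ N' r := by
    intro r hr
    have hr1 : R ≤ r := (le_max_left _ _).trans hr
    have hr2 := (le_max_right _ _).trans hr
    rw [div_le_iff₀ ha] at hr2
    have := h1 r hr1
    have h3 := mul_le_mul_of_nonneg_left (hI r hr1) hb
    linarith
  have h3 : ∀ r, R₁ ≤ r → N R₁ - R₁ ≤ N r - r := by
    refine mono (f := fun r => N r - r) (f' := fun r => N' r - 1) (fun r hr => ?_) fun r hr => ?_
    · exact (hN r ((le_max_left _ _).trans hr)).sub (hasDerivAt_id r)
    · linarith [h2 r hr]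
  have h4 : ∀ r, R₁ + 1 ≤ r → 1 ≤ N r := by
    intro r hr
    have := h3 r (by linarith)
    linarith [hN0 R₁]
  have h5 : ∀ r, R₁ + 1 ≤ r → P (R₁ + 1) - (R₁ + 1) ≤ P r - r := by
    refine mono (f := fun r => P r - r) (f' := fun r => N r - 1) (fun r hr => ?_) fun r hr => ?_
    · exact (hP r ((le_max_left _ _).trans (by linarith))).sub (hasDerivAt_id r)
    · linarith [h4 r hr]
  have h6 := h5 (R₁ + 1 + (I - P (R₁ + 1) + 1)) (by
    have := hI (R₁ + 1) ((le_max_left _ _).trans (by linarith))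
    linarith)
  have h7 := hI (R₁ + 1 + (I - P (R₁ + 1) + 1)) ((le_max_left R _).trans (by
    have := hI (R₁ + 1) ((le_max_left _ _).trans (by linarith))
    linarith))
  linarith

lemma exists_bound_potential {β C : ℝ} (hβ : β < -2) (hC : 0 < C) (l : ℕ) :
    ∃ M, 0 ≤ M ∧ ∀ r, 1 ≤ r → |potential β C l r| ≤ M := by
  refine ⟨(l : ℝ) * (l + 1) + C, by positivity, fun r hr => ?_⟩
  have hr0 : 0 < r := one_pos.trans_le hr
  have h1 : (l : ℝ) * (l + 1) / r ^ 2 ≤ (l : ℝ) * (l + 1) :=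
    div_le_self (by positivity) (one_le_pow₀ hr)
  have h2 : r ^ β ≤ 1 := Real.rpow_le_one_of_one_le_of_nonpos hr (by linarith)
  have h3 : 0 ≤ (l : ℝ) * (l + 1) / r ^ 2 := by positivity
  have h4 : 0 ≤ r ^ β := by positivity
  rw [potential, abs_le]
  constructor <;> nlinarith

/-- An `L²` solution of `-y'' + V y = z y` with `Im z ≠ 0` for which `Im (y' ȳ)` tends to zero at
the origin vanishes identically: infinity is in the limit point case. -/
lemma eq_zero_of_tendsto_im {β C : ℝ} (hβ : β < -2) (hC : 0 < C) (l : ℕ) {z : ℂ} (hz : z.im ≠ 0)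
    {y : ℝ → ℂ} (hy : ContDiffOn ℝ 2 y (Ioi 0))
    (heq : ∀ r, 0 < r → deriv (deriv y) r = ((potential β C l r : ℂ) - z) * y r)
    (hint : IntegrableOn (fun r => ‖y r‖ ^ 2) (Ioi 0))
    (h0 : Tendsto (fun r => (deriv y r).im * (y r).re - (deriv y r).re * (y r).im)
      (𝓝[>] 0) (𝓝 0)) : ∀ r, 0 < r → y r = 0 := by
  set V := potential β C l
  set a : ℝ → ℝ := fun r => (y r).re
  set b : ℝ → ℝ := fun r => (y r).im
  set a' : ℝ → ℝ := fun r => (deriv y r).re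
  set b' : ℝ → ℝ := fun r => (deriv y r).im
  have da : ∀ r, 0 < r → HasDerivAt a (a' r) r := fun r hr =>
    Complex.reCLM.hasFDerivAt.comp_hasDerivAt r (hasDerivAt_of_contDiffOn_Ioi hy hr).1
  have db : ∀ r, 0 < r → HasDerivAt b (b' r) r := fun r hr =>
    Complex.imCLM.hasFDerivAt.comp_hasDerivAt r (hasDerivAt_of_contDiffOn_Ioi hy hr).1
  have da' : ∀ r, 0 < r → HasDerivAt a' ((V r - z.re) * a r + z.im * b r) r := fun r hr => by
    have h := Complex.reCLM.hasFDerivAt.comp_hasDerivAt r (hasDerivAt_of_contDiffOn_Ioi hy hr).2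
    refine h.congr_deriv ?_
    rw [heq r hr]
    simp [Complex.mul_re, a, b, V]
  have db' : ∀ r, 0 < r → HasDerivAt b' ((V r - z.re) * b r - z.im * a r) r := fun r hr => by
    have h := Complex.imCLM.hasFDerivAt.comp_hasDerivAt r (hasDerivAt_of_contDiffOn_Ioi hy hr).2
    refine h.congr_deriv ?_
    rw [heq r hr]
    simp [Complex.mul_im, a, b, V]
    ring
  set N : ℝ → ℝ := fun r => a r ^ 2 + b r ^ 2 with hN
  have hNy : ∀ r, N r = ‖y r‖ ^ 2 := fun r => by
    rw [Complex.sq_norm, Complex.normSq_apply]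
    simp only [hN, a, b]
    ring
  -- `P = -Im (y' ȳ) / Im z` is a primitive of `N = |y|²`.
  set P : ℝ → ℝ := fun r => -(b' r * a r - a' r * b r) / z.im with hP
  have dP : ∀ r, 0 < r → HasDerivAt P (N r) r := fun r hr => by
    have := ((((db' r hr).mul (da r hr)).sub ((da' r hr).mul (db r hr))).neg).div_const z.im
    refine this.congr_deriv ?_
    simp only [hN]
    field_simp
    ring
  have hP0 : Tendsto P (𝓝[>] 0) (𝓝 0) := by
    have := h0.neg.div_const z.im
    simpa [hP, a, b, a', b'] using this
  have hN0 : ∀ r, 0 ≤ N r := fun r => by positivity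
  have hmono : MonotoneOn P (Ioi 0) := by
    refine monotoneOn_of_deriv_nonneg (convex_Ioi 0)
      (fun s hs => (dP s hs).continuousAt.continuousWithinAt) (fun s hs => ?_) fun s hs => ?_
    · rw [interior_Ioi] at hs
      exact (dP s hs).differentiableAt.differentiableWithinAt
    · rw [interior_Ioi] at hs
      rw [(dP s hs).deriv]
      exact hN0 s
  have hPnonneg : ∀ r, 0 < r → 0 ≤ P r := fun r hr => by
    refine le_of_tendsto hP0 ?_
    filter_upwards [Ioo_mem_nhdsGT hr] with s hs using hmono hs.1 hr hs.2.le
  by_contra! hne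
  obtain ⟨r₀, hr₀, hyr₀⟩ := hne
  have hNr₀ : 0 < N r₀ := by
    rw [hNy]
    have := norm_pos_iff.2 hyr₀
    positivity
  have hc : 0 < P (r₀ + 1) := by
    refine lt_of_le_of_ne (hPnonneg _ (by linarith)) fun hcon => hNr₀.ne' ?_
    have he : P =ᶠ[𝓝 r₀] fun _ => 0 := by
      filter_upwards [Ioo_mem_nhds hr₀ (lt_add_one r₀)] with s hs
      refine le_antisymm ?_ (hPnonneg s hs.1)
      rw [hcon]
      exact hmono hs.1 (hs.1.trans hs.2) hs.2.le
    rw [← (dP r₀ hr₀).deriv, he.deriv_eq, deriv_const]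
  obtain ⟨M, hM0, hM⟩ := exists_bound_potential hβ hC l
  have hNc : ContinuousOn N (Ioi 0) := fun r hr =>
    ((((da r hr).continuousAt.pow 2).add ((db r hr).continuousAt.pow 2))).continuousWithinAt
  have hpos : ∀ r, max (r₀ + 1) 1 ≤ r → 0 < r := fun r hr =>
    one_pos.trans_le ((le_max_right _ _).trans hr)
  refine no_bounded_primitive (P := P) (N := N) (N' := fun r => 2 * (a r * a' r + b r * b' r))
    (N'' := fun r => 2 * (a' r ^ 2 + b' r ^ 2) + 2 * (V r - z.re) * N r)
    (R := max (r₀ + 1) 1) (a := 4 * (P (r₀ + 1) * |z.im|)) (b := 2 + 2 * (M + |z.re|))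
    (I := P 1 + ∫ r in Ioi (0 : ℝ), ‖y r‖ ^ 2) (by positivity) (by positivity)
    (fun r hr => dP r (hpos r hr)) (fun r hr => ?_) (fun r hr => ?_) hN0 (fun r hr => ?_)
    (fun r hr => ?_)
  · refine (((da r (hpos r hr)).pow 2).add ((db r (hpos r hr)).pow 2)).congr_deriv ?_
    simp
    ring
  · refine ((((da r (hpos r hr)).mul (da' r (hpos r hr))).add
      ((db r (hpos r hr)).mul (db' r (hpos r hr)))).const_mul 2).congr_deriv ?_
    simp only [hN]
    ring
  · have h1r : 1 ≤ r := (le_max_right _ _).trans hr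
    have hsub : uIcc 1 r ⊆ Ioi 0 := fun s hs => by
      rw [uIcc_of_le h1r] at hs
      exact one_pos.trans_le hs.1
    have hF := intervalIntegral.integral_eq_sub_of_hasDerivAt (fun s hs => dP s (hsub hs))
      ((hNc.mono hsub).intervalIntegrable)
    have hle : ∫ s in (1 : ℝ)..r, N s ≤ ∫ s in Ioi (0 : ℝ), ‖y s‖ ^ 2 := by
      rw [intervalIntegral.integral_of_le h1r]
      simp only [hNy]
      refine setIntegral_mono_set hint (.of_forall fun s => by positivity) ?_
      exact LE.le.eventuallyLE fun s hs => one_pos.trans hs.1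
    linarith
  · have h1r : 1 ≤ r := (le_max_right _ _).trans hr
    have hPr : P (r₀ + 1) ≤ P r := hmono (mem_Ioi.2 (by linarith)) (hpos r hr)
      ((le_max_left _ _).trans hr)
    have h1 : |b' r * a r - a' r * b r| = P r * |z.im| := by
      rw [← abs_of_nonneg (hPnonneg r (hpos r hr)), ← abs_mul, hP]
      simp only
      rw [div_mul_cancel₀ _ hz, abs_neg]
    have h2 : P (r₀ + 1) * |z.im| ≤ P r * |z.im| :=
      mul_le_mul_of_nonneg_right hPr (abs_nonneg _)
    have h3 : 2 * |b' r * a r - a' r * b r| ≤ a' r ^ 2 + b' r ^ 2 + N r := by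
      simp only [hN]
      rcases abs_cases (b' r * a r - a' r * b r) with ⟨h, -⟩ | ⟨h, -⟩ <;> rw [h] <;>
        nlinarith [sq_nonneg (b' r - a r), sq_nonneg (a' r + b r), sq_nonneg (b' r + a r),
          sq_nonneg (a' r - b r)]
    have h4 : -(M + |z.re|) * N r ≤ (V r - z.re) * N r := by
      refine mul_le_mul_of_nonneg_right ?_ (hN0 r)
      have := (abs_le.1 (hM r h1r)).1
      have := le_abs_self z.re
      linarith
    linarith

/-- Symmetric extensions with boundary condition `cos θ F + sin θ G` have dense range of `A - z` for
nonreal `z`: a function orthogonal to the range is an `L²` solution of `-y'' + V y = z y` that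
satisfies the boundary condition. -/
lemma eq_zero_of_orthogonal {β C : ℝ} {ξ : ℝ → ℝ} (hβ : β < -2) (hC : 0 < C)
    (hξ : IsLocalizer ξ) (l : ℕ) (θ : ℝ) {z : ℂ} (hz : z.im ≠ 0) {h : RadialL2}
    (horth : ∀ q ∈ radialGraph β C ξ l θ, inner ℂ h (q.2 - z • q.1) = (0 : ℂ)) : h = 0 := by
  set k : ℝ → ℂ := fun r => star (h r) with hkdef
  have hmem : MemLp (fun r => h r) 2 (volume.restrict (Ioi (0 : ℝ))) := Lp.memLp h
  have hmemk : MemLp k 2 (volume.restrict (Ioi (0 : ℝ))) := hmem.star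
  have hk : LocallyIntegrableOn k (Ioi 0) :=
    locallyIntegrableOn_of_locallyIntegrable_restrict (hmemk.locallyIntegrable one_le_two)
  set q : ℝ → ℂ := fun r => (potential β C l r : ℂ) - z with hq
  have hqc : ContinuousOn q (Ioi 0) :=
    (Complex.continuous_ofReal.comp_continuousOn (continuousOn_potential β C l)).sub
      continuousOn_const
  have hweak : ∀ u, IsTest u → ∫ r, deriv (deriv u) r • k r = ∫ r, u r • (q r * k r) := by
    intro u hu
    have hs1 : ContDiff ℝ ∞ fun r => (u r : ℂ) := Complex.ofRealCLM.contDiff.comp hu.smooth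
    have hs2 : HasCompactSupport fun r => (u r : ℂ) :=
      hu.compact.comp_left (g := fun x : ℝ => (x : ℂ)) Complex.ofReal_zero
    have hs3 : tsupport (fun r => (u r : ℂ)) ⊆ Ioi 0 :=
      (closure_mono fun r (hr : (u r : ℂ) ≠ 0) (h0 : u r = 0) => hr (by simp [h0])).trans hu.support
    obtain ⟨p, hp, hp1, hp2⟩ := exists_testPair β C l hs1 hs2 hs3
    have h0 := horth p (le_sup_left (α := Submodule ℂ (RadialL2 × RadialL2)) hp)
    have hd : ∀ r, HasDerivAt u (deriv u r) r := fun r =>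
      ((contDiff_infty_iff_deriv.1 hu.smooth).1 r).hasDerivAt
    have hd' : ∀ r, HasDerivAt (deriv u) (deriv (deriv u) r) r := fun r =>
      ((contDiff_infty_iff_deriv.1 hu.deriv.smooth).1 r).hasDerivAt
    have e1 : deriv (fun r => (u r : ℂ)) = fun r => ((deriv u r : ℝ) : ℂ) :=
      funext fun r => (hd r).ofReal_comp.deriv
    have e2 : deriv (fun r => ((deriv u r : ℝ) : ℂ)) = fun r => ((deriv (deriv u) r : ℝ) : ℂ) :=
      funext fun r => (hd' r).ofReal_comp.deriv
    rw [L2.inner_def] at h0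
    have hae : ∀ᵐ r ∂(volume.restrict (Ioi (0 : ℝ))), inner ℂ (h r) ((p.2 - z • p.1 : RadialL2) r)
        = u r • (q r * k r) - deriv (deriv u) r • k r := by
      filter_upwards [hp1, hp2, Lp.coeFn_sub p.2 (z • p.1), Lp.coeFn_smul z p.1]
        with r a1 a2 a3 a4
      rw [a3, Pi.sub_apply, a4, Pi.smul_apply, a1, a2, radialExpr_eq, e1, e2]
      simp only [RCLike.inner_apply, hkdef, hq, Complex.real_smul, smul_eq_mul]
      change _ * star (h r) = _
      ring
    rw [integral_congr_ae hae] at h0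
    have i1 : Integrable fun r => u r • (q r * k r) :=
      hu.integrable_smul (hk.continuousOn_mul hqc isOpen_Ioi.isLocallyClosed)
    have i2 : Integrable fun r => deriv (deriv u) r • k r := hu.deriv.deriv.integrable_smul hk
    rw [setIntegral_eq_integral_of_forall_compl_eq_zero, integral_sub i1 i2] at h0
    · exact (sub_eq_zero.1 h0).symm
    · intro r hr
      have a1 : u r = 0 := image_eq_zero_of_notMem_tsupport fun h' => hr (hu.support h')
      have a2 : deriv (deriv u) r = 0 :=
        image_eq_zero_of_notMem_tsupport fun h' => hr (hu.deriv.deriv.support h')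
      rw [a1, a2, zero_smul, zero_smul, sub_zero]
  obtain ⟨y, hy, hky, hyeq⟩ := exists_classical_of_weak hk hqc hweak
  have hky' : ∀ᵐ r ∂(volume.restrict (Ioi (0 : ℝ))), k r = y r :=
    (ae_restrict_iff' measurableSet_Ioi).2 hky
  have hτy : ∀ r, 0 < r → radialExpr β C l y r = z * y r := fun r hr => by
    rw [radialExpr_eq, hyeq r hr, hq]
    ring
  have hymem : MemLp y 2 (volume.restrict (Ioi (0 : ℝ))) := hmemk.ae_eq hky'
  have hint : IntegrableOn (fun r => ‖y r‖ ^ 2) (Ioi 0) := by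
    have := hymem.integrable_norm_pow two_ne_zero
    exact_mod_cast this
  -- The boundary condition at the origin: `W(y, w) → 0` for `w = cos θ F + sin θ G`.
  obtain ⟨f, hf1, hf2⟩ := exists_boundaryPair hβ hC hξ l θ
  have hfg : f ∈ radialGraph β C ξ l θ :=
    le_sup_right (a := minGraph β C l) (Submodule.subset_span ⟨hf1, hf2⟩)
  have hA₀ : Tendsto (wronskian y (boundaryFun β C ξ l θ)) (𝓝[>] 0) (𝓝 0) := by
    have hlim := tendsto_wronskian β C l (φ := h) (ψ := star z • h) (φ' := f.1) (ψ' := f.2)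
      (u := fun r => star (y r)) (contDiffOn_conj hy) (contDiffOn_boundaryFun hβ hC hξ l θ)
      (by
        filter_upwards [hky'] with r hr
        rw [← hr, hkdef, star_star])
      (by
        filter_upwards [hky', Lp.coeFn_smul (star z) h, ae_restrict_mem measurableSet_Ioi]
          with r hr hr2 hr3
        rw [hr2, radialExpr_conj, hτy r hr3, Pi.smul_apply, star_mul', ← hr, hkdef, star_star]
        rfl) hf1 hf2 (fun r hr => boundaryFun_eq_zero hξ l θ hr)
    have hz0 : inner ℂ h f.2 - inner ℂ (star z • h) f.1 = (0 : ℂ) := by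
      have := horth f hfg
      rw [inner_sub_right, inner_smul_right] at this
      rw [inner_smul_left]
      simpa using this
    rw [hz0] at hlim
    simpa only [star_star] using hlim
  obtain ⟨F', G', hF, hG, ⟨w₀, hw₀, hW⟩, M, hM⟩ := exists_fundamental_system hβ hC l
  set w : ℝ → ℝ := boundarySol β C l θ
  set w₂ : ℝ → ℝ := boundarySol β C l (θ + Real.pi / 2)
  set w' : ℝ → ℝ := fun r => Real.cos θ * F' r + Real.sin θ * G' r
  set w₂' : ℝ → ℝ := fun r => -Real.sin θ * F' r + Real.cos θ * G' r
  have hw₂def : w₂ = fun r => -Real.sin θ * solF β C l r + Real.cos θ * solG β C l r := by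
    funext r
    simp only [w₂, boundarySol, Real.cos_add_pi_div_two, Real.sin_add_pi_div_two]
  have hw : ∀ r, 0 < r → HasDerivAt w (w' r) r := fun r hr =>
    ((hF r hr).1.const_mul _).add ((hG r hr).1.const_mul _)
  have hw₂ : ∀ r, 0 < r → HasDerivAt w₂ (w₂' r) r ∧
      HasDerivAt w₂' (potential β C l r * w₂ r) r := fun r hr => by
    rw [hw₂def]
    refine ⟨((hF r hr).1.const_mul _).add ((hG r hr).1.const_mul _),
      (((hF r hr).2.const_mul _).add ((hG r hr).2.const_mul _)).congr_deriv ?_⟩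
    ring
  have hWw : ∀ r, 0 < r → w r * w₂' r - w' r * w₂ r = w₀ := fun r hr => by
    rw [← hW r hr, hw₂def]
    simp only [w, boundarySol, w', w₂']
    linear_combination (solF β C l r * G' r - F' r * solG β C l r) * (Real.sin_sq_add_cos_sq θ)
  set A : ℝ → ℂ := fun r => y r * (w' r : ℂ) - deriv y r * (w r : ℂ) with hA
  set B : ℝ → ℂ := fun r => y r * (w₂' r : ℂ) - deriv y r * (w₂ r : ℂ) with hB
  have hAlim : Tendsto A (𝓝[>] 0) (𝓝 0) := by
    refine hA₀.congr' ?_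
    filter_upwards [Ioo_mem_nhdsGT one_pos] with r hr
    have he : boundaryFun β C ξ l θ =ᶠ[𝓝 r] fun r => (w r : ℂ) := by
      filter_upwards [Ioo_mem_nhds hr.1 hr.2] with s hs using boundaryFun_eq hξ l θ hs
    rw [wronskian_congr (EventuallyEq.refl _ y) he, wronskian, (hw r hr.1).ofReal_comp.deriv]
  -- The Wronskian with the complementary solution stays bounded, since its derivative is
  -- integrable.
  obtain ⟨K, hK⟩ : ∃ K, ∀ r ∈ Ioo (0 : ℝ) 1, ‖B r‖ ≤ K := by
    have hyc : ContinuousOn y (Ioi 0) := hy.continuousOn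
    have hw₂c : ContinuousOn (fun r => (w₂ r : ℂ)) (Ioi 0) := fun r hr =>
      (hw₂ r hr).1.ofReal_comp.continuousAt.continuousWithinAt
    have dB : ∀ r, 0 < r → HasDerivAt B (z * (y r * (w₂ r : ℂ))) r := fun r hr => by
      obtain ⟨y1, y2⟩ := hasDerivAt_of_contDiffOn_Ioi hy hr
      refine ((y1.mul (hw₂ r hr).2.ofReal_comp).sub
        (y2.mul (hw₂ r hr).1.ofReal_comp)).congr_deriv ?_
      rw [hyeq r hr, hq]
      push_cast
      ring
    have hyI : IntegrableOn (fun r => ‖y r‖) (Ioc 0 1) := by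
      have := (hymem.restrict (Ioc 0 1))
      rw [Measure.restrict_restrict measurableSet_Ioc,
        inter_eq_left.2 Ioc_subset_Ioi_self] at this
      exact (this.integrable one_le_two).norm
    refine ⟨‖B 1‖ + ‖z‖ * (2 * M) * ∫ r in Ioc (0 : ℝ) 1, ‖y r‖, fun r hr => ?_⟩
    have hsub : uIcc r 1 ⊆ Ioi 0 := fun s hs => by
      rw [uIcc_of_le hr.2.le] at hs
      exact hr.1.trans_le hs.1
    have hF := intervalIntegral.integral_eq_sub_of_hasDerivAt (fun s hs => dB s (hsub hs))
      ((continuousOn_const.mul (hyc.mul hw₂c)).mono hsub).intervalIntegrable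
    have hsub' : Ioc r 1 ⊆ Ioc 0 1 := Ioc_subset_Ioc_left hr.1.le
    have hM0 : 0 ≤ M := (abs_nonneg _).trans (hM 1 ⟨one_pos, le_rfl⟩).1
    have hle : ‖∫ s in r..1, z * (y s * (w₂ s : ℂ))‖ ≤
        ‖z‖ * (2 * M) * ∫ s in Ioc (0 : ℝ) 1, ‖y s‖ := by
      rw [intervalIntegral.integral_of_le hr.2.le]
      refine (norm_integral_le_integral_norm _).trans ?_
      have hstep : ∫ s in Ioc r 1, ‖z * (y s * (w₂ s : ℂ))‖ ≤
          ∫ s in Ioc r 1, ‖z‖ * (2 * M) * ‖y s‖ := by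
        refine setIntegral_mono_on ?_ ((hyI.mono_set hsub').const_mul _) measurableSet_Ioc
          fun s hs => ?_
        · have := ((continuousOn_const (c := z)).mul (hyc.mul hw₂c)).mono hsub
          rw [uIcc_of_le hr.2.le] at this
          exact (this.norm.integrableOn_Icc).mono_set Ioc_subset_Icc_self
        · rw [norm_mul, norm_mul, Complex.norm_real]
          have hb : ‖w₂ s‖ ≤ 2 * M := by
            obtain ⟨m1, m2⟩ := hM s (hsub' hs)
            rw [hw₂def, two_mul]
            refine (norm_add_le _ _).trans (add_le_add ?_ ?_) <;> rw [norm_mul]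
            · rw [norm_neg]
              exact (mul_le_of_le_one_left (norm_nonneg _) (Real.abs_sin_le_one θ)).trans m1
            · exact (mul_le_of_le_one_left (norm_nonneg _) (Real.abs_cos_le_one θ)).trans m2
          calc ‖z‖ * (‖y s‖ * ‖w₂ s‖) ≤ ‖z‖ * (‖y s‖ * (2 * M)) := by gcongr
            _ = ‖z‖ * (2 * M) * ‖y s‖ := by ring
      refine hstep.trans ?_
      rw [integral_const_mul]
      refine mul_le_mul_of_nonneg_left ?_ (by positivity)
      exact setIntegral_mono_set hyI (.of_forall fun s => norm_nonneg _)
        (LE.le.eventuallyLE hsub')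
    have hBr : B r = B 1 - ∫ s in r..1, z * (y s * (w₂ s : ℂ)) := by
      rw [hF]
      ring
    rw [hBr]
    exact (norm_sub_le _ _).trans (add_le_add le_rfl hle)
  -- The Plücker relation expresses `Im (y' ȳ)` through the two Wronskians.
  have hplucker : ∀ r, 0 < r → (deriv y r).im * (y r).re - (deriv y r).re * (y r).im =
      (B r * star (A r)).im / w₀ := fun r hr => by
    have h1 := hWw r hr
    rw [eq_div_iff hw₀, ← h1]
    simp only [hA, hB, Complex.star_def, map_sub, map_mul, Complex.conj_ofReal]
    simp [Complex.mul_im, Complex.mul_re]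
    ring
  have h0 : Tendsto (fun r => (deriv y r).im * (y r).re - (deriv y r).re * (y r).im)
      (𝓝[>] 0) (𝓝 0) := by
    have hprod : Tendsto (fun r => B r * star (A r)) (𝓝[>] 0) (𝓝 0) := by
      refine squeeze_zero_norm' (a := fun r => K * ‖A r‖) ?_ ?_
      · filter_upwards [Ioo_mem_nhdsGT one_pos] with r hr
        rw [norm_mul, norm_star]
        exact mul_le_mul_of_nonneg_right (hK r hr) (norm_nonneg _)
      · simpa using hAlim.norm.const_mul K
    have him := ((Complex.continuous_im.tendsto 0).comp hprod).div_const w₀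
    simp only [Complex.zero_im, zero_div] at him
    refine him.congr' ?_
    filter_upwards [self_mem_nhdsWithin] with r hr
    exact (hplucker r hr).symm
  have hzero := eq_zero_of_tendsto_im hβ hC l hz hy hyeq hint h0
  refine Lp.ext ?_
  filter_upwards [hky', ae_restrict_mem measurableSet_Ioi,
    Lp.coeFn_zero ℂ 2 (volume.restrict (Ioi (0 : ℝ)))] with r h1 h2 h3
  rw [h3, Pi.zero_apply]
  have h4 : star (h r) = 0 := by
    have := hzero r h2
    rw [← h1] at this
    exact this
  exact star_eq_zero.1 h4

/-! ### Polar coordinates -/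

/-- Euclidean three-space. -/
abbrev Space : Type := EuclideanSpace ℝ (Fin 3)

/-- The unit sphere. -/
abbrev Sph : Type := Metric.sphere (0 : Space) 1

/-- The surface measure on the unit sphere. -/
abbrev sphMeasure : Measure Sph := (volume : Measure Space).toSphere

lemma finrank_space_sub_one : Module.finrank ℝ Space - 1 = 2 := by
  rw [finrank_euclideanSpace_fin]

/-- Polar coordinates, in the form of a measure preserving map. -/
lemma measurePreserving_polar :
    MeasurePreserving (homeomorphUnitSphereProd Space) ((volume : Measure Space).comap (↑))
      (sphMeasure.prod (Measure.volumeIoiPow 2)) := by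
  have h := (volume : Measure Space).measurePreserving_homeomorphUnitSphereProd
  rwa [finrank_space_sub_one] at h

lemma integral_volumeIoiPow_two {F : Type*} [NormedAddCommGroup F] [NormedSpace ℝ F] (g : ℝ → F) :
    ∫ r : Ioi (0 : ℝ), g r ∂(Measure.volumeIoiPow 2) = ∫ r in Ioi (0 : ℝ), r ^ 2 • g r := by
  simp only [Measure.volumeIoiPow, ENNReal.ofReal]
  rw [integral_withDensity_eq_integral_smul,
    integral_subtype_comap measurableSet_Ioi fun a : ℝ => Real.toNNReal (a ^ 2) • g a,
    setIntegral_congr_fun measurableSet_Ioi fun x hx => ?_]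
  · rw [NNReal.smul_def, Real.coe_toNNReal _ (by positivity)]
  · exact (measurable_subtype_coe.pow_const _).real_toNNReal

lemma integrable_volumeIoiPow_two {F : Type*} [NormedAddCommGroup F] [NormedSpace ℝ F]
    {g : ℝ → F} : Integrable (fun r : Ioi (0 : ℝ) => g r) (Measure.volumeIoiPow 2) ↔
      IntegrableOn (fun r => r ^ 2 • g r) (Ioi 0) := by
  rw [integrableOn_iff_comap_subtypeVal measurableSet_Ioi, Measure.volumeIoiPow,
    integrable_withDensity_iff_integrable_smul', integrable_congr]
  · refine .of_forall ?_
    rintro ⟨x, hx : 0 < x⟩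
    simp (disch := positivity) [ENNReal.toReal_ofReal]
  · fun_prop
  · simp

/-- Integration in polar coordinates of a function of product form. -/
lemma integral_polar (k : Space → ℂ) (g : ℝ → ℂ) :
    ∫ x : Space, k (‖x‖⁻¹ • x) * g ‖x‖ =
      (∫ s : Sph, k s ∂sphMeasure) * ∫ r in Ioi (0 : ℝ), r ^ 2 • g r := by
  calc ∫ x : Space, k (‖x‖⁻¹ • x) * g ‖x‖
      = ∫ x : ({(0 : Space)}ᶜ : Set Space), k (‖x.1‖⁻¹ • x.1) * g ‖x.1‖
          ∂((volume : Measure Space).comap (↑)) := by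
        rw [integral_subtype_comap (measurableSet_singleton _).compl
          fun x : Space => k (‖x‖⁻¹ • x) * g ‖x‖, restrict_compl_singleton]
    _ = ∫ x : Sph × Ioi (0 : ℝ), k x.1 * g x.2 ∂sphMeasure.prod (.volumeIoiPow 2) := by
        simpa using measurePreserving_polar.integral_comp
          (Homeomorph.measurableEmbedding _) (fun x : Sph × Ioi (0 : ℝ) => k x.1 * g x.2)
    _ = (∫ s : Sph, k s ∂sphMeasure) * ∫ r : Ioi (0 : ℝ), g r ∂(Measure.volumeIoiPow 2) :=
        integral_prod_mul (fun s : Sph => k s) (fun r : Ioi (0 : ℝ) => g r)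
    _ = _ := by rw [integral_volumeIoiPow_two]

lemma integrable_polar {𝕜 : Type*} [RCLike 𝕜] {k : Space → 𝕜} {g : ℝ → 𝕜}
    (hk : Integrable (fun s : Sph => k s) sphMeasure)
    (hg : IntegrableOn (fun r => r ^ 2 • g r) (Ioi 0)) :
    Integrable fun x : Space => k (‖x‖⁻¹ • x) * g ‖x‖ := by
  have h1 := hk.mul_prod (integrable_volumeIoiPow_two.2 hg)
  have h2 := (measurePreserving_polar.integrable_comp_emb (Homeomorph.measurableEmbedding _)).2 h1
  rw [← restrict_compl_singleton (μ := (volume : Measure Space)) 0, ← IntegrableOn,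
    integrableOn_iff_comap_subtypeVal (measurableSet_singleton _).compl]
  refine h2.congr (.of_forall fun x => ?_)
  simp

/-- The norm pulls back null sets of `(0,∞)` to null sets of `ℝ³`. -/
lemma quasiMeasurePreserving_norm :
    Measure.QuasiMeasurePreserving (fun x : Space => ‖x‖) volume
      (volume.restrict (Ioi (0 : ℝ))) := by
  refine ⟨measurable_norm, Measure.AbsolutelyContinuous.mk fun s hs hs0 => ?_⟩
  rw [Measure.map_apply measurable_norm hs]
  rw [← restrict_compl_singleton (μ := (volume : Measure Space)) 0,
    ← map_comap_subtype_coe (measurableSet_singleton (0 : Space)).compl,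
    Measure.map_apply measurable_subtype_coe (measurable_norm hs)]
  have h1 : (Subtype.val : ({(0 : Space)}ᶜ : Set Space) → Space) ⁻¹' ((fun x => ‖x‖) ⁻¹' s) =
      homeomorphUnitSphereProd Space ⁻¹' (univ ×ˢ (Subtype.val ⁻¹' s)) := by
    ext x
    simp
  rw [h1, measurePreserving_polar.measure_preimage
    (MeasurableSet.univ.prod (measurable_subtype_coe hs)).nullMeasurableSet, Measure.prod_prod]
  have h2 : Measure.volumeIoiPow 2 (Subtype.val ⁻¹' s) = 0 := by
    refine withDensity_absolutelyContinuous _ _ ?_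
    rw [Measure.restrict_apply hs] at hs0
    rw [comap_subtype_coe_apply measurableSet_Ioi, Subtype.image_preimage_coe, inter_comm]
    exact hs0
  rw [h2, mul_zero]

/-! ### Functions of the form `r⁻¹ φ(r) Y(ω)` -/

/-- The value of a polynomial at a point of `ℝ³`. -/
def polyEval (p : MvPolynomial (Fin 3) ℂ) (x : Space) : ℂ :=
  MvPolynomial.eval (fun i => ((x i : ℝ) : ℂ)) p

lemma continuous_polyEval (p : MvPolynomial (Fin 3) ℂ) : Continuous (polyEval p) := by
  have h : Continuous fun x : Space => (fun i => ((x i : ℝ) : ℂ) : Fin 3 → ℂ) := by fun_prop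
  exact (MvPolynomial.continuous_eval p).comp h

lemma polyEval_mul (p q : MvPolynomial (Fin 3) ℂ) (x : Space) :
    polyEval (p * q) x = polyEval p x * polyEval q x := by simp [polyEval]

/-- The `L²(S²)` inner product of the restrictions of two polynomials to the unit sphere. -/
def sphInner (p q : MvPolynomial (Fin 3) ℂ) : ℂ :=
  ∫ s : Sph, star (polyEval p s) * polyEval q s ∂sphMeasure

lemma isTensor_iff (φ : RadialL2) (p : MvPolynomial (Fin 3) ℂ) (Ψ : SpaceL2) :
    IsTensor φ p Ψ ↔ ∀ᵐ x : Space, Ψ x = polyEval p (‖x‖⁻¹ • x) * (((‖x‖⁻¹ : ℝ) : ℂ) * φ ‖x‖) := by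
  refine eventually_congr (.of_forall fun x => ?_)
  rw [mul_comm (polyEval p _)]
  rfl

lemma integrable_radial_inner (φ ψ : RadialL2) :
    IntegrableOn (fun r : ℝ => r ^ 2 • (star (((r⁻¹ : ℝ) : ℂ) * φ r) * (((r⁻¹ : ℝ) : ℂ) * ψ r)))
      (Ioi 0) ∧ ∫ r in Ioi (0 : ℝ),
        r ^ 2 • (star (((r⁻¹ : ℝ) : ℂ) * φ r) * (((r⁻¹ : ℝ) : ℂ) * ψ r)) = inner ℂ φ ψ := by
  have he : EqOn (fun r : ℝ => inner ℂ (φ r) (ψ r)) (fun r : ℝ =>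
      r ^ 2 • (star (((r⁻¹ : ℝ) : ℂ) * φ r) * (((r⁻¹ : ℝ) : ℂ) * ψ r))) (Ioi 0) := by
    intro r hr
    have hr' : (r : ℂ) ≠ 0 := by exact_mod_cast (mem_Ioi.1 hr).ne'
    simp only [RCLike.inner_apply, Complex.star_def, map_mul, Complex.conj_ofReal,
      Complex.real_smul]
    push_cast
    field_simp
  refine ⟨IntegrableOn.congr_fun (L2.integrable_inner φ ψ) he measurableSet_Ioi, ?_⟩
  rw [L2.inner_def]
  exact (setIntegral_congr_fun measurableSet_Ioi he).symm

lemma integrable_sphere {k : Space → ℂ} (hk : Continuous k) :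
    Integrable (fun s : Sph => k s) sphMeasure := by
  have hc : Continuous fun s : Sph => k s := hk.comp continuous_subtype_val
  exact hc.integrable_of_hasCompactSupport (HasCompactSupport.of_compactSpace _)

lemma aestronglyMeasurable_tensor (p : MvPolynomial (Fin 3) ℂ) (φ : RadialL2) :
    AEStronglyMeasurable
      (fun x : Space => polyEval p (‖x‖⁻¹ • x) * (((‖x‖⁻¹ : ℝ) : ℂ) * φ ‖x‖)) := by
  have h1 : Measurable fun x : Space => polyEval p (‖x‖⁻¹ • x) :=
    (continuous_polyEval p).measurable.comp (measurable_norm.inv.smul measurable_id)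
  have h2 : Measurable fun x : Space => ((‖x‖⁻¹ : ℝ) : ℂ) :=
    Complex.measurable_ofReal.comp measurable_norm.inv
  have h3 := (Lp.aestronglyMeasurable φ).comp_quasiMeasurePreserving quasiMeasurePreserving_norm
  exact h1.aestronglyMeasurable.mul (h2.aestronglyMeasurable.mul h3)

lemma memLp_tensor (p : MvPolynomial (Fin 3) ℂ) (φ : RadialL2) :
    MemLp (fun x : Space => polyEval p (‖x‖⁻¹ • x) * (((‖x‖⁻¹ : ℝ) : ℂ) * φ ‖x‖)) 2 := by
  rw [memLp_two_iff_integrable_sq_norm (aestronglyMeasurable_tensor p φ)]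
  have hk : Continuous fun x : Space => star (polyEval p x) * polyEval p x :=
    (continuous_polyEval p).star.mul (continuous_polyEval p)
  have h := (integrable_polar (integrable_sphere hk) (integrable_radial_inner φ φ).1).norm
  refine h.congr (.of_forall fun x => ?_)
  simp only [norm_mul, norm_star]
  ring

/-- The isometry up to a constant `φ ↦ r⁻¹ φ(r) p(ω)` from `L²(ℝ₊)` to `L²(ℝ³)`. -/
def tensorₗ (p : MvPolynomial (Fin 3) ℂ) : RadialL2 →ₗ[ℂ] SpaceL2 where
  toFun φ := (memLp_tensor p φ).toLp
  map_add' φ ψ := by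
    rw [← MemLp.toLp_add]
    refine MemLp.toLp_congr _ _ ?_
    have h := quasiMeasurePreserving_norm.ae (Lp.coeFn_add φ ψ)
    filter_upwards [h] with x hx
    simp only [Pi.add_apply, hx]
    ring
  map_smul' c φ := by
    rw [RingHom.id_apply, ← MemLp.toLp_const_smul]
    refine MemLp.toLp_congr _ _ ?_
    have h := quasiMeasurePreserving_norm.ae (Lp.coeFn_smul c φ)
    filter_upwards [h] with x hx
    simp only [Pi.smul_apply, hx, smul_eq_mul]
    ring

lemma tensorₗ_ae (p : MvPolynomial (Fin 3) ℂ) (φ : RadialL2) :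
    ∀ᵐ x : Space, tensorₗ p φ x = polyEval p (‖x‖⁻¹ • x) * (((‖x‖⁻¹ : ℝ) : ℂ) * φ ‖x‖) :=
  (memLp_tensor p φ).coeFn_toLp

lemma inner_tensorₗ (p q : MvPolynomial (Fin 3) ℂ) (φ ψ : RadialL2) :
    inner ℂ (tensorₗ p φ) (tensorₗ q ψ) = sphInner p q * inner ℂ φ ψ := by
  rw [L2.inner_def, ← (integrable_radial_inner φ ψ).2, sphInner,
    ← integral_polar (fun x => star (polyEval p x) * polyEval q x)
      (fun r => star (((r⁻¹ : ℝ) : ℂ) * φ r) * (((r⁻¹ : ℝ) : ℂ) * ψ r))]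
  refine integral_congr_ae ?_
  filter_upwards [tensorₗ_ae p φ, tensorₗ_ae q ψ] with x h1 h2
  rw [h1, h2, RCLike.inner_apply]
  simp only [Complex.star_def, map_mul]
  ring

/-- The bounded operator `φ ↦ r⁻¹ φ(r) p(ω)` from `L²(ℝ₊)` to `L²(ℝ³)`. -/
def tensor (p : MvPolynomial (Fin 3) ℂ) : RadialL2 →L[ℂ] SpaceL2 :=
  (tensorₗ p).mkContinuous √‖sphInner p p‖ fun φ => by
    have h : ‖tensorₗ p φ‖ ^ 2 = ‖sphInner p p‖ * ‖φ‖ ^ 2 := by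
      have h1 := inner_self_eq_norm_sq_to_K (𝕜 := ℂ) (tensorₗ p φ)
      have h2 := inner_self_eq_norm_sq_to_K (𝕜 := ℂ) φ
      rw [inner_tensorₗ, h2] at h1
      have h3 := congrArg norm h1
      rw [norm_mul, norm_pow, norm_pow, RCLike.norm_ofReal, RCLike.norm_ofReal, abs_norm,
        abs_norm] at h3
      exact h3.symm
    refine le_of_sq_le_sq ?_ (by positivity)
    rw [h, mul_pow, Real.sq_sqrt (norm_nonneg _)]

lemma inner_tensor (p q : MvPolynomial (Fin 3) ℂ) (φ ψ : RadialL2) :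
    inner ℂ (tensor p φ) (tensor q ψ) = sphInner p q * inner ℂ φ ψ :=
  inner_tensorₗ p q φ ψ

lemma tensor_ae (p : MvPolynomial (Fin 3) ℂ) (φ : RadialL2) :
    ∀ᵐ x : Space, tensor p φ x = polyEval p (‖x‖⁻¹ • x) * (((‖x‖⁻¹ : ℝ) : ℂ) * φ ‖x‖) :=
  tensorₗ_ae p φ

lemma isTensor_iff_eq (φ : RadialL2) (p : MvPolynomial (Fin 3) ℂ) (Ψ : SpaceL2) :
    IsTensor φ p Ψ ↔ Ψ = tensor p φ := by
  rw [isTensor_iff]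
  constructor
  · intro h
    refine Lp.ext ?_
    filter_upwards [h, tensor_ae p φ] with x h1 h2
    rw [h1, h2]
  · rintro rfl
    exact tensor_ae p φ

/-! ### Orthogonality of spherical harmonics of different degrees -/

open MvPolynomial in
lemma hasLineDerivAt_polyEval (p : MvPolynomial (Fin 3) ℂ) (i : Fin 3) (x : Space) :
    HasLineDerivAt ℝ (polyEval p) (polyEval (pderiv i p) x) x (EuclideanSpace.single i 1) := by
  induction p using MvPolynomial.induction_on with
  | C a => simpa [HasLineDerivAt, polyEval] using hasDerivAt_const (0 : ℝ) a
  | add p q hp hq =>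
    refine (HasDerivAt.add hp hq).congr_deriv ?_ |>.congr_of_eventuallyEq (.of_forall fun t => ?_)
    · simp [polyEval]
    · simp [polyEval]
  | mul_X p j hp =>
    have hX : HasDerivAt
        (fun t : ℝ => ((((x + t • EuclideanSpace.single i (1 : ℝ)) : Space) j : ℝ) : ℂ))
        ((EuclideanSpace.single i (1 : ℝ) : Space) j : ℝ) 0 := by
      have h : HasDerivAt (fun t : ℝ => x j + t * (EuclideanSpace.single i (1 : ℝ) : Space) j)
          ((EuclideanSpace.single i (1 : ℝ) : Space) j) 0 := by
        simpa using (((hasDerivAt_id (0 : ℝ)).mul_const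
          ((EuclideanSpace.single i (1 : ℝ) : Space) j)).const_add (x j))
      simpa using h.ofReal_comp
    have h := HasDerivAt.mul hp hX
    have e : polyEval (pderiv i (p * X j)) x = polyEval (pderiv i p) x * (x j : ℝ) +
        polyEval p x * ((EuclideanSpace.single i (1 : ℝ) : Space) j : ℝ) := by
      rw [Derivation.leibniz, pderiv_X]
      by_cases hij : j = i
      · subst hij
        simp [polyEval]
        ring
      · simp [polyEval, hij]
        ring
    rw [e]
    refine (h.congr_deriv ?_).congr_of_eventuallyEq (.of_forall fun t => ?_)
    · simp
    · simp [polyEval]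

/-- The Gaussian weight. -/
def gaussian (x : Space) : ℂ := ((Real.exp (-‖x‖ ^ 2) : ℝ) : ℂ)

lemma continuous_gaussian : Continuous gaussian := by
  unfold gaussian
  fun_prop

lemma hasLineDerivAt_gaussian (i : Fin 3) (x : Space) :
    HasLineDerivAt ℝ gaussian (-2 * (x i : ℝ) * gaussian x) x (EuclideanSpace.single i 1) := by
  have h1 := ((hasStrictFDerivAt_norm_sq x).hasFDerivAt.hasLineDerivAt
    (EuclideanSpace.single i (1 : ℝ)))
  have h2 := ((HasDerivAt.neg h1).exp).ofReal_comp
  refine h2.congr_deriv ?_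
  simp [gaussian, EuclideanSpace.inner_single_right]
  ring

/-- A polynomial is dominated by `exp (ε |x|²)`. -/
lemma exists_norm_polyEval_le (p : MvPolynomial (Fin 3) ℂ) :
    ∀ ε : ℝ, 0 < ε → ∃ c : ℝ, ∀ x, ‖polyEval p x‖ ≤ c * Real.exp (ε * ‖x‖ ^ 2) := by
  induction p using MvPolynomial.induction_on with
  | C a =>
    intro ε hε
    refine ⟨‖a‖, fun x => ?_⟩
    have : 1 ≤ Real.exp (ε * ‖x‖ ^ 2) := Real.one_le_exp (by positivity)
    simpa [polyEval] using le_mul_of_one_le_right (norm_nonneg a) this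
  | add p q hp hq =>
    intro ε hε
    obtain ⟨a, ha⟩ := hp ε hε
    obtain ⟨b, hb⟩ := hq ε hε
    refine ⟨a + b, fun x => ?_⟩
    have e : polyEval (p + q) x = polyEval p x + polyEval q x := by simp [polyEval]
    rw [e, add_mul]
    exact (norm_add_le _ _).trans (add_le_add (ha x) (hb x))
  | mul_X p j hp =>
    intro ε hε
    obtain ⟨a, ha⟩ := hp (ε / 2) (half_pos hε)
    refine ⟨a * (1 + 2 / ε), fun x => ?_⟩
    have e : polyEval (p * MvPolynomial.X j) x = polyEval p x * (x j : ℝ) := by simp [polyEval]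
    have h1 : |x j| ≤ ‖x‖ := by simpa using PiLp.norm_apply_le x j
    have h2 : |x j| ≤ (1 + 2 / ε) * Real.exp (ε / 2 * ‖x‖ ^ 2) := by
      have h3 := Real.add_one_le_exp (ε / 2 * ‖x‖ ^ 2)
      have h4 : 1 ≤ Real.exp (ε / 2 * ‖x‖ ^ 2) := Real.one_le_exp (by positivity)
      have h5 : ‖x‖ ^ 2 ≤ 2 / ε * Real.exp (ε / 2 * ‖x‖ ^ 2) := by
        rw [div_mul_eq_mul_div, le_div_iff₀ hε]
        linarith
      nlinarith [sq_nonneg (‖x‖ - 1)]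
    have h0 : 0 ≤ a * Real.exp (ε / 2 * ‖x‖ ^ 2) := (norm_nonneg _).trans (ha x)
    have e2 : Real.exp (ε * ‖x‖ ^ 2) =
        Real.exp (ε / 2 * ‖x‖ ^ 2) * Real.exp (ε / 2 * ‖x‖ ^ 2) := by
      rw [← Real.exp_add]
      ring_nf
    rw [e, norm_mul, Complex.norm_real, Real.norm_eq_abs, e2]
    calc _ ≤ (a * Real.exp (ε / 2 * ‖x‖ ^ 2)) * ((1 + 2 / ε) * Real.exp (ε / 2 * ‖x‖ ^ 2)) :=
          mul_le_mul (ha x) h2 (abs_nonneg _) h0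
      _ = _ := by ring

lemma integrable_exp_neg_half_norm_sq :
    Integrable fun x : Space => Real.exp (-(1 / 2) * ‖x‖ ^ 2) := by
  have h := (GaussianFourier.integrable_cexp_neg_mul_sq_norm_add (V := Space) (b := 1 / 2)
    (by norm_num) 0 0).norm
  refine h.congr (.of_forall fun x => ?_)
  simp only [Complex.norm_exp]
  congr 1
  have : (-(1 / 2 : ℂ) * (‖x‖ : ℂ) ^ 2 + 0 * ((inner ℝ (0 : Space) x : ℝ) : ℂ)) =
    ((-(1 / 2) * ‖x‖ ^ 2 : ℝ) : ℂ) := by push_cast; ring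
  rw [this, Complex.ofReal_re]

lemma integrable_polyEval_mul_gaussian (p : MvPolynomial (Fin 3) ℂ) :
    Integrable fun x => polyEval p x * gaussian x := by
  obtain ⟨c, hc⟩ := exists_norm_polyEval_le p (1 / 2) (by norm_num)
  refine (integrable_exp_neg_half_norm_sq.const_mul c).mono'
    ((continuous_polyEval p).mul continuous_gaussian).aestronglyMeasurable (.of_forall fun x => ?_)
  rw [norm_mul, gaussian, Complex.norm_real, Real.norm_eq_abs, Real.abs_exp]
  calc _ ≤ c * Real.exp (1 / 2 * ‖x‖ ^ 2) * Real.exp (-‖x‖ ^ 2) :=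
        mul_le_mul_of_nonneg_right (hc x) (Real.exp_pos _).le
    _ = _ := by
      rw [mul_assoc, ← Real.exp_add]
      ring_nf

/-- The Gaussian integral of a polynomial. -/
def gaussInt : MvPolynomial (Fin 3) ℂ →ₗ[ℂ] ℂ where
  toFun p := ∫ x, polyEval p x * gaussian x
  map_add' p q := by
    rw [← integral_add (integrable_polyEval_mul_gaussian p) (integrable_polyEval_mul_gaussian q)]
    simp [polyEval, add_mul]
  map_smul' c p := by
    rw [RingHom.id_apply, smul_eq_mul, ← integral_const_mul]
    simp [polyEval, mul_assoc]

lemma gaussInt_apply (p : MvPolynomial (Fin 3) ℂ) :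
    gaussInt p = ∫ x, polyEval p x * gaussian x := rfl

open MvPolynomial in
/-- Integration by parts against the Gaussian weight. -/
lemma gaussInt_pderiv (p : MvPolynomial (Fin 3) ℂ) (i : Fin 3) :
    gaussInt (pderiv i p) = 2 * gaussInt (X i * p) := by
  have e : ∀ x : Space, polyEval p x * (-2 * (x i : ℝ) * gaussian x) =
      -2 * (polyEval (X i * p) x * gaussian x) := by
    intro x
    simp [polyEval]
    ring
  have h := integral_bilinear_hasLineDerivAt_right_eq_neg_left_of_integrable
    (μ := (volume : Measure Space)) (B := ContinuousLinearMap.mul ℝ ℂ)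
    (f := polyEval p) (f' := polyEval (pderiv i p)) (g := gaussian)
    (g' := fun x => -2 * (x i : ℝ) * gaussian x) (v := EuclideanSpace.single i 1)
    (by simpa using integrable_polyEval_mul_gaussian (pderiv i p))
    (by
      simp only [ContinuousLinearMap.mul_apply', e]
      exact (integrable_polyEval_mul_gaussian _).const_mul _)
    (by simpa using integrable_polyEval_mul_gaussian p)
    (fun x _ => hasLineDerivAt_polyEval p i x) (fun x _ => hasLineDerivAt_gaussian i x)
  simp only [ContinuousLinearMap.mul_apply', e] at h
  rw [integral_const_mul] at h
  rw [gaussInt_apply, gaussInt_apply]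
  linear_combination h

open MvPolynomial in
/-- Integration by parts and Euler's identity evaluate the Gaussian integral of `∇q · ∇p` for
harmonic `p` of degree `l`. -/
lemma gaussInt_gradient {l : ℕ} {p : MvPolynomial (Fin 3) ℂ} (hp : IsSolidHarmonic l p)
    (q : MvPolynomial (Fin 3) ℂ) :
    ∑ i, gaussInt (pderiv i q * pderiv i p) = 2 * l * gaussInt (q * p) := by
  have h1 : ∀ i, gaussInt (pderiv i q * pderiv i p) =
      2 * gaussInt (q * (X i * pderiv i p)) - gaussInt (q * pderiv i (pderiv i p)) := by
    intro i
    have h := gaussInt_pderiv (q * pderiv i p) i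
    rw [Derivation.leibniz, smul_eq_mul, smul_eq_mul, map_add] at h
    rw [mul_comm (pderiv i q), show q * (X i * pderiv i p) = X i * (q * pderiv i p) by ring, ← h]
    ring
  rw [Finset.sum_congr rfl fun i _ => h1 i, Finset.sum_sub_distrib, ← Finset.mul_sum, ← map_sum,
    ← map_sum, ← Finset.mul_sum, ← Finset.mul_sum, hp.1.sum_X_mul_pderiv, hp.2]
  rw [mul_smul_comm, map_nsmul, mul_zero, map_zero, nsmul_eq_mul]
  ring

/-- The integral of `∇q · ∇p` equals both `2 l ∫ p q` and `2 l' ∫ p q`. -/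
lemma gaussInt_mul_eq_zero {l l' : ℕ} {p q : MvPolynomial (Fin 3) ℂ} (hp : IsSolidHarmonic l p)
    (hq : IsSolidHarmonic l' q) (hll : l ≠ l') : gaussInt (p * q) = 0 := by
  have h1 := gaussInt_gradient hp q
  have h2 := gaussInt_gradient hq p
  rw [Finset.sum_congr rfl fun i _ => by rw [mul_comm], mul_comm q p, h2] at h1
  have h3 : (l : ℂ) - l' ≠ 0 := by
    rw [sub_ne_zero]
    exact_mod_cast hll
  have h4 : ((l : ℂ) - l') * gaussInt (p * q) = 0 := by linear_combination -h1 / 2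
  exact (mul_eq_zero.1 h4).resolve_left h3

lemma polyEval_smul {n : ℕ} {p : MvPolynomial (Fin 3) ℂ} (hp : p.IsHomogeneous n) (c : ℝ)
    (x : Space) : polyEval p (c • x) = (c : ℂ) ^ n * polyEval p x := by
  rw [polyEval, polyEval, MvPolynomial.eval_eq, MvPolynomial.eval_eq, Finset.mul_sum]
  refine Finset.sum_congr rfl fun d hd => ?_
  have h : ∑ i, d i = n := by
    rw [← hp (MvPolynomial.mem_support_iff.1 hd), Finsupp.weight_apply]
    simp [Finsupp.sum_fintype]
  have h2 : ∀ i, (((c • x : Space) i : ℝ) : ℂ) = c * (x i : ℂ) := by simp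
  rw [Finset.prod_subset (Finset.subset_univ _) (by
    intro i _ hi
    simp [Finsupp.notMem_support_iff.1 hi]), Finset.prod_subset (Finset.subset_univ d.support) (by
    intro i _ hi
    simp [Finsupp.notMem_support_iff.1 hi])]
  simp only [h2, mul_pow, Finset.prod_mul_distrib, Finset.prod_pow_eq_pow_sum, h]
  ring

lemma polyEval_eq_norm_pow_mul {n : ℕ} {p : MvPolynomial (Fin 3) ℂ} (hp : p.IsHomogeneous n)
    (x : Space) : polyEval p x = polyEval p (‖x‖⁻¹ • x) * (‖x‖ : ℂ) ^ n := by
  rw [mul_comm, ← polyEval_smul hp, smul_smul]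
  rcases eq_or_ne x 0 with rfl | hx
  · simp
  · rw [mul_inv_cancel₀ (norm_ne_zero_iff.2 hx), one_smul]

/-- The Gaussian integral of a homogeneous polynomial is a positive multiple of its integral over
the unit sphere. -/
lemma integral_sphere_eq_zero {n : ℕ} {p : MvPolynomial (Fin 3) ℂ} (hp : p.IsHomogeneous n)
    (h : gaussInt p = 0) : ∫ s : Sph, polyEval p s ∂sphMeasure = 0 := by
  have h1 := integral_polar (polyEval p) fun r => ((r ^ n * Real.exp (-r ^ 2) : ℝ) : ℂ)
  have h2 : ∫ r in Ioi (0 : ℝ), r ^ 2 • ((r ^ n * Real.exp (-r ^ 2) : ℝ) : ℂ) ≠ 0 := by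
    have e : ∀ r ∈ Ioi (0 : ℝ), r ^ 2 • ((r ^ n * Real.exp (-r ^ 2) : ℝ) : ℂ) =
        ((r ^ ((n : ℝ) + 2) * Real.exp (-r ^ (2 : ℝ)) : ℝ) : ℂ) := by
      intro r hr
      rw [Real.rpow_add hr, Real.rpow_natCast, Real.rpow_ofNat]
      simp only [Complex.real_smul]
      push_cast
      ring
    rw [setIntegral_congr_fun measurableSet_Ioi e, integral_complex_ofReal,
      integral_rpow_mul_exp_neg_rpow two_pos
        (by linarith [n.cast_nonneg (α := ℝ)] : (-1 : ℝ) < (n : ℝ) + 2)]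
    have := Real.Gamma_pos_of_pos (s := ((n : ℝ) + 2 + 1) / 2) (by positivity)
    exact_mod_cast (by positivity : (0 : ℝ) < 1 / 2 * Real.Gamma (((n : ℝ) + 2 + 1) / 2)).ne'
  rw [gaussInt_apply] at h
  rw [integral_congr_ae (g := fun x : Space => polyEval p x * gaussian x)
    (.of_forall fun x => ?_), h] at h1
  · exact (mul_eq_zero.1 h1.symm).resolve_right h2
  · simp only [gaussian]
    rw [polyEval_eq_norm_pow_mul hp x]
    push_cast
    ring

lemma polyEval_conj (p : MvPolynomial (Fin 3) ℂ) (x : Space) :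
    polyEval (MvPolynomial.map (starRingEnd ℂ) p) x = star (polyEval p x) := by
  rw [polyEval, polyEval, MvPolynomial.eval_map, Complex.star_def, MvPolynomial.eval₂_eq,
    MvPolynomial.eval_eq]
  simp

lemma IsSolidHarmonic.conj {l : ℕ} {p : MvPolynomial (Fin 3) ℂ} (hp : IsSolidHarmonic l p) :
    IsSolidHarmonic l (MvPolynomial.map (starRingEnd ℂ) p) := by
  refine ⟨hp.1.map _, ?_⟩
  simp only [MvPolynomial.pderiv_map]
  rw [← map_sum, hp.2, map_zero]

/-- Spherical harmonics of different degrees are orthogonal in `L²(S²)`. -/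
lemma sphInner_eq_zero {l l' : ℕ} {p q : MvPolynomial (Fin 3) ℂ} (hp : IsSolidHarmonic l p)
    (hq : IsSolidHarmonic l' q) (hll : l ≠ l') : sphInner p q = 0 := by
  have h := integral_sphere_eq_zero (hp.conj.1.mul hq.1) (gaussInt_mul_eq_zero hp.conj hq hll)
  simp only [polyEval_mul, polyEval_conj] at h
  exact h

/-! ### Decomposition of polynomials into harmonic ones -/

open MvPolynomial in
/-- The Laplacian on polynomials. -/
def lap : MvPolynomial (Fin 3) ℂ →ₗ[ℂ] MvPolynomial (Fin 3) ℂ :=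
  ∑ i, (pderiv i).toLinearMap ∘ₗ (pderiv i).toLinearMap

open MvPolynomial in
lemma lap_apply (p : MvPolynomial (Fin 3) ℂ) : lap p = ∑ i, pderiv i (pderiv i p) := by
  simp [lap]

open MvPolynomial in
/-- The polynomial `|x|²`. -/
def normSqPoly : MvPolynomial (Fin 3) ℂ := ∑ i, X i ^ 2

open MvPolynomial in
lemma isHomogeneous_normSqPoly : normSqPoly.IsHomogeneous 2 :=
  IsHomogeneous.sum _ _ _ fun i _ => isHomogeneous_X_pow i 2

lemma polyEval_normSqPoly (x : Space) : polyEval normSqPoly x = (‖x‖ : ℂ) ^ 2 := by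
  have h := EuclideanSpace.norm_sq_eq x
  simp only [polyEval, normSqPoly, map_sum, map_pow, MvPolynomial.eval_X]
  rw [← Complex.ofReal_pow, h]
  simp

open MvPolynomial in
/-- `Δ(|x|² p) = |x|² Δp + 4 x · ∇p + 6 p`, with Euler's identity for the middle term. -/
lemma lap_normSqPoly_mul {n : ℕ} {p : MvPolynomial (Fin 3) ℂ} (hp : p.IsHomogeneous n) :
    lap (normSqPoly * p) = normSqPoly * lap p + ((4 * n + 6 : ℕ) : ℂ) • p := by
  have h := hp.sum_X_mul_pderiv
  have h1 : ∀ i : Fin 3, pderiv i normSqPoly = 2 * X i := by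
    intro i
    rw [normSqPoly, map_sum, Finset.sum_eq_single i]
    · rw [Derivation.leibniz_pow, pderiv_X_self]; simp
    · intro j _ hj
      rw [Derivation.leibniz_pow, pderiv_X_of_ne hj]; simp
    · simp
  have h2 : ∀ i : Fin 3, pderiv i (pderiv i (normSqPoly * p)) =
      normSqPoly * pderiv i (pderiv i p) + 4 * (X i * pderiv i p) + 2 * p := by
    intro i
    have h3 : pderiv i (2 * X i : MvPolynomial (Fin 3) ℂ) = 2 := by
      rw [two_mul, map_add, pderiv_X_self]; norm_num
    rw [Derivation.leibniz, map_add, smul_eq_mul, smul_eq_mul, h1, Derivation.leibniz,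
      Derivation.leibniz, h1, smul_eq_mul, smul_eq_mul, smul_eq_mul, smul_eq_mul, h3]
    ring
  rw [lap_apply, lap_apply, Finset.sum_congr rfl fun i _ => h2 i, Finset.sum_add_distrib,
    Finset.sum_add_distrib, ← Finset.mul_sum, ← Finset.mul_sum, h, Finset.sum_const,
    Finset.card_univ, Fintype.card_fin, Nat.cast_smul_eq_nsmul]
  simp only [nsmul_eq_mul]
  push_cast
  ring

lemma isHomogeneous_normSqPoly_pow_mul {j : ℕ} {h : MvPolynomial (Fin 3) ℂ}
    (hh : h.IsHomogeneous j) (k : ℕ) : (normSqPoly ^ k * h).IsHomogeneous (2 * k + j) :=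
  (isHomogeneous_normSqPoly.pow k).mul hh

lemma lap_normSqPoly_pow_mul {j : ℕ} {h : MvPolynomial (Fin 3) ℂ} (hh : IsSolidHarmonic j h)
    (k : ℕ) : ∃ c : ℕ, 0 < c ∧
      lap (normSqPoly ^ (k + 1) * h) = (c : ℂ) • (normSqPoly ^ k * h) := by
  induction k with
  | zero =>
    refine ⟨4 * j + 6, by omega, ?_⟩
    rw [zero_add, pow_one, lap_normSqPoly_mul hh.1, lap_apply, hh.2]
    simp
  | succ k ih =>
    obtain ⟨c, hc, h1⟩ := ih
    refine ⟨c + (4 * (2 * (k + 1) + j) + 6), by omega, ?_⟩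
    rw [pow_succ' _ (k + 1), mul_assoc,
      lap_normSqPoly_mul (isHomogeneous_normSqPoly_pow_mul hh.1 _),
      h1, mul_smul_comm, ← mul_assoc, ← pow_succ', ← add_smul]
    push_cast
    rfl

/-- The span of the polynomials `|x|^(2k) h` of degree `n` with `h` harmonic and homogeneous. -/
def harmonicSpan (n : ℕ) : Submodule ℂ (MvPolynomial (Fin 3) ℂ) :=
  Submodule.span ℂ {p | ∃ (k j : ℕ) (h : MvPolynomial (Fin 3) ℂ),
    2 * k + j = n ∧ IsSolidHarmonic j h ∧ p = normSqPoly ^ k * h}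

lemma isHomogeneous_of_mem_harmonicSpan {n : ℕ} {p : MvPolynomial (Fin 3) ℂ}
    (hp : p ∈ harmonicSpan n) : p.IsHomogeneous n := by
  have h : harmonicSpan n ≤ MvPolynomial.homogeneousSubmodule (Fin 3) ℂ n := by
    refine Submodule.span_le.2 ?_
    rintro _ ⟨k, j, h, rfl, hh, rfl⟩
    exact isHomogeneous_normSqPoly_pow_mul hh.1 k
  exact h hp

lemma mem_harmonicSpan_of_isSolidHarmonic {n : ℕ} {p : MvPolynomial (Fin 3) ℂ}
    (hp : IsSolidHarmonic n p) : p ∈ harmonicSpan n :=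
  Submodule.subset_span ⟨0, n, p, by simp, hp, by simp⟩

/-- The Laplacian maps the span in degree `n + 2` onto the span in degree `n`. -/
lemma exists_lap_eq {n : ℕ} {p : MvPolynomial (Fin 3) ℂ} (hp : p ∈ harmonicSpan n) :
    ∃ q ∈ harmonicSpan (n + 2), lap q = p := by
  have h : harmonicSpan n ≤ (harmonicSpan (n + 2)).map lap := by
    refine Submodule.span_le.2 ?_
    rintro _ ⟨k, j, h, rfl, hh, rfl⟩
    obtain ⟨c, hc, h1⟩ := lap_normSqPoly_pow_mul hh k
    have hc' : (c : ℂ) ≠ 0 := by exact_mod_cast hc.ne'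
    refine ⟨(c : ℂ)⁻¹ • (normSqPoly ^ (k + 1) * h), Submodule.smul_mem _ _
      (Submodule.subset_span ⟨k + 1, j, h, by ring, hh, rfl⟩), ?_⟩
    rw [map_smul, h1, smul_smul, inv_mul_cancel₀ hc', one_smul]
  exact h hp

open MvPolynomial in
lemma pderiv_eq_zero_of_isHomogeneous_zero {p : MvPolynomial (Fin 3) ℂ} (hp : p.IsHomogeneous 0)
    (i : Fin 3) : pderiv i p = 0 := by
  rw [← totalDegree_zero_iff_isHomogeneous, totalDegree_eq_zero_iff_eq_C] at hp
  rw [hp, pderiv_C]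

/-- Every homogeneous polynomial is a sum of terms `|x|^(2k) h` with `h` harmonic. -/
lemma mem_harmonicSpan (n : ℕ) : ∀ p : MvPolynomial (Fin 3) ℂ, p.IsHomogeneous n →
    p ∈ harmonicSpan n := by
  induction n using Nat.twoStepInduction with
  | zero =>
    intro p hp
    refine mem_harmonicSpan_of_isSolidHarmonic ⟨hp, Finset.sum_eq_zero fun i _ => ?_⟩
    rw [pderiv_eq_zero_of_isHomogeneous_zero hp, map_zero]
  | one =>
    intro p hp
    refine mem_harmonicSpan_of_isSolidHarmonic ⟨hp, Finset.sum_eq_zero fun i _ => ?_⟩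
    exact pderiv_eq_zero_of_isHomogeneous_zero hp.pderiv i
  | more n ih _ =>
    intro p hp
    have h1 : (lap p).IsHomogeneous n := by
      rw [lap_apply]
      exact MvPolynomial.IsHomogeneous.sum _ _ _ fun i _ => hp.pderiv.pderiv
    -- By induction `Δp = Δq` with `q` in the span, so that `p - q` is harmonic.
    obtain ⟨q, hq, hqp⟩ := exists_lap_eq (ih _ h1)
    have h2 : IsSolidHarmonic (n + 2) (p - q) := by
      refine ⟨hp.sub (isHomogeneous_of_mem_harmonicSpan hq), ?_⟩
      rw [← lap_apply, map_sub, hqp, sub_self]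
    simpa using add_mem (mem_harmonicSpan_of_isSolidHarmonic h2) hq

/-! ### Completeness of the spherical harmonics -/

/-- A continuous function is uniformly close to a polynomial on a ball. -/
lemma exists_polyEval_near (g : C(Space, ℝ)) (R : ℝ) {ε : ℝ} (hε : 0 < ε) :
    ∃ p : MvPolynomial (Fin 3) ℂ, ∀ x ∈ Metric.closedBall (0 : Space) R,
      ‖polyEval p x - g x‖ < ε := by
  set coord : Fin 3 → C(Space, ℝ) := fun i => ⟨fun x => x i, by fun_prop⟩
  have hsep : (MvPolynomial.aeval (R := ℝ) coord).range.SeparatesPoints := by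
    intro x y hxy
    obtain ⟨i, hi⟩ : ∃ i, x i ≠ y i := by
      by_contra! h
      exact hxy (by ext i; exact h i)
    exact ⟨coord i, ⟨coord i, ⟨MvPolynomial.X i, by simp⟩, rfl⟩, hi⟩
  obtain ⟨f, ⟨p, rfl⟩, hp⟩ :=
    ContinuousMap.exists_mem_subalgebra_near_continuous_of_isCompact_of_separatesPoints hsep g
      (isCompact_closedBall (0 : Space) R) hε
  have he : ∀ (p : MvPolynomial (Fin 3) ℝ) (x : Space),
      polyEval (MvPolynomial.map Complex.ofRealHom p) x =
        ((MvPolynomial.aeval coord p x : ℝ) : ℂ) := by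
    intro p x
    induction p using MvPolynomial.induction_on with
    | C a => simp [polyEval]
    | add p q hp hq =>
      rw [map_add, map_add, ContinuousMap.add_apply, Complex.ofReal_add, ← hp, ← hq]
      simp [polyEval]
    | mul_X p i hp =>
      rw [map_mul, map_mul, ContinuousMap.mul_apply, Complex.ofReal_mul, ← hp, polyEval_mul]
      simp [polyEval, coord]
  refine ⟨MvPolynomial.map Complex.ofRealHom p, fun x hx => ?_⟩
  rw [he, ← Complex.ofReal_sub, Complex.norm_real]
  exact hp x hx

/-- The radial function `r^(m+1)`, cut off at `R`, as an element of `L²(ℝ₊)`. -/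
lemma exists_radial_power (m : ℕ) (R : ℝ) : ∃ η : RadialL2,
    ∀ᵐ r ∂(volume.restrict (Ioi (0 : ℝ))),
      η r = (Iic R).indicator (fun r : ℝ => (r : ℂ) ^ (m + 1)) r := by
  have hK : MemLp ((Ioc 0 R).indicator fun _ : ℝ => |R| ^ (m + 1)) 2
      (volume.restrict (Ioi (0 : ℝ))) := by
    refine memLp_indicator_const _ measurableSet_Ioc _ (Or.inr ?_)
    refine ((Measure.restrict_apply_le _ _).trans_lt ?_).ne
    simp
  have hm : MemLp ((Iic R).indicator fun r : ℝ => (r : ℂ) ^ (m + 1)) 2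
      (volume.restrict (Ioi (0 : ℝ))) := by
    refine hK.mono ?_ ?_
    · exact ((by fun_prop : Continuous fun r : ℝ => (r : ℂ) ^ (m + 1)).measurable.indicator
        measurableSet_Iic).aestronglyMeasurable
    · filter_upwards [ae_restrict_mem measurableSet_Ioi] with r hr
      by_cases h : r ≤ R
      · rw [indicator_of_mem (show r ∈ Iic R from h),
          indicator_of_mem (show r ∈ Ioc 0 R from ⟨hr, h⟩), norm_pow, norm_pow,
          Complex.norm_real, norm_abs_eq_norm]
        gcongr
        rw [Real.norm_eq_abs, Real.norm_eq_abs]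
        exact abs_le_abs_of_nonneg (le_of_lt hr) h
      · rw [indicator_of_notMem (show r ∉ Iic R from h), norm_zero]
        exact norm_nonneg _
  exact ⟨hm.toLp, hm.coeFn_toLp⟩

lemma integrableOn_polyEval_mul (Φ : SpaceL2) (p : MvPolynomial (Fin 3) ℂ) (R : ℝ) :
    IntegrableOn (fun x => polyEval p x * star (Φ x)) (Metric.closedBall (0 : Space) R) := by
  have h : IntegrableOn (fun x => star (Φ x)) (Metric.closedBall (0 : Space) R) := by
    have hfin : IsFiniteMeasure ((volume : Measure Space).restrict (Metric.closedBall 0 R)) :=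
      ⟨by
        rw [Measure.restrict_apply_univ]
        exact measure_closedBall_lt_top⟩
    exact ((Lp.memLp Φ).star.restrict _).integrable one_le_two
  exact h.continuousOn_mul (continuous_polyEval p).continuousOn (isCompact_closedBall _ _)

/-- A function orthogonal to all `r⁻¹ φ(r) Y(ω)`, `Y` a spherical harmonic, is orthogonal to the
polynomials on each ball. -/
lemma integral_polyEval_mul_eq_zero {Φ : SpaceL2}
    (h : ∀ l p, IsSolidHarmonic l p → ∀ η : RadialL2, inner ℂ Φ (tensor p η) = (0 : ℂ)) (R : ℝ)
    (p : MvPolynomial (Fin 3) ℂ) :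
    ∫ x in Metric.closedBall (0 : Space) R, polyEval p x * star (Φ x) = 0 := by
  let L : MvPolynomial (Fin 3) ℂ →ₗ[ℂ] ℂ :=
    { toFun := fun p => ∫ x in Metric.closedBall (0 : Space) R, polyEval p x * star (Φ x)
      map_add' := fun p q => by
        rw [← integral_add (integrableOn_polyEval_mul Φ p R) (integrableOn_polyEval_mul Φ q R)]
        simp [polyEval, add_mul]
      map_smul' := fun c p => by
        rw [RingHom.id_apply, smul_eq_mul, ← integral_const_mul]
        simp [polyEval, mul_assoc] }
  have hL : ∀ n, harmonicSpan n ≤ LinearMap.ker L := by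
    refine fun n => Submodule.span_le.2 ?_
    rintro _ ⟨k, j, q, rfl, hq, rfl⟩
    obtain ⟨η, hη⟩ := exists_radial_power (2 * k + j) R
    rw [SetLike.mem_coe, LinearMap.mem_ker, ← h j q hq η, L2.inner_def]
    change ∫ x in Metric.closedBall (0 : Space) R, _ = _
    rw [← integral_indicator measurableSet_closedBall]
    refine integral_congr_ae ?_
    have h0 : ∀ᵐ x : Space, x ≠ 0 := Measure.ae_ne volume 0
    filter_upwards [tensor_ae q η, quasiMeasurePreserving_norm.ae hη, h0] with x h1 h2 h3
    rw [h1, h2, RCLike.inner_apply]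
    have hx : (‖x‖ : ℂ) ≠ 0 := by exact_mod_cast norm_ne_zero_iff.2 h3
    by_cases hR : ‖x‖ ≤ R
    · rw [indicator_of_mem (by simpa using hR), indicator_of_mem (show ‖x‖ ∈ Iic R from hR),
        polyEval_eq_norm_pow_mul (isHomogeneous_normSqPoly_pow_mul hq.1 k), polyEval_mul]
      have h4 : polyEval (normSqPoly ^ k) (‖x‖⁻¹ • x) = 1 := by
        have e : polyEval (normSqPoly ^ k) (‖x‖⁻¹ • x) = polyEval normSqPoly (‖x‖⁻¹ • x) ^ k := by
          simp [polyEval]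
        rw [e, polyEval_normSqPoly, norm_smul, norm_inv, norm_norm,
          inv_mul_cancel₀ (norm_ne_zero_iff.2 h3), Complex.ofReal_one, one_pow, one_pow]
      rw [h4, one_mul, pow_succ, Complex.ofReal_inv, Complex.star_def]
      field_simp
    · rw [indicator_of_notMem (by simpa using hR), indicator_of_notMem (show ‖x‖ ∉ Iic R from hR)]
      simp
  have h1 : L p = 0 := by
    rw [← MvPolynomial.sum_homogeneousComponent p, map_sum]
    exact Finset.sum_eq_zero fun n _ =>
      hL n (mem_harmonicSpan n _ (MvPolynomial.homogeneousComponent_isHomogeneous n p))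
  exact h1

/-- The functions `r⁻¹ φ(r) Y(ω)`, `Y` a spherical harmonic, span a dense subspace: a function
orthogonal to them is orthogonal to all test functions, which are uniform limits of polynomials on
a ball. -/
lemma eq_zero_of_inner_tensor {Φ : SpaceL2}
    (h : ∀ l p, IsSolidHarmonic l p → ∀ η : RadialL2, inner ℂ Φ (tensor p η) = (0 : ℂ)) :
    Φ = 0 := by
  have hloc : LocallyIntegrable (fun x => star (Φ x)) (volume : Measure Space) :=
    (Lp.memLp Φ).star.locallyIntegrable one_le_two
  have h0 := ae_eq_zero_of_integral_contDiff_smul_eq_zero hloc fun g hg hgc => by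
    obtain ⟨R, hR⟩ := hgc.isCompact.isBounded.subset_closedBall 0
    set B := Metric.closedBall (0 : Space) R
    set I := ∫ x in B, ‖star (Φ x)‖
    have hint : IntegrableOn (fun x => star (Φ x)) B := by
      simpa [polyEval] using integrableOn_polyEval_mul Φ 1 R
    have hI : 0 ≤ I := integral_nonneg fun x => norm_nonneg _
    have hgint : IntegrableOn (fun x => (g x : ℂ) * star (Φ x)) B :=
      hint.continuousOn_mul (Complex.continuous_ofReal.comp hg.continuous).continuousOn
        (isCompact_closedBall _ _)
    have hle : ∀ ε > 0, ‖∫ x, g x • star (Φ x)‖ ≤ ε * I := by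
      intro ε hε
      obtain ⟨p, hp⟩ := exists_polyEval_near ⟨g, hg.continuous⟩ R hε
      have e1 : ∫ x, g x • star (Φ x) = ∫ x in B, (g x : ℂ) * star (Φ x) := by
        refine (setIntegral_eq_integral_of_forall_compl_eq_zero fun x hx => ?_).symm
        rw [image_eq_zero_of_notMem_tsupport fun h => hx (hR h)]
        simp
      rw [e1, ← sub_zero (∫ x in B, (g x : ℂ) * star (Φ x)),
        ← integral_polyEval_mul_eq_zero h R p,
        ← integral_sub hgint (integrableOn_polyEval_mul Φ p R), ← integral_const_mul]
      refine norm_integral_le_of_norm_le (hint.norm.const_mul ε) ?_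
      filter_upwards [ae_restrict_mem measurableSet_closedBall] with x hx
      rw [← sub_mul, norm_mul, norm_sub_rev]
      exact mul_le_mul_of_nonneg_right (hp x hx).le (norm_nonneg _)
    rw [← norm_le_zero_iff]
    refine le_of_forall_pos_le_add fun ε hε => ?_
    refine (hle (ε / (I + 1)) (by positivity)).trans ?_
    rw [zero_add, div_mul_eq_mul_div, div_le_iff₀ (by positivity)]
    nlinarith
  refine Lp.eq_zero_iff_ae_eq_zero.2 ?_
  filter_upwards [h0] with x hx
  simpa using hx

/-! ### Self-adjointness of the infinite atoms -/

/-- The minimal operator is densely defined. -/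
lemma eq_zero_of_inner_minGraph (β C : ℝ) (l : ℕ) {h : RadialL2}
    (horth : ∀ q ∈ minGraph β C l, inner ℂ h q.1 = (0 : ℂ)) : h = 0 := by
  have hloc : LocallyIntegrableOn (fun r => star (h r)) (Ioi 0) volume :=
    locallyIntegrableOn_of_locallyIntegrable_restrict
      ((Lp.memLp h).star.locallyIntegrable one_le_two)
  have h0 := isOpen_Ioi.ae_eq_zero_of_integral_contDiff_smul_eq_zero hloc fun g h1 h2 h3 => by
    have h1' : ContDiff ℝ ∞ fun r => (g r : ℂ) := Complex.ofRealCLM.contDiff.comp h1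
    obtain ⟨q, hq, hq1, -⟩ := exists_testPair β C l (u := fun r => (g r : ℂ)) h1'
      (h2.comp_left Complex.ofReal_zero)
      ((tsupport_comp_subset Complex.ofReal_zero g).trans h3)
    rw [← horth q hq, L2.inner_def, ← setIntegral_eq_integral_of_forall_compl_eq_zero
      (s := Ioi 0) fun x hx => by
        rw [image_eq_zero_of_notMem_tsupport fun h => hx (h3 h), zero_smul]]
    refine integral_congr_ae ?_
    filter_upwards [hq1] with r hr
    rw [hr, RCLike.inner_apply]
    simp
  refine Lp.eq_zero_iff_ae_eq_zero.2 ?_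
  rw [EventuallyEq, ae_restrict_iff' measurableSet_Ioi]
  filter_upwards [h0] with x hx hx'
  simpa using hx hx'

/-- The generators `(φ ⊗ Y, ψ ⊗ Y)`, `(φ, ψ)` in the graph of a radial operator, of the graph of an
infinite atom. -/
def atomSet (β C : ℝ) (ξ : ℝ → ℝ) (θ : ℕ → ℝ) : Set (SpaceL2 × SpaceL2) :=
  {q | ∃ (l : ℕ) (p : MvPolynomial (Fin 3) ℂ) (φ ψ : RadialL2), IsSolidHarmonic l p ∧
    (φ, ψ) ∈ radialGraph β C ξ l (θ l) ∧ q = (tensor p φ, tensor p ψ)}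

lemma atomGraph_eq (β C : ℝ) (ξ : ℝ → ℝ) (θ : ℕ → ℝ) :
    atomGraph β C ξ θ = (Submodule.span ℂ (atomSet β C ξ θ)).topologicalClosure := by
  simp only [atomGraph, atomSet, isTensor_iff_eq, Prod.ext_iff]

section SelfAdjoint

variable {β C : ℝ} {ξ : ℝ → ℝ}

lemma tensor_mem_atomGraph (θ : ℕ → ℝ) {l : ℕ} {p : MvPolynomial (Fin 3) ℂ}
    (hp : IsSolidHarmonic l p) {q : RadialL2 × RadialL2} (hq : q ∈ radialGraph β C ξ l (θ l)) :
    (tensor p q.1, tensor p q.2) ∈ atomGraph β C ξ θ := by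
  rw [atomGraph_eq]
  exact Submodule.le_topologicalClosure _ (Submodule.subset_span ⟨l, p, q.1, q.2, hp, hq, rfl⟩)

lemma isSymmGraph_atomGraph (hβ : β < -2) (hC : 0 < C) (hξ : IsLocalizer ξ) (θ : ℕ → ℝ) :
    IsSymmGraph (atomGraph β C ξ θ) := by
  rw [atomGraph_eq]
  refine (isSymmGraph_span ?_).topologicalClosure
  rintro _ ⟨l, p, φ, ψ, hp, hq, rfl⟩ _ ⟨l', p', φ', ψ', hp', hq', rfl⟩
  rw [inner_tensor, inner_tensor]
  rcases eq_or_ne l l' with rfl | hl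
  · rw [isSymmGraph_radialGraph hβ hC hξ l (θ l) _ hq _ hq']
  · rw [sphInner_eq_zero hp hp' hl, zero_mul, zero_mul]

lemma isSelfAdjointGraph_atomGraph (hβ : β < -2) (hC : 0 < C) (hξ : IsLocalizer ξ) (θ : ℕ → ℝ) :
    IsSelfAdjointGraph (atomGraph β C ξ θ) where
  symm := isSymmGraph_atomGraph hβ hC hξ θ
  closed := Submodule.isClosed_topologicalClosure _
  dense_dom := by
    rw [Submodule.dense_iff_topologicalClosure_eq_top, Submodule.topologicalClosure_eq_top_iff,
      Submodule.eq_bot_iff]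
    intro Φ hΦ
    refine eq_zero_of_inner_tensor fun l p hp η => ?_
    have h : (tensor p).adjoint Φ = 0 := by
      refine eq_zero_of_inner_minGraph β C l fun q hq => ?_
      rw [ContinuousLinearMap.adjoint_inner_left]
      exact (Submodule.mem_orthogonal' _ _).1 hΦ _
        ⟨_, tensor_mem_atomGraph θ hp (Submodule.mem_sup_left hq), rfl⟩
    rw [← ContinuousLinearMap.adjoint_inner_left, h, inner_zero_left]
  dense_range := by
    intro s hs
    have hmap : (shiftMap SpaceL2 s '' (atomGraph β C ξ θ : Set (SpaceL2 × SpaceL2))) =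
        ((atomGraph β C ξ θ).map (shiftMap SpaceL2 s).toLinearMap : Set SpaceL2) := rfl
    rw [hmap, Submodule.dense_iff_topologicalClosure_eq_top,
      Submodule.topologicalClosure_eq_top_iff, Submodule.eq_bot_iff]
    intro Φ hΦ
    -- The component of `Φ` along `p` is orthogonal to the range of a shifted radial operator.
    refine eq_zero_of_inner_tensor fun l p hp η => ?_
    have hz : (-s).im ≠ 0 := by rcases hs with rfl | rfl <;> simp
    have h : (tensor p).adjoint Φ = 0 := by
      refine eq_zero_of_orthogonal hβ hC hξ l (θ l) hz fun q hq => ?_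
      rw [ContinuousLinearMap.adjoint_inner_left]
      refine Eq.trans ?_ ((Submodule.mem_orthogonal' _ _).1 hΦ _
        ⟨_, tensor_mem_atomGraph θ hp hq, rfl⟩)
      simp [shiftMap_apply]
    rw [← ContinuousLinearMap.adjoint_inner_left, h, inner_zero_left]

end SelfAdjoint

/-! ### Dependence of the operators on the boundary condition -/

lemma radialExpr_linear_combination (β C : ℝ) (l : ℕ) {u v : ℝ → ℂ} (hu : ContDiffOn ℝ 2 u (Ioi 0))
    (hv : ContDiffOn ℝ 2 v (Ioi 0)) (a b : ℂ) {r : ℝ} (hr : 0 < r) :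
    radialExpr β C l (fun r => a * u r + b * v r) r =
      a * radialExpr β C l u r + b * radialExpr β C l v r := by
  have h1 : deriv (fun r => a * u r + b * v r) =ᶠ[𝓝 r] fun r => a * deriv u r + b * deriv v r := by
    filter_upwards [lt_mem_nhds hr] with s hs
    exact (((hasDerivAt_of_contDiffOn_Ioi hu hs).1.const_mul a).add
      ((hasDerivAt_of_contDiffOn_Ioi hv hs).1.const_mul b)).deriv
  have h2 : HasDerivAt (fun r => a * deriv u r + b * deriv v r)
      (a * deriv (deriv u) r + b * deriv (deriv v) r) r :=
    ((hasDerivAt_of_contDiffOn_Ioi hu hr).2.const_mul a).add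
      ((hasDerivAt_of_contDiffOn_Ioi hv hr).2.const_mul b)
  rw [radialExpr_eq, radialExpr_eq, radialExpr_eq, h1.deriv_eq, h2.deriv]
  ring

section Continuity

variable {α β C : ℝ} {ξ : ℝ → ℝ}

/-- The added vectors of the radial graphs may be chosen as `cos θ A + sin θ B`. -/
lemma exists_boundary_family (hβ : β < -2) (hC : 0 < C) (hξ : IsLocalizer ξ) (l : ℕ) :
    ∃ A B : RadialL2 × RadialL2, ∀ θ : ℝ, radialGraph β C ξ l θ = minGraph β C l ⊔
      Submodule.span ℂ {((Real.cos θ : ℝ) : ℂ) • A + ((Real.sin θ : ℝ) : ℂ) • B} := by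
  obtain ⟨A, hA1, hA2⟩ := exists_boundaryPair hβ hC hξ l 0
  obtain ⟨B, hB1, hB2⟩ := exists_boundaryPair hβ hC hξ l (Real.pi / 2)
  refine ⟨A, B, fun θ => ?_⟩
  have hb : boundaryFun β C ξ l θ = fun r =>
      ((Real.cos θ : ℝ) : ℂ) * boundaryFun β C ξ l 0 r +
        ((Real.sin θ : ℝ) : ℂ) * boundaryFun β C ξ l (Real.pi / 2) r := by
    ext r
    simp only [boundaryFun, Real.cos_zero, Real.sin_zero, Real.cos_pi_div_two,
      Real.sin_pi_div_two]
    push_cast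
    ring
  set D := ((Real.cos θ : ℝ) : ℂ) • A + ((Real.sin θ : ℝ) : ℂ) • B
  have hD1 : ∀ᵐ r ∂(volume.restrict (Ioi (0 : ℝ))), D.1 r = boundaryFun β C ξ l θ r := by
    filter_upwards [hA1, hB1, Lp.coeFn_add (((Real.cos θ : ℝ) : ℂ) • A.1)
      (((Real.sin θ : ℝ) : ℂ) • B.1), Lp.coeFn_smul ((Real.cos θ : ℝ) : ℂ) A.1,
      Lp.coeFn_smul ((Real.sin θ : ℝ) : ℂ) B.1] with r h1 h2 h3 h4 h5
    rw [hb]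
    beta_reduce
    rw [← h1, ← h2]
    exact h3.trans (by rw [Pi.add_apply, h4, h5]; rfl)
  have hD2 : ∀ᵐ r ∂(volume.restrict (Ioi (0 : ℝ))),
      D.2 r = radialExpr β C l (boundaryFun β C ξ l θ) r := by
    filter_upwards [hA2, hB2, Lp.coeFn_add (((Real.cos θ : ℝ) : ℂ) • A.2)
      (((Real.sin θ : ℝ) : ℂ) • B.2), Lp.coeFn_smul ((Real.cos θ : ℝ) : ℂ) A.2,
      Lp.coeFn_smul ((Real.sin θ : ℝ) : ℂ) B.2, ae_restrict_mem measurableSet_Ioi]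
      with r h1 h2 h3 h4 h5 hr
    rw [hb, radialExpr_linear_combination β C l (contDiffOn_boundaryFun hβ hC hξ l _)
      (contDiffOn_boundaryFun hβ hC hξ l _) _ _ hr, ← h1, ← h2]
    exact h3.trans (by rw [Pi.add_apply, h4, h5]; rfl)
  have hset : {q : RadialL2 × RadialL2 |
      (∀ᵐ r ∂(volume.restrict (Ioi (0 : ℝ))), q.1 r = boundaryFun β C ξ l θ r) ∧
      (∀ᵐ r ∂(volume.restrict (Ioi (0 : ℝ))),
        q.2 r = radialExpr β C l (boundaryFun β C ξ l θ) r)} = {D} := by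
    ext q
    constructor
    · rintro ⟨h1, h2⟩
      refine Prod.ext (Lp.ext ?_) (Lp.ext ?_)
      · filter_upwards [h1, hD1] with r e1 e2 using e1.trans e2.symm
      · filter_upwards [h2, hD2] with r e1 e2 using e1.trans e2.symm
    · rintro rfl
      exact ⟨hD1, hD2⟩
  rw [radialGraph, hset]

/-- A boundary condition depends only on the line spanned by `(cos θ, sin θ)`, that is, on
`2θ` modulo `2π`, and the graphs depend continuously on it. -/
lemma exists_tendsto_radialGraph (hβ : β < -2) (hC : 0 < C) (hξ : IsLocalizer ξ) (l : ℕ)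
    {ι : Type*} {f : Filter ι} {θ : ι → ℝ} {θ₀ : ℝ}
    (h : Tendsto (fun i => Circle.exp (2 * θ i)) f (𝓝 (Circle.exp (2 * θ₀))))
    {q : RadialL2 × RadialL2} (hq : q ∈ radialGraph β C ξ l θ₀) :
    ∃ p : ι → RadialL2 × RadialL2, (∀ i, p i ∈ radialGraph β C ξ l (θ i)) ∧
      Tendsto p f (𝓝 q) := by
  obtain ⟨A, B, hAB⟩ := exists_boundary_family hβ hC hξ l
  rw [hAB, Submodule.mem_sup] at hq
  obtain ⟨m, hm, b, hb, rfl⟩ := hq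
  obtain ⟨c, rfl⟩ := Submodule.mem_span_singleton.1 hb
  have hexp : Tendsto (fun i => (Circle.exp (2 * θ i) : ℂ)) f (𝓝 (Circle.exp (2 * θ₀) : ℂ)) :=
    (continuous_subtype_val.tendsto _).comp h
  have hre : ∀ x : ℝ, (Circle.exp x : ℂ).re = Real.cos x := fun x => by
    rw [Circle.coe_exp, Complex.exp_ofReal_mul_I_re]
  have him : ∀ x : ℝ, (Circle.exp x : ℂ).im = Real.sin x := fun x => by
    rw [Circle.coe_exp, Complex.exp_ofReal_mul_I_im]
  have hcos : Tendsto (fun i => Real.cos (2 * θ i)) f (𝓝 (Real.cos (2 * θ₀))) := by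
    simpa only [Function.comp_def, hre] using (Complex.continuous_re.tendsto _).comp hexp
  have hsin : Tendsto (fun i => Real.sin (2 * θ i)) f (𝓝 (Real.sin (2 * θ₀))) := by
    simpa only [Function.comp_def, him] using (Complex.continuous_im.tendsto _).comp hexp
  -- The factor `cos (θ i - θ₀)` turns the vector at `θ i` into a function of `2 θ i`.
  have e1 : ∀ x, Real.cos (x - θ₀) * Real.cos x = (Real.cos (2 * x) * Real.cos θ₀ +
      Real.sin (2 * x) * Real.sin θ₀ + Real.cos θ₀) / 2 := fun x => by
    rw [Real.cos_sub, Real.cos_two_mul, Real.sin_two_mul]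
    ring
  have e2 : ∀ x, Real.cos (x - θ₀) * Real.sin x = (Real.sin (2 * x) * Real.cos θ₀ -
      Real.cos (2 * x) * Real.sin θ₀ + Real.sin θ₀) / 2 := fun x => by
    rw [Real.cos_sub, Real.cos_two_mul, Real.sin_two_mul]
    linear_combination Real.sin θ₀ * Real.sin_sq_add_cos_sq x
  have t1 : Tendsto (fun i => Real.cos (θ i - θ₀) * Real.cos (θ i)) f (𝓝 (Real.cos θ₀)) := by
    have h1 := (((hcos.mul_const (Real.cos θ₀)).add (hsin.mul_const (Real.sin θ₀))).add_const
      (Real.cos θ₀)).div_const 2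
    rw [← e1, sub_self, Real.cos_zero, one_mul] at h1
    simpa only [e1] using h1
  have t2 : Tendsto (fun i => Real.cos (θ i - θ₀) * Real.sin (θ i)) f (𝓝 (Real.sin θ₀)) := by
    have h1 := (((hsin.mul_const (Real.cos θ₀)).sub (hcos.mul_const (Real.sin θ₀))).add_const
      (Real.sin θ₀)).div_const 2
    rw [← e2, sub_self, Real.cos_zero, one_mul] at h1
    simpa only [e2] using h1
  refine ⟨fun i => m + c • ((Real.cos (θ i - θ₀) : ℝ) : ℂ) •
    (((Real.cos (θ i) : ℝ) : ℂ) • A + ((Real.sin (θ i) : ℝ) : ℂ) • B), fun i => ?_, ?_⟩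
  · rw [hAB]
    exact Submodule.add_mem_sup hm (Submodule.smul_mem _ _ (Submodule.smul_mem _ _
      (Submodule.mem_span_singleton_self _)))
  · simp only [smul_add, smul_smul, ← mul_assoc]
    refine tendsto_const_nhds.add ?_
    simp only [mul_assoc, ← Complex.ofReal_mul]
    exact (((Complex.continuous_ofReal.tendsto _).comp t1).const_mul c |>.smul_const A).add
      (((Complex.continuous_ofReal.tendsto _).comp t2).const_mul c |>.smul_const B)

/-- The boundary condition at each `ℓ` is a fixed rotation of `exp (2π i τ)`. -/
lemma exp_two_mul_angle (α β τ : ℝ) (l : ℕ) :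
    Circle.exp (2 * angle α β τ l) = Circle.exp (2 * Real.pi * τ) * Circle.exp (-(2 * Real.pi *
      ((2 * (l : ℝ) + 1) / (4 + 2 * α) + (2 * (l : ℝ) + 1) / (4 + 2 * β) + 1 / 2))) := by
  rw [← Circle.exp_add, Circle.exp_eq_exp, angle]
  refine ⟨-⌊τ - (2 * (l : ℝ) + 1) / (4 + 2 * α) - (2 * (l : ℝ) + 1) / (4 + 2 * β) - 1 / 2⌋, ?_⟩
  rw [Int.fract]
  push_cast
  ring

lemma angle_mem_Ico (α β τ : ℝ) (l : ℕ) : angle α β τ l ∈ Ico 0 Real.pi := by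
  refine ⟨mul_nonneg Real.pi_pos.le (Int.fract_nonneg _), ?_⟩
  exact mul_lt_of_lt_one_right Real.pi_pos (Int.fract_lt_one _)

/-- The infinite atom depends only on `τ` modulo `1`. -/
lemma infiniteAtom_congr (C : ℝ) (ξ : ℝ → ℝ) {τ τ' : ℝ}
    (h : Circle.exp (2 * Real.pi * τ) = Circle.exp (2 * Real.pi * τ')) :
    infiniteAtom α β C ξ τ = infiniteAtom α β C ξ τ' := by
  obtain ⟨m, hm⟩ := Circle.exp_eq_exp.1 h
  have hτ : τ = τ' + m := by
    have := Real.pi_pos.ne'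
    field_simp at hm
    linarith
  have he : angle α β τ = angle α β τ' := by
    ext l
    rw [angle, angle, hτ, show τ' + m - (2 * (l : ℝ) + 1) / (4 + 2 * α) -
      (2 * (l : ℝ) + 1) / (4 + 2 * β) - 1 / 2 = τ' - (2 * (l : ℝ) + 1) / (4 + 2 * α) -
      (2 * (l : ℝ) + 1) / (4 + 2 * β) - 1 / 2 + m by ring, Int.fract_add_intCast]
  rw [infiniteAtom, infiniteAtom, he]

lemma strongResolventTendsto_infiniteAtom (hβ : β < -2) (hC : 0 < C) (hξ : IsLocalizer ξ)
    {ι : Type*} {f : Filter ι} {τ : ι → ℝ} {τ₀ : ℝ}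
    (h : Tendsto (fun i => Circle.exp (2 * Real.pi * τ i)) f
      (𝓝 (Circle.exp (2 * Real.pi * τ₀)))) :
    StrongResolventTendsto (fun i => infiniteAtom α β C ξ (τ i)) f
      (infiniteAtom α β C ξ τ₀) := by
  have h₀ := isSelfAdjointGraph_atomGraph hβ hC hξ (angle α β τ₀)
  rw [atomGraph_eq] at h₀
  rw [infiniteAtom, atomOperator, atomGraph_eq]
  refine strongResolventTendsto_of_graph
    (fun i => isSelfAdjointGraph_atomGraph hβ hC hξ (angle α β (τ i))) h₀ ?_
  rintro _ ⟨l, p, φ, ψ, hp, hq, rfl⟩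
  have hang : Tendsto (fun i => Circle.exp (2 * angle α β (τ i) l)) f
      (𝓝 (Circle.exp (2 * angle α β τ₀ l))) := by
    simp only [exp_two_mul_angle]
    exact h.mul_const _
  obtain ⟨a, ha, hlim⟩ := exists_tendsto_radialGraph hβ hC hξ l hang hq
  refine ⟨fun i => (tensor p (a i).1, tensor p (a i).2),
    fun i => tensor_mem_atomGraph _ hp (ha i), ?_⟩
  exact (((tensor p).continuous.tendsto _).comp hlim.fst_nhds).prodMk_nhds
    (((tensor p).continuous.tendsto _).comp hlim.snd_nhds)

/-! ### Injectivity of the parametrization -/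

lemma isSolidHarmonic_one : IsSolidHarmonic 0 1 :=
  ⟨MvPolynomial.isHomogeneous_one _ _, by simp⟩

lemma sphInner_one_one : sphInner 1 1 ≠ 0 := by
  have h : sphInner 1 1 = (sphMeasure.real univ : ℂ) := by simp [sphInner, polyEval]
  rw [h, Complex.ofReal_ne_zero, measureReal_ne_zero_iff, Measure.measure_univ_ne_zero]
  exact Measure.toSphere_ne_zero _

/-- Two boundary conditions at the origin whose added functions lie in the domain of a common
symmetric operator coincide: the Wronskian of the added functions at the origin is a nonzero
multiple of `sin (θ' - θ)`. -/
lemma eq_of_isSymm_boundary (hβ : β < -2) (hC : 0 < C) (hξ : IsLocalizer ξ) (l : ℕ)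
    {θ θ' : ℝ} (hθ : θ ∈ Ico 0 Real.pi) (hθ' : θ' ∈ Ico 0 Real.pi)
    (h : ∀ q ∈ radialGraph β C ξ l θ, ∀ q' ∈ radialGraph β C ξ l θ',
      (inner ℂ q.2 q'.1 : ℂ) = inner ℂ q.1 q'.2) : θ = θ' := by
  obtain ⟨q, hq1, hq2⟩ := exists_boundaryPair hβ hC hξ l θ
  obtain ⟨q', hq1', hq2'⟩ := exists_boundaryPair hβ hC hξ l θ'
  have hmem : ∀ {θ : ℝ} {q : RadialL2 × RadialL2},
      (∀ᵐ r ∂(volume.restrict (Ioi (0 : ℝ))), q.1 r = boundaryFun β C ξ l θ r) →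
      (∀ᵐ r ∂(volume.restrict (Ioi (0 : ℝ))),
        q.2 r = radialExpr β C l (boundaryFun β C ξ l θ) r) → q ∈ radialGraph β C ξ l θ :=
    fun h1 h2 => Submodule.mem_sup_right (Submodule.subset_span ⟨h1, h2⟩)
  have hlim := tendsto_wronskian β C l (contDiffOn_boundaryFun hβ hC hξ l θ)
    (contDiffOn_boundaryFun hβ hC hξ l θ') hq1 hq2 hq1' hq2'
    (fun r hr => boundaryFun_eq_zero hξ l θ' hr)
  rw [h q (hmem hq1 hq2) q' (hmem hq1' hq2'), sub_self] at hlim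
  obtain ⟨F', G', hF, hG, ⟨w, hw, hW⟩, -⟩ := exists_fundamental_system hβ hC l
  have hder : ∀ (t : ℝ) {r : ℝ}, 0 < r → HasDerivAt (fun r => (boundarySol β C l t r : ℂ))
      ((Real.cos t * F' r + Real.sin t * G' r : ℝ) : ℂ) r := fun t r hr =>
    (((hF r hr).1.const_mul _).add ((hG r hr).1.const_mul _)).ofReal_comp
  have hconst : Tendsto (wronskian (fun r => star (boundaryFun β C ξ l θ r))
      (boundaryFun β C ξ l θ')) (𝓝[>] 0) (𝓝 ((Real.sin (θ' - θ) * w : ℝ) : ℂ)) := by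
    refine tendsto_const_nhds.congr' ?_
    filter_upwards [Ioo_mem_nhdsGT one_pos] with r hr
    have hm := Ioo_mem_nhds hr.1 hr.2
    have e1 : (fun r => star (boundaryFun β C ξ l θ r)) =ᶠ[𝓝 r]
        fun r => (boundarySol β C l θ r : ℂ) := by
      filter_upwards [hm] with s hs
      rw [boundaryFun_eq hξ l θ hs, Complex.star_def, Complex.conj_ofReal]
    have e2 : boundaryFun β C ξ l θ' =ᶠ[𝓝 r] fun r => (boundarySol β C l θ' r : ℂ) := by
      filter_upwards [hm] with s hs using boundaryFun_eq hξ l θ' hs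
    rw [wronskian_congr e1 e2, wronskian, (hder θ hr.1).deriv, (hder θ' hr.1).deriv, ← hW r hr.1,
      Real.sin_sub, boundarySol, boundarySol]
    push_cast
    ring
  have h0 := tendsto_nhds_unique hconst hlim
  rw [Complex.ofReal_eq_zero] at h0
  have h1 := (mul_eq_zero.1 h0).resolve_right hw
  have h2 := (Real.sin_eq_zero_iff_of_lt_of_lt (by linarith [hθ.2, hθ'.1])
    (by linarith [hθ.1, hθ'.2])).1 h1
  linarith

lemma exp_eq_of_infiniteAtom_eq (hβ : β < -2) (hC : 0 < C) (hξ : IsLocalizer ξ) {τ τ' : ℝ}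
    (h : infiniteAtom α β C ξ τ = infiniteAtom α β C ξ τ') :
    Circle.exp (2 * Real.pi * τ) = Circle.exp (2 * Real.pi * τ') := by
  have hg : atomGraph β C ξ (angle α β τ) = atomGraph β C ξ (angle α β τ') := by
    rw [← (isSelfAdjointGraph_atomGraph hβ hC hξ (angle α β τ)).graph_eq,
      ← (isSelfAdjointGraph_atomGraph hβ hC hξ (angle α β τ')).graph_eq]
    exact congrArg LinearPMap.graph h
  have hang : angle α β τ 0 = angle α β τ' 0 := by
    refine eq_of_isSymm_boundary hβ hC hξ 0 (angle_mem_Ico α β τ 0) (angle_mem_Ico α β τ' 0)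
      fun q hq q' hq' => ?_
    have h1 := tensor_mem_atomGraph (angle α β τ) isSolidHarmonic_one hq
    have h2 := tensor_mem_atomGraph (angle α β τ') isSolidHarmonic_one hq'
    rw [← hg] at h2
    have h3 := isSymmGraph_atomGraph hβ hC hξ _ _ h1 _ h2
    rw [inner_tensor, inner_tensor] at h3
    exact mul_left_cancel₀ sphInner_one_one h3
  have h4 := exp_two_mul_angle α β τ 0
  rw [hang, exp_two_mul_angle] at h4
  exact (mul_right_cancel h4).symm

end Continuity

end InfiniteAtom

end

open InfiniteAtom in
theorem corollary3p4 (α β C : ℝ) (hα : -2 < α) (hβ : β < -2) (hC : 0 < C)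
    (ξ : ℝ → ℝ) (hξ : IsLocalizer ξ) :
    (∀ τ : ℝ, (infiniteAtom α β C ξ τ).graph = atomGraph β C ξ (angle α β τ)) ∧
    (∀ (τ : ℕ → ℝ) (τ₀ : ℝ),
      Tendsto (fun n => (τ n : UnitAddCircle)) atTop (𝓝 (τ₀ : UnitAddCircle)) →
      StrongResolventTendsto (fun n => infiniteAtom α β C ξ (τ n)) atTop
        (infiniteAtom α β C ξ τ₀)) ∧
    ∃ K : Circle → SpaceL2 →ₗ.[ℂ] SpaceL2,
      (∀ τ : ℝ, K (Circle.exp (2 * Real.pi * τ)) = infiniteAtom α β C ξ τ) ∧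
      Function.Injective K ∧
      ∀ t₀ : Circle, StrongResolventTendsto K (𝓝 t₀) (K t₀) := by
  have harg : ∀ t : Circle, Circle.exp (2 * Real.pi * (Complex.arg t / (2 * Real.pi))) = t := by
    intro t
    rw [mul_div_cancel₀ _ Real.two_pi_pos.ne', Circle.exp_arg]
  refine ⟨fun τ => (isSelfAdjointGraph_atomGraph hβ hC hξ _).graph_eq, fun τ τ₀ h => ?_,
    fun t => infiniteAtom α β C ξ (Complex.arg t / (2 * Real.pi)), fun τ => ?_, ?_, fun t₀ => ?_⟩
  · refine strongResolventTendsto_infiniteAtom hβ hC hξ ?_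
    have h1 := (AddCircle.continuous_toCircle.tendsto _).comp h
    simpa [Function.comp_def, AddCircle.toCircle_apply_mk] using h1
  · exact infiniteAtom_congr C ξ (harg _)
  · intro t t' h
    have h1 := exp_eq_of_infiniteAtom_eq hβ hC hξ h
    rwa [harg, harg] at h1
  · refine strongResolventTendsto_infiniteAtom hβ hC hξ ?_
    simp only [harg]
    exact tendsto_id
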